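/- **Setting.** A database consists of finite relations $S_1,\dots,S_r$. Relation $S_i$ has a set $X_i$ of key attributes, with values of any type, and $n_i\ge 0$ real-valued data columns $Y_i$. The key attributes are exactly the join attributes, i.e. the attributes that occur in at least two relations; each data column belongs to exactly one relation. The matrix $\mathbf S_i$ lists the tuples of $S_i$, each once, in any order. $\mathbf A$ is the matrix of the natural join (rows in any order) and $\mathbf A[:Y]$ consists of its $N=\sum_i n_i$ data columns. The relations are fully reduced if every input tuple is the projection of a tuple of the natural join. A join tree $\tau$ is a (rooted) tree whose nodes are the $r$ relations such that every node on the path between $S_i$ and $S_j$ has a key containing $X_i\cap X_j$. Let $M=\sum_i|S_i|$. **FiGaRo.** For a matrix $\mathbf B$ with rows $B_1,\dots,B_m$ and a vector $v\in\mathbb R_{>0}^m$ let the head be $\mathcal H(\mathbf B,v)=\frac1{\|v\|}\sum_i v_iB_i$ and let the tail $\mathcal T(\mathbf B,v)$ have the $m-1$ rows $\frac{1}{\|v_{1..j+1}\|}\big(\|v_{1..j}\|B_{j+1}-\frac{v_{j+1}\sum_{i\le j}v_iB_i}{\|v_{1..j}\|}\big)$. For a key tuple $x$, let $\Phi_i^\circ(x)$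 be the number of tuples with key values $x$ on $X_i$ in the join of all relations except $S_i$, and for a value $x$ of the key attributes shared by $S_i$ and its parent let $\Phi_i^\downarrow(x)$ and $\Phi_i^\uparrow(x)$ be the number of tuples with this value in the join of the relations inside, respectively outside, the subtree of $S_i$. FiGaRo first computes these counts in one bottom-up and one top-down pass over $\tau$. Then it proceeds recursively from the root. At node $S_i$: 1. For each key tuple $x$ of $S_i$, let $\mathbf S_i^{x}$ be the data part of the rows of $S_i$ with key $x$. Output $\sqrt{\Phi_i^\circ(x)}\,\mathcal T(\mathbf S_i^x,\mathbf 1)$, padded with zeros; set $\mathrm{Data}[x:Y_i]=\mathcal H(\mathbf S_i^x,\mathbf 1)$ and $\mathrm{scales}[x]=\sqrt{|\mathbf S_i^x|}$. 2. If $S_i$ is not a leaf, process its children $S_j$, obtaining $\mathrm{Data}_j,\mathrm{scales}_j$. For each $x$, with projections $x_{ij}$ to $X_i\cap X_j$: for all $S_k$ in the subtree of $S_j$ set $\mathrm{Data}[x:Y_k]=\mathrm{Data}_j[x_{ij}:Y_k]\cdot\mathrm{scales}[x]\cdot\prod_{j'\ne j}\mathrm{scales}_{j'}[x_{ij'}]$;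 multiply $\mathrm{Data}[x:Y_i]$ and $\mathrm{scales}[x]$ by $\prod_j\mathrm{scales}_j[x_{ij}]$ (products over children of $S_i$). 3. If $S_i$ is neither a leaf nor the root, then for each value $x_p$ of the key attributes shared with the parent, output the tail, multiplied by $\sqrt{\Phi_i^\uparrow(x_p)}$, of the rows of $\mathrm{Data}$ whose keys project to $x_p$, weighted by $\mathrm{scales}$; replace these rows by their weighted head, with new scale $\sqrt{\Phi_i^\downarrow(x_p)}$. 4. At the root, output the rows of $\mathrm{Data}$. $\mathbf R_0$ is the matrix of all output rows. Time is counted on a real random access machine with dictionaries: arithmetic operations and square roots on reals, operations on single key tuples, reading and writing of dictionary and array entries, list appends, loop iterations and recursive calls have unit cost. **Theorem.** There is an absolute constant $C$ such that for all fully reduced relations $S_1,\dots,S_r$ and every join tree $\tau$ of their natural join, FiGaRo returns a matrix $\mathbf R_0$ with the following properties. (0) If $M>0$, the running time is at most $C\,M(N+r)$. It is at most $C\,MN$ if every relation has at least one data column, and at most $C\,r\,MN$ if $N>0$; so it is $\mathcal O(MN)$. (1) $\mathbf R_0$ has at most $M$ rows. (2) $\mathbf R_0$ has at most $|\mathbf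 A|$ rows and there is an orthogonal $|\mathbf A|\times|\mathbf A|$ matrix $\mathbf Q$ with $\mathbf A[:Y]=\mathbf Q\begin{bmatrix}\mathbf R_0\\ \mathbf 0\end{bmatrix}$. (3) There is a finite sequence of Givens rotations whose application to $\mathbf A[:Y]$ produces the matrix $\begin{bmatrix}\mathbf R_0\\ \mathbf 0\end{bmatrix}$ up to a permutation of its rows. -/

import Mathlib

namespace Figaro

/-! ## Schemas, relations, natural join -/

/-- The schema of `r` relations over a set `κ` of key attributes. Relation `i` has the key
attributes `key i` and `width i` data columns. The key attributes are exactly the join attributes,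
that is, the attributes that occur in at least two relations; every data column belongs to
exactly one relation. -/
structure Schema (r : ℕ) (κ : Type) where
  key : Fin r → Finset κ
  width : Fin r → ℕ
  shared : ∀ a, ∃ i j, i ≠ j ∧ a ∈ key i ∧ a ∈ key j

variable {r : ℕ} {κ V : Type}

/-- The tuples `(x, y)` of relation `i`: key values of an arbitrary type `V`, and real data. -/
abbrev Schema.Tuple (σ : Schema r κ) (V : Type) (i : Fin r) : Type :=
  (σ.key i → V) × (Fin (σ.width i) → ℝ)

/-- The input matrices: for every relation the list of its rows, in an arbitrary order. -/
abbrev Schema.Database (σ : Schema r κ) (V : Type) : Type :=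
  ∀ i, List (σ.Tuple V i)

/-- A row over all data columns of all relations. -/
abbrev Schema.Row (σ : Schema r κ) : Type :=
  ∀ i : Fin r, Fin (σ.width i) → ℝ

/-- The data columns of all relations. -/
abbrev Schema.Col (σ : Schema r κ) : Type :=
  Σ i : Fin r, Fin (σ.width i)

/-- Tuples over all key attributes and all data columns. -/
abbrev Schema.JoinTuple (σ : Schema r κ) (V : Type) : Type :=
  (κ → V) × σ.Row

/-- The projection of a tuple onto the attributes of relation `i`. -/
def Schema.JoinTuple.proj {σ : Schema r κ} (t : σ.JoinTuple V) (i : Fin r) : σ.Tuple V i :=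
  (fun a => t.1 a, t.2 i)

/-- The natural join of all relations. -/
def natJoin {σ : Schema r κ} (S : σ.Database V) : Set (σ.JoinTuple V) :=
  {t | ∀ i, Schema.JoinTuple.proj t i ∈ S i}

/-- The natural join is finite, so its rows can be enumerated. -/
theorem natJoin_finite {σ : Schema r κ} (S : σ.Database V) : (natJoin S).Finite := by
  classical
  let f : natJoin S → ∀ i, {t // t ∈ S i} := fun t i => ⟨Schema.JoinTuple.proj t.1 i, t.2 i⟩
  have hf : Function.Injective f := by
    intro s t h
    have h' : ∀ i, Schema.JoinTuple.proj s.1 i = Schema.JoinTuple.proj t.1 i := fun i =>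
      congrArg Subtype.val (congrFun h i)
    apply Subtype.ext
    apply Prod.ext
    · funext a
      obtain ⟨i, _, _, hi, _⟩ := σ.shared a
      exact congrFun (congrArg Prod.fst (h' i)) ⟨a, hi⟩
    · funext i
      exact congrArg Prod.snd (h' i)
  have : ∀ i, Finite {t // t ∈ S i} := fun i => (List.finite_toSet (S i)).to_subtype
  exact Set.finite_coe_iff.mp (Finite.of_injective f hf)

/-- No input tuple is dangling: each one is the projection of a tuple in the join output. -/
def FullyReduced {σ : Schema r κ} (S : σ.Database V) : Prop :=
  ∀ i, ∀ t ∈ S i, ∃ u ∈ natJoin S, Schema.JoinTuple.proj u i = t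

/-- `M`: the overall number of input rows. -/
def numRows {σ : Schema r κ} (S : σ.Database V) : ℕ := ∑ i, (S i).length

/-- `N`: the overall number of data columns. -/
def numCols (σ : Schema r κ) : ℕ := ∑ i, σ.width i

/-- The matrix `A[: Y]`: the data columns of the join output, whose rows are listed by `e`. -/
def joinMatrix {σ : Schema r κ} {S : σ.Database V} {m : ℕ} (e : Fin m ≃ natJoin S) :
    Matrix (Fin m) σ.Col ℝ :=
  Matrix.of fun a c => (e a).1.2 c.1 c.2

/-- The matrix with `m` rows that consists of the rows in the list `R`, followed by zero rows. -/
def stackZero {σ : Schema r κ} (R : List σ.Row) (m : ℕ) : Matrix (Fin m) σ.Col ℝ :=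
  Matrix.of fun a c => if h : (a : ℕ) < R.length then R[(a : ℕ)] c.1 c.2 else 0

/-- The Givens rotation in the coordinates `i`, `j` by the angle `θ`. -/
noncomputable def givens {m : ℕ} (i j : Fin m) (θ : ℝ) : Matrix (Fin m) (Fin m) ℝ :=
  Matrix.of fun a b =>
    if a = i ∧ b = i then Real.cos θ
    else if a = j ∧ b = j then Real.cos θ
    else if a = i ∧ b = j then -Real.sin θ
    else if a = j ∧ b = i then Real.sin θ
    else if a = b then 1 else 0

/-! ## Join trees -/

/-- Finite ordered forests: `node a children siblings` is the forest whose first tree has the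
root label `a` and the subtrees `children`, and whose other trees are `siblings`. -/
inductive Forest (α : Type) : Type where
  | nil : Forest α
  | node (a : α) (children siblings : Forest α) : Forest α

namespace Forest

/-- The labels of the roots of the trees of a forest. -/
def roots {α : Type} : Forest α → List α
  | nil => []
  | node a _ rest => a :: rest.roots

/-- All labels of a forest. -/
def labels {α : Type} : Forest α → List α
  | nil => []
  | node a cs rest => a :: (cs.labels ++ rest.labels)

/-- The pairs (parent, child), where `p` is the parent of the roots of the forest. -/
def edges {α : Type} : α → Forest α → List (α × α)
  | _, nil => []
  | p, node a cs rest => (p, a) :: (edges a cs ++ edges p rest)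

end Forest

/-- Rooted trees. -/
structure RootedTree (α : Type) where
  root : α
  children : Forest α

/-- The labels of all nodes. -/
def RootedTree.labels {α : Type} (τ : RootedTree α) : List α := τ.root :: τ.children.labels

/-- The undirected graph of a rooted tree. -/
def RootedTree.graph {α : Type} (τ : RootedTree α) : SimpleGraph α :=
  SimpleGraph.fromRel fun a b => (a, b) ∈ τ.children.edges τ.root

/-- `τ` is a join tree: each relation is exactly one node, and all nodes on the path between
relations `i` and `j` contain the key attributes that `i` and `j` have in common. -/
structure IsJoinTree [DecidableEq κ] (σ : Schema r κ) (τ : RootedTree (Fin r)) : Prop where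
  nodup : τ.labels.Nodup
  mem_labels : ∀ i, i ∈ τ.labels
  path : ∀ (i j : Fin r) (w : τ.graph.Walk i j), w.IsPath →
    ∀ k ∈ w.support, σ.key i ∩ σ.key j ⊆ σ.key k

/-! ## Computations with a step count

The cost model is a real random access machine with dictionaries: arithmetic operations and
square roots on real numbers, reading, projecting and storing a key tuple, reading and writing a
dictionary entry, reading and writing a cell of an array, appending an entry to a list, every
iteration of a loop (and leaving the loop) and every recursive call take one step each. Only
passing on references (pairs, constants, pattern matching) is free. -/

/-- A result together with the number of steps that were made to compute it. -/
structure Timed (α : Type) : Type where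
  val : α
  steps : ℕ

instance : Monad Timed where
  pure a := ⟨a, 0⟩
  bind x f := ⟨(f x.val).val, x.steps + (f x.val).steps⟩

/-- One step without a result. -/
def tick : Timed Unit := ⟨(), 1⟩

def add (a b : ℝ) : Timed ℝ := ⟨a + b, 1⟩

noncomputable def sub (a b : ℝ) : Timed ℝ := ⟨a - b, 1⟩

def mul (a b : ℝ) : Timed ℝ := ⟨a * b, 1⟩

noncomputable def div (a b : ℝ) : Timed ℝ := ⟨a / b, 1⟩

noncomputable def sqrt (a : ℝ) : Timed ℝ := ⟨Real.sqrt a, 1⟩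

/-- Append an entry at the end of a list. -/
def push {α : Type} (l : List α) (a : α) : Timed (List α) := ⟨l ++ [a], 1⟩

/-- Read a cell of a row. -/
def cell {σ : Schema r κ} (v : σ.Row) (i : Fin r) (c : Fin (σ.width i)) : Timed ℝ := ⟨v i c, 1⟩

/-- Replace the block of a row that belongs to relation `i` by (a reference to) the array `b`. -/
def setBlock {σ : Schema r κ} (v : σ.Row) (i : Fin r) (b : Fin (σ.width i) → ℝ) :
    Timed σ.Row := ⟨Function.update v i b, 1⟩

/-- Go through a list, changing a state. -/
def loop {α β : Type} (f : β → α → Timed β) : List α → β → Timed β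
  | [], b => ⟨b, 1⟩
  | a :: l, b => do
    tick
    let b' ← f b a
    loop f l b'

/-- Fill an array, one entry after the other. -/
def tabulate {n : ℕ} {α : Fin n → Type} (f : ∀ i, Timed (α i)) : Timed (∀ i, α i) :=
  ⟨fun i => (f i).val, 1 + ∑ i, (1 + (f i).steps)⟩

/-- Key tuples over any set of key attributes, `none` at the attributes outside this set. -/
abbrev KeyTuple (κ V : Type) : Type := κ → Option V

/-- The key tuple of a row of relation `i`. -/
def keyOf [DecidableEq κ] {σ : Schema r κ} {i : Fin r} (t : σ.Tuple V i) :
    Timed (KeyTuple κ V) :=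
  ⟨fun a => if h : a ∈ σ.key i then some (t.1 ⟨a, h⟩) else none, 1⟩

/-- The projection of a key tuple onto those of its attributes that are in `X`. -/
def project [DecidableEq κ] (X : Finset κ) (x : KeyTuple κ V) : Timed (KeyTuple κ V) :=
  ⟨fun a => if a ∈ X then x a else none, 1⟩

/-- Dictionaries: the list of the keys that have been written so far, in the order of their first
occurrence, and the value of each key (a default value for the other keys). -/
structure Dict (K β : Type) : Type where
  keys : List K
  get : K → β

namespace Dict

/-- The empty dictionary with default value `b`. -/
def empty {K β : Type} (b : β) : Dict K β := ⟨[], fun _ => b⟩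

def lookup {K β : Type} (d : Dict K β) (k : K) : Timed β := ⟨d.get k, 1⟩

def insert {K β : Type} [DecidableEq K] (d : Dict K β) (k : K) (b : β) : Timed (Dict K β) :=
  ⟨⟨if k ∈ d.keys then d.keys else d.keys ++ [k], Function.update d.get k b⟩, 1⟩

end Dict

/-- Dictionaries that are indexed by key tuples. -/
abbrev KeyDict (κ V β : Type) : Type := Dict (KeyTuple κ V) β

/-! ## The count queries -/

/-- What the first pass stores for relation `idx`: the number of its rows per key tuple, the size
of the join of the relations in its subtree per key tuple (`theta`), and the same size per value
of the attributes that are shared with its parent (`down`; unused at the root). -/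
structure Counts₁ (r : ℕ) (κ V : Type) : Type where
  idx : Fin r
  rowsPerKey : KeyDict κ V ℝ
  theta : KeyDict κ V ℝ
  down : KeyDict κ V ℝ

/-- What the second pass stores in addition: the size of the join of the relations outside the
subtree of relation `idx` per value of the attributes that are shared with its parent (`up`;
unused at the root), and the size of the join of all other relations per key tuple (`circ`). -/
structure Counts₂ (r : ℕ) (κ V : Type) : Type where
  idx : Fin r
  rowsPerKey : KeyDict κ V ℝ
  down : KeyDict κ V ℝ
  up : KeyDict κ V ℝ
  circ : KeyDict κ V ℝ

section Program

variable [Fintype κ] [DecidableEq κ] [DecidableEq V]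

/-- Counts the rows of relation `i` per key tuple. -/
noncomputable def countRows {σ : Schema r κ} (S : σ.Database V) (i : Fin r) :
    Timed (KeyDict κ V ℝ) :=
  loop (fun d t => do
    let x ← keyOf t
    let c ← d.lookup x
    let c' ← add c 1
    d.insert x c') (S i) (Dict.empty 0)

/-- `theta x = rowsPerKey x * ∏ down_j (projection of x)`, the product over the children `j`. -/
noncomputable def computeTheta (σ : Schema r κ) (rowsPerKey : KeyDict κ V ℝ)
    (children : List (Counts₁ r κ V)) : Timed (KeyDict κ V ℝ) :=
  loop (fun d x => do
    let c ← rowsPerKey.lookup x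
    let c' ← loop (fun c b => do
      let y ← project (σ.key b.idx) x
      let f ← b.down.lookup y
      mul c f) children c
    d.insert x c') rowsPerKey.keys (Dict.empty 0)

/-- Sums up the values of a dictionary over all keys with the same projection onto `X`. -/
noncomputable def sumOver (X : Finset κ) (d : KeyDict κ V ℝ) : Timed (KeyDict κ V ℝ) :=
  loop (fun e x => do
    let y ← project X x
    let c ← d.lookup x
    let s ← e.lookup y
    let s' ← add s c
    e.insert y s') d.keys (Dict.empty 0)

/-- First pass (bottom-up) over the subtrees of the children of relation `p`. -/
noncomputable def pass₁ {σ : Schema r κ} (S : σ.Database V) :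
    Fin r → Forest (Fin r) → Timed (Forest (Counts₁ r κ V))
  | _, .nil => do
    tick
    pure .nil
  | p, .node i cs rest => do
    tick
    let cs' ← pass₁ S i cs
    let rowsPerKey ← countRows S i
    let theta ← computeTheta σ rowsPerKey cs'.roots
    let down ← sumOver (σ.key p) theta
    let rest' ← pass₁ S p rest
    pure (.node ⟨i, rowsPerKey, theta, down⟩ cs' rest')

/-- Multiplies `theta x` by the count `up` of the projection of `x` onto `X`. -/
noncomputable def applyUp (X : Finset κ) (up theta : KeyDict κ V ℝ) : Timed (KeyDict κ V ℝ) :=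
  loop (fun d x => do
    let y ← project X x
    let u ← up.lookup y
    let c ← theta.lookup x
    let f ← mul c u
    d.insert x f) theta.keys (Dict.empty 0)

/-- Pointwise quotient of two dictionaries. -/
noncomputable def divide (d e : KeyDict κ V ℝ) : Timed (KeyDict κ V ℝ) :=
  loop (fun q x => do
    let a ← d.lookup x
    let b ← e.lookup x
    let c ← div a b
    q.insert x c) d.keys (Dict.empty 0)

/-- Second pass (top-down) over the subtrees of the children of relation `p`, where `full` is the
size of the join of all relations per key tuple of `p`. -/
noncomputable def pass₂ (σ : Schema r κ) :
    Fin r → KeyDict κ V ℝ → Forest (Counts₁ r κ V) → Timed (Forest (Counts₂ r κ V))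
  | _, _, .nil => do
    tick
    pure .nil
  | p, full, .node b cs rest => do
    tick
    let sums ← sumOver (σ.key b.idx) full
    let up ← divide sums b.down
    let full' ← applyUp (σ.key p) up b.theta
    let circ ← divide full' b.rowsPerKey
    let cs' ← pass₂ σ b.idx full' cs
    let rest' ← pass₂ σ p full rest
    pure (.node ⟨b.idx, b.rowsPerKey, b.down, up, circ⟩ cs' rest')

/-- All count queries, stored at the nodes of the join tree. -/
noncomputable def computeCounts {σ : Schema r κ} (S : σ.Database V) (τ : RootedTree (Fin r)) :
    Timed (RootedTree (Counts₂ r κ V)) := do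
  tick
  let cs₁ ← pass₁ S τ.root τ.children
  let rowsPerKey ← countRows S τ.root
  let theta ← computeTheta σ rowsPerKey cs₁.roots
  let circ ← divide theta rowsPerKey
  let cs₂ ← pass₂ σ τ.root theta cs₁
  pure ⟨⟨τ.root, rowsPerKey, Dict.empty 0, Dict.empty 0, circ⟩, cs₂⟩

/-! ## Heads and tails -/

/-- The loop of `headTail`. Here `q` is the sum of the squares of the weights of the rows that
have been read, and `s` is the weighted sum of these rows. With weights `v₁, v₂, …` and rows
`A₁, A₂, …`, the head is `(∑ i, vᵢ Aᵢ) / ‖v‖` and row `j` of the tail is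
`(‖(v₁, …, vⱼ)‖ Aⱼ₊₁ - vⱼ₊₁ (∑ i ≤ j, vᵢ Aᵢ) / ‖(v₁, …, vⱼ)‖) / ‖(v₁, …, vⱼ₊₁)‖`. -/
noncomputable def headTailLoop {σ : Schema r κ} (k : ℝ) :
    List (ℝ × σ.Row) → ℝ → σ.Row → List σ.Row → Timed (σ.Row × List σ.Row)
  | [], q, s, out => do
    tick
    let n ← sqrt q
    let h ← tabulate fun i => tabulate fun c => do
      let a ← cell s i c
      div a n
    pure (h, out)
  | (v, w) :: l, q, s, out => do
    tick
    let n ← sqrt q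
    let v2 ← mul v v
    let q' ← add q v2
    let n' ← sqrt q'
    let t ← tabulate fun i => tabulate fun c => do
      let a ← cell w i c
      let b ← cell s i c
      let na ← mul n a
      let vb ← mul v b
      let vbn ← div vb n
      let d ← sub na vbn
      let e ← div d n'
      mul k e
    let out' ← push out t
    let s' ← tabulate fun i => tabulate fun c => do
      let a ← cell w i c
      let b ← cell s i c
      let va ← mul v a
      add b va
    headTailLoop k l q' s' out'

/-- The generalized head of the matrix whose rows, with positive weights, are listed in the first
argument after `k`; the rows of its generalized tail, scaled by `k`, are appended to `out`. -/
noncomputable def headTail {σ : Schema r κ} (k : ℝ) :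
    List (ℝ × σ.Row) → List σ.Row → Timed (σ.Row × List σ.Row)
  | [], out => do
    tick
    pure (fun _ _ => 0, out)
  | (v, w) :: l, out => do
    tick
    let q ← mul v v
    let s ← tabulate fun i => tabulate fun c => do
      let a ← cell w i c
      mul v a
    headTailLoop k l q s out

/-! ## The algorithm -/

/-- The working state at a node: the matrix `data` and the vector `scales`, with one row (one
entry) per key tuple, and the matrix `out`. The rows of `data` are zero outside of the columns of
the relations in the subtree of the node. The matrix `out` is passed on through the recursive
calls, which append their rows to it. -/
structure State (σ : Schema r κ) (V : Type) : Type where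
  data : KeyDict κ V σ.Row
  scales : KeyDict κ V ℝ
  out : List σ.Row

/-- What remains of a processed subtree: its root, the relations in it, `data` and `scales`. -/
structure Result (σ : Schema r κ) (V : Type) : Type where
  idx : Fin r
  nodes : List (Fin r)
  data : KeyDict κ V σ.Row
  scales : KeyDict κ V ℝ

/-- The data values of a row of relation `i`, in a row with zeros in all other columns. -/
noncomputable def padRow {σ : Schema r κ} {i : Fin r} (t : σ.Tuple V i) : Timed σ.Row := do
  let z ← tabulate fun j => tabulate fun _ : Fin (σ.width j) => pure (0 : ℝ)
  let b ← tabulate fun c => (⟨t.2 c, 1⟩ : Timed ℝ)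
  setBlock z i b

/-- The rows of relation `i`, with weight one, grouped by key tuple. -/
noncomputable def groupRows {σ : Schema r κ} (S : σ.Database V) (i : Fin r) :
    Timed (KeyDict κ V (List (ℝ × σ.Row))) :=
  loop (fun d t => do
    let x ← keyOf t
    let w ← padRow t
    let g ← d.lookup x
    let g' ← push g (1, w)
    d.insert x g') (S i) (Dict.empty [])

/-- Replaces every group of weighted rows by its generalized head and appends its generalized
tail, scaled by the square root of `tailCount`, to `out`; the new scales are the square roots
of `headCount`. With all weights one these are the head and the tail of the group. -/
noncomputable def reduceGroups {σ : Schema r κ} (groups : KeyDict κ V (List (ℝ × σ.Row)))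
    (tailCount headCount : KeyDict κ V ℝ) (out : List σ.Row) : Timed (State σ V) :=
  loop (fun st x => do
    let g ← groups.lookup x
    let c ← tailCount.lookup x
    let k ← sqrt c
    let ht ← headTail k g st.out
    let data ← st.data.insert x ht.1
    let c' ← headCount.lookup x
    let s ← sqrt c'
    let scales ← st.scales.insert x s
    pure ⟨data, scales, ht.2⟩) groups.keys ⟨Dict.empty (fun _ _ => 0), Dict.empty 0, out⟩

/-- Heads and tails of the rows of a relation, grouped by key tuple. -/
noncomputable def headsAndTails {σ : Schema r κ} (S : σ.Database V) (b : Counts₂ r κ V)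
    (out : List σ.Row) : Timed (State σ V) := do
  let groups ← groupRows S b.idx
  reduceGroups groups b.circ b.rowsPerKey out

/-- Joins `data` with the results for the children of relation `i` and applies the scaling
factors. The product of the scales of all children but one is computed as a quotient. -/
noncomputable def joinChildren {σ : Schema r κ} (i : Fin r) (children : List (Result σ V))
    (st : State σ V) : Timed (State σ V) :=
  loop (fun st x => do
    let s ← st.scales.lookup x
    let w ← st.data.lookup x
    let p ← loop (fun p (b : Result σ V) => do
      let y ← project (σ.key b.idx) x
      let f ← b.scales.lookup y
      mul p f) children 1
    let sp ← mul s p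
    let own ← tabulate fun c => do
      let a ← cell w i c
      mul a p
    let w₁ ← setBlock w i own
    let w₂ ← loop (fun w (b : Result σ V) => do
      let y ← project (σ.key b.idx) x
      let f ← b.scales.lookup y
      let g ← div sp f
      let u ← b.data.lookup y
      loop (fun w k => do
        let blk ← tabulate fun c => do
          let a ← cell u k c
          mul a g
        setBlock w k blk) b.nodes w) children w₁
    let data ← st.data.insert x w₂
    let scales ← st.scales.insert x sp
    pure ⟨data, scales, st.out⟩) st.data.keys st

/-- Reduces `data` to one row per value of the attributes shared with the parent `p`. -/
noncomputable def projectAway {σ : Schema r κ} (p : Fin r) (b : Counts₂ r κ V)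
    (st : State σ V) : Timed (State σ V) := do
  let groups ← loop (fun d x => do
    let y ← project (σ.key p) x
    let v ← st.scales.lookup x
    let w ← st.data.lookup x
    let g ← d.lookup y
    let g' ← push g (v, w)
    d.insert y g') st.data.keys (Dict.empty ([] : List (ℝ × σ.Row)))
  reduceGroups groups b.up b.down st.out

/-- The relations in the subtree with root `i`. -/
def collectNodes {σ : Schema r κ} (i : Fin r) (children : List (Result σ V)) :
    Timed (List (Fin r)) :=
  loop (fun l (b : Result σ V) => loop (fun l k => push l k) b.nodes l) children [i]

/-- The recursive calls for the children of relation `p`. -/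
noncomputable def processForest {σ : Schema r κ} (S : σ.Database V) :
    Fin r → Forest (Counts₂ r κ V) → List σ.Row → Timed (List (Result σ V) × List σ.Row)
  | _, .nil, out => do
    tick
    pure ([], out)
  | p, .node b cs rest, out => do
    tick
    let st ← headsAndTails S b out
    let sub ← processForest S b.idx cs st.out
    let nodes ← collectNodes b.idx sub.1
    let st' ← match sub.1 with
      | [] => pure st
      | _ :: _ => do
        let st₁ ← joinChildren b.idx sub.1 ⟨st.data, st.scales, sub.2⟩
        projectAway p b st₁
    let others ← processForest S p rest st'.out
    pure (⟨b.idx, nodes, st'.data, st'.scales⟩ :: others.1, others.2)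

/-- FiGaRo, called for the root of the join tree `τ`: the rows of the matrix `R₀`. -/
noncomputable def figaro {σ : Schema r κ} (S : σ.Database V) (τ : RootedTree (Fin r)) :
    Timed (List σ.Row) := do
  tick
  let t ← computeCounts S τ
  let st ← headsAndTails S t.root []
  let sub ← processForest S t.root.idx t.children st.out
  let st' ← joinChildren t.root.idx sub.1 ⟨st.data, st.scales, sub.2⟩
  loop (fun out x => do
    let w ← st'.data.lookup x
    push out w) st'.data.keys st'.out

end Program

end Figaro

namespace Figaro

variable {r : ℕ} {κ V : Type}

/-! ## Evaluation of timed computations -/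

namespace Timed

variable {α β : Type}

/-! Call the sum of `(f w) ^ 2` over a family of rows its energy for the linear functional `f`. Two
matrices with `m` rows whose energies agree for every `f` differ by an orthogonal factor on the left
(`exists_orthogonal_mul_eq`). The decomposition therefore only requires that the output and the join
have equal energies (`figaro_val`).

A join row is the sum of the zero-padded data of the tuples it consists of. Along the tree the join
is thus built from disjoint unions over key tuples and from Minkowski sums `sumset`, because
subtrees are chosen independently once the key tuple of their parent is fixed. `map_natJoin`
identifies this with the natural join; there the path condition of join trees turns matching along
edges into matching everywhere.

The energy of a finite family is its cardinality times its variance plus `f(sum)² / card`. Variances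
add under `sumset` (`variance_sumset`), and unions obey the law of total variance. A tail carries
exactly the variance part and a head the remaining mean part (`headTail_val`), so sums and
cardinalities of families are all that `data` and `scales` have to store. By `processForest_val` the
output for a forest has the energy of all variances in it, each weighted by the number of join rows
concerned; the rows output at the root supply the mean part. The counts enter only through the
cancellations in `sum_upCount`, `sum_circ_add` and `sum_fullCount`. Leaves may skip the projection
to the parent, because a leaf of a join tree has no key attribute outside the key of its parent
(`IsJoinTree.leafKeys`).

The output has at most as many rows as the join because `a + b ≤ a * b + 1` for positive integers,
propagated through the tree (`outLength_add_le`). For the rotations, Givens matrices reduce any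
orthogonal matrix to a permutation matrix (`exists_givens_permutation`): a remaining sign is
absorbed by a quarter turn, which needs two coordinates, so a join with a single row is treated
directly. For the running time, the work at a node is charged to its rows at `numCols σ + r` steps
per row, except that the top-down pass is charged `numRows S` per node. -/

@[simp] theorem val_bind (x : Timed α) (f : α → Timed β) : (x >>= f).val = (f x.val).val := rfl

@[simp] theorem steps_bind (x : Timed α) (f : α → Timed β) :
    (x >>= f).steps = x.steps + (f x.val).steps := rfl

@[simp] theorem val_pure (a : α) : (pure a : Timed α).val = a := rfl

@[simp] theorem steps_pure (a : α) : (pure a : Timed α).steps = 0 := rfl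

theorem bind_congr (x : Timed α) {f g : α → Timed β} (h : ∀ a, f a = g a) :
    x >>= f = x >>= g := congrArg _ (funext h)

theorem bind_assoc {γ : Type} (x : Timed α) (f : α → Timed β) (g : β → Timed γ) :
    (x >>= f) >>= g = x >>= fun a => f a >>= g :=
  congrArg (Timed.mk _) (Nat.add_assoc _ _ _)

end Timed

@[simp] theorem steps_tick : tick.steps = 1 := rfl
@[simp] theorem val_add (a b : ℝ) : (add a b).val = a + b := rfl
@[simp] theorem steps_add (a b : ℝ) : (add a b).steps = 1 := rfl
@[simp] theorem val_sub (a b : ℝ) : (sub a b).val = a - b := rfl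
@[simp] theorem steps_sub (a b : ℝ) : (sub a b).steps = 1 := rfl
@[simp] theorem val_mul (a b : ℝ) : (mul a b).val = a * b := rfl
@[simp] theorem steps_mul (a b : ℝ) : (mul a b).steps = 1 := rfl
@[simp] theorem val_div (a b : ℝ) : (div a b).val = a / b := rfl
@[simp] theorem steps_div (a b : ℝ) : (div a b).steps = 1 := rfl
@[simp] theorem val_sqrt (a : ℝ) : (sqrt a).val = Real.sqrt a := rfl
@[simp] theorem steps_sqrt (a : ℝ) : (sqrt a).steps = 1 := rfl

@[simp] theorem val_push {α : Type} (l : List α) (a : α) : (push l a).val = l ++ [a] := rfl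
@[simp] theorem steps_push {α : Type} (l : List α) (a : α) : (push l a).steps = 1 := rfl

@[simp] theorem val_cell {σ : Schema r κ} (v : σ.Row) (i : Fin r) (c : Fin (σ.width i)) :
    (cell v i c).val = v i c := rfl
@[simp] theorem steps_cell {σ : Schema r κ} (v : σ.Row) (i : Fin r) (c : Fin (σ.width i)) :
    (cell v i c).steps = 1 := rfl

@[simp] theorem val_setBlock {σ : Schema r κ} (v : σ.Row) (i : Fin r)
    (b : Fin (σ.width i) → ℝ) : (setBlock v i b).val = Function.update v i b := rfl
@[simp] theorem steps_setBlock {σ : Schema r κ} (v : σ.Row) (i : Fin r)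
    (b : Fin (σ.width i) → ℝ) : (setBlock v i b).steps = 1 := rfl

@[simp] theorem val_tabulate {n : ℕ} {α : Fin n → Type} (f : ∀ i, Timed (α i)) :
    (tabulate f).val = fun i => (f i).val := rfl
@[simp] theorem steps_tabulate {n : ℕ} {α : Fin n → Type} (f : ∀ i, Timed (α i)) :
    (tabulate f).steps = 1 + ∑ i, (1 + (f i).steps) := rfl

@[simp] theorem Dict.val_lookup {K β : Type} (d : Dict K β) (k : K) :
    (d.lookup k).val = d.get k := rfl
@[simp] theorem Dict.steps_lookup {K β : Type} (d : Dict K β) (k : K) :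
    (d.lookup k).steps = 1 := rfl
@[simp] theorem Dict.steps_insert {K β : Type} [DecidableEq K] (d : Dict K β) (k : K) (b : β) :
    (d.insert k b).steps = 1 := rfl
@[simp] theorem Dict.get_insert {K β : Type} [DecidableEq K] (d : Dict K β) (k : K) (b : β) :
    (d.insert k b).val.get = Function.update d.get k b := rfl
@[simp] theorem Dict.get_empty {K β : Type} (b : β) (k : K) :
    (Dict.empty b : Dict K β).get k = b := rfl
@[simp] theorem Dict.keys_empty {K β : Type} (b : β) :
    (Dict.empty b : Dict K β).keys = [] := rfl

@[simp] theorem steps_keyOf [DecidableEq κ] {σ : Schema r κ} {i : Fin r} (t : σ.Tuple V i) :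
    (keyOf t).steps = 1 := rfl
@[simp] theorem steps_project [DecidableEq κ] (X : Finset κ) (x : KeyTuple κ V) :
    (project X x).steps = 1 := rfl

theorem loop_val {α β : Type} (f : β → α → Timed β) (l : List α) (b : β) :
    (loop f l b).val = l.foldl (fun b a => (f b a).val) b := by
  induction l generalizing b with
  | nil => rfl
  | cons a l ih => exact ih _

theorem loop_steps_le {α β : Type} (P : β → Prop) (c : α → ℕ) (f : β → α → Timed β)
    (l : List α) (b : β) (hb : P b)
    (h : ∀ a ∈ l, ∀ b, P b → P (f b a).val ∧ (f b a).steps ≤ c a) :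
    (loop f l b).steps ≤ 1 + (l.map fun a => 1 + c a).sum := by
  induction l generalizing b with
  | nil => simp [loop]
  | cons a l ih =>
    have h1 := h a (by simp) b hb
    have h2 := ih _ h1.1 fun a' ha' => h a' (by simp [ha'])
    simp only [loop, Timed.steps_bind, steps_tick, List.map_cons, List.sum_cons]
    omega

theorem loop_steps_le_const {α β : Type} (c : ℕ) (f : β → α → Timed β) (l : List α) (b : β)
    (h : ∀ a ∈ l, ∀ b, (f b a).steps ≤ c) :
    (loop f l b).steps ≤ 1 + l.length * (1 + c) := by
  refine (loop_steps_le (fun _ => True) (fun _ => c) f l b trivial fun a ha b _ =>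
    ⟨trivial, h a ha b⟩).trans ?_
  simp

/-- Every relation costs two steps of overhead, even if it has no data column. This `2 * r` is one
reason why the general time bound has the factor `N + r` instead of `N`. -/
theorem steps_grid {σ : Schema r κ} (f : ∀ i, Fin (σ.width i) → Timed ℝ) (k : ℕ)
    (h : ∀ i c, (f i c).steps = k) :
    (tabulate fun i => tabulate (f i)).steps = 1 + 2 * r + (1 + k) * numCols σ := by
  simp only [steps_tabulate, h, Finset.sum_const, Finset.card_univ, Fintype.card_fin, numCols,
    Finset.sum_add_distrib, smul_eq_mul, Finset.mul_sum]
  simp only [mul_comm, mul_one, add_mul, Finset.sum_add_distrib]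
  ring

/-! ## The contents of dictionaries -/

namespace Dict

variable {K β : Type}

/-- The dictionary `d` has the set of keys `s` and the values `g`. -/
structure Represents (d : Dict K β) (s : Finset K) (g : K → β) : Prop where
  nodup : d.keys.Nodup
  mem_keys : ∀ k, k ∈ d.keys ↔ k ∈ s
  get_eq : ∀ k, d.get k = g k

theorem represents_empty (b : β) : (empty b : Dict K β).Represents ∅ fun _ => b :=
  ⟨by simp, by simp, by simp⟩

theorem Represents.congr {d : Dict K β} {s t : Finset K} {f g : K → β} (h : d.Represents s f)
    (hst : s = t) (hfg : ∀ k, f k = g k) : d.Represents t g :=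
  ⟨h.nodup, hst ▸ h.mem_keys, fun k => (h.get_eq k).trans (hfg k)⟩

variable [DecidableEq K]

theorem Represents.toFinset {d : Dict K β} {s : Finset K} {g : K → β} (h : d.Represents s g) :
    d.keys.toFinset = s := by
  ext k
  simp [h.mem_keys]

theorem Represents.length_keys {d : Dict K β} {s : Finset K} {g : K → β}
    (h : d.Represents s g) : d.keys.length = s.card := by
  rw [← h.toFinset, List.toFinset_card_of_nodup h.nodup]

theorem Represents.sum_keys {d : Dict K β} {s : Finset K} {g : K → β} (h : d.Represents s g)
    {M : Type*} [AddCommMonoid M] (f : K → M) : (d.keys.map f).sum = ∑ k ∈ s, f k := by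
  rw [← h.toFinset, List.sum_toFinset _ h.nodup]

theorem Represents.insert {d : Dict K β} {s : Finset K} {g : K → β} (h : d.Represents s g)
    (k : K) (b : β) :
    (d.insert k b).val.Represents (s ∪ {k}) (Function.update g k b) := by
  refine ⟨?_, fun a => ?_, fun a => ?_⟩
  · change (if k ∈ d.keys then d.keys else d.keys ++ [k]).Nodup
    split_ifs with hk
    · exact h.nodup
    · exact h.nodup.append (by simp) (by simpa using hk)
  · change (a ∈ if k ∈ d.keys then d.keys else d.keys ++ [k]) ↔ _
    split_ifs with hk
    · have := (h.mem_keys k).1 hk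
      simp only [h.mem_keys, Finset.mem_union, Finset.mem_singleton]
      constructor
      · exact Or.inl
      · rintro (h | rfl) <;> assumption
    · simp [h.mem_keys, or_comm]
  · simp [Function.update_apply, h.get_eq]

/-- Repeated insertion: every key collects the updates of the entries that belong to it. -/
theorem Represents.foldl_insert {α : Type} (key : α → K) (upd : α → β → β) (l : List α)
    {d : Dict K β} {s : Finset K} {g : K → β} (h : d.Represents s g) :
    (l.foldl (fun d a => (d.insert (key a) (upd a (d.get (key a)))).val) d).Represents
      (s ∪ (l.map key).toFinset)
      fun k => (l.filter (key · = k)).foldl (fun b a => upd a b) (g k) := by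
  induction l generalizing d s g with
  | nil => exact h.congr (by simp) (by simp)
  | cons a l ih =>
    refine (ih (h.insert (key a) (upd a (d.get (key a))))).congr ?_ fun k => ?_
    · ext
      simp
    · by_cases hk : key a = k
      · subst hk
        simp [h.get_eq]
      · simp [hk, Function.update_of_ne (Ne.symm hk)]

/-- Setting every key of a list once. -/
theorem represents_foldl_set (l : List K) (hl : l.Nodup) (c : K → β) (b : β) (s : Finset K)
    (hs : ∀ k, k ∈ l ↔ k ∈ s) (hc : ∀ k, k ∉ s → c k = b) :
    (l.foldl (fun d a => (d.insert a (c a)).val) (empty b)).Represents s c := by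
  refine ((represents_empty b).foldl_insert id (fun a _ => c a) l).congr ?_ fun k => ?_
  · ext k
    simp [hs]
  · by_cases hk : k ∈ l
    · have : l.filter (fun a => decide (a = k)) = [k] := by
        rw [List.filter_eq, List.count_eq_one_of_mem hl hk]
        rfl
      simp [this]
    -- A key that is never written keeps the default `b`; `hc` makes this the correct value.
    · have : l.filter (fun a => decide (a = k)) = [] := by
        rw [List.filter_eq, List.count_eq_zero_of_not_mem hk]
        rfl
      simp only [id, this, List.foldl_nil]
      exact (hc k fun h => hk ((hs k).2 h)).symm

end Dict

/-! ## Moments of finite families of vectors -/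

section Moments

variable {E : Type} [AddCommGroup E]

/-- All sums of an element of `S` and an element of `T`. -/
def sumset (S T : Multiset E) : Multiset E := S.bind fun a => T.map (a + ·)

@[simp] theorem zero_sumset (T : Multiset E) : sumset 0 T = 0 := by simp [sumset]

@[simp] theorem cons_sumset (a : E) (S T : Multiset E) :
    sumset (a ::ₘ S) T = T.map (a + ·) + sumset S T := by simp [sumset]

theorem add_sumset (S₁ S₂ T : Multiset E) :
    sumset (S₁ + S₂) T = sumset S₁ T + sumset S₂ T := by simp [sumset]

@[simp] theorem card_sumset (S T : Multiset E) : (sumset S T).card = S.card * T.card := by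
  simp [sumset, Multiset.card_bind]

@[simp] theorem sumset_singleton_zero (S : Multiset E) : sumset S {0} = S := by
  simp only [sumset, Multiset.map_singleton, add_zero]
  exact (Multiset.bind_singleton S id).trans (Multiset.map_id S)

theorem sum_map_const_add (a : E) (T : Multiset E) :
    (T.map (a + ·)).sum = T.card • a + T.sum := by
  induction T using Multiset.induction with
  | empty => simp
  | cons b T ih => simp only [Multiset.map_cons, Multiset.sum_cons, ih, Multiset.card_cons]; module

theorem sum_sumset (S T : Multiset E) :
    (sumset S T).sum = T.card • S.sum + S.card • T.sum := by
  induction S using Multiset.induction with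
  | empty => simp
  | cons a S ih =>
    simp only [cons_sumset, Multiset.sum_add, ih, sum_map_const_add, Multiset.sum_cons,
      Multiset.card_cons]
    module

variable [Module ℝ E]

/-- The sum of the squares of the values of a linear functional. -/
noncomputable def sumSq (f : E →ₗ[ℝ] ℝ) (T : Multiset E) : ℝ := (T.map fun w => f w ^ 2).sum

/-- The variance of the values of a linear functional. -/
noncomputable def variance (f : E →ₗ[ℝ] ℝ) (T : Multiset E) : ℝ :=
  sumSq f T / T.card - (f T.sum / T.card) ^ 2

@[simp] theorem sumSq_zero (f : E →ₗ[ℝ] ℝ) : sumSq f 0 = 0 := by simp [sumSq]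

@[simp] theorem sumSq_add (f : E →ₗ[ℝ] ℝ) (S T : Multiset E) :
    sumSq f (S + T) = sumSq f S + sumSq f T := by simp [sumSq]

@[simp] theorem sumSq_cons (f : E →ₗ[ℝ] ℝ) (a : E) (T : Multiset E) :
    sumSq f (a ::ₘ T) = f a ^ 2 + sumSq f T := by simp [sumSq]

theorem sumSq_sum (f : E →ₗ[ℝ] ℝ) {ι : Type} (s : Finset ι) (T : ι → Multiset E) :
    sumSq f (∑ i ∈ s, T i) = ∑ i ∈ s, sumSq f (T i) := by
  classical
  induction s using Finset.induction_on with
  | empty => simp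
  | insert a s ha ih => simp [Finset.sum_insert ha, ih]

theorem sumSq_map_const_add (f : E →ₗ[ℝ] ℝ) (a : E) (T : Multiset E) :
    sumSq f (T.map (a + ·)) = T.card * f a ^ 2 + 2 * f a * f T.sum + sumSq f T := by
  induction T using Multiset.induction with
  | empty => simp
  | cons b T ih =>
    simp only [Multiset.map_cons, sumSq_cons, ih, Multiset.card_cons, Multiset.sum_cons, map_add]
    push_cast
    ring

theorem sumSq_sumset (f : E →ₗ[ℝ] ℝ) (S T : Multiset E) :
    sumSq f (sumset S T) =
      T.card * sumSq f S + 2 * f S.sum * f T.sum + S.card * sumSq f T := by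
  induction S using Multiset.induction with
  | empty => simp
  | cons a S ih =>
    simp only [cons_sumset, sumSq_add, sumSq_cons, ih, sumSq_map_const_add, Multiset.sum_cons,
      Multiset.card_cons, map_add]
    push_cast
    ring

/-- A uniformly chosen element of the sumset is the sum of two independent uniform elements, one
from each family. Both families have to be nonempty: an empty one makes the left side zero, whatever
the variance of the other. -/
theorem variance_sumset (f : E →ₗ[ℝ] ℝ) {S T : Multiset E} (hS : S.card ≠ 0) (hT : T.card ≠ 0) :
    variance f (sumset S T) = variance f S + variance f T := by
  have h1 : (S.card : ℝ) ≠ 0 := by exact_mod_cast hS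
  have h2 : (T.card : ℝ) ≠ 0 := by exact_mod_cast hT
  simp only [variance, sumSq_sumset, sum_sumset, card_sumset, map_add, map_nsmul, nsmul_eq_mul]
  push_cast
  field_simp
  ring

/-- On the right stands the energy that tails produce: the total energy minus that of the head. For
the empty family both sides vanish by the convention for division by zero. -/
theorem card_mul_variance (f : E →ₗ[ℝ] ℝ) (T : Multiset E) :
    T.card * variance f T = sumSq f T - f T.sum ^ 2 / T.card := by
  by_cases h : T.card = 0
  · simp [Multiset.card_eq_zero.1 h, variance]
  · have h1 : (T.card : ℝ) ≠ 0 := by exact_mod_cast h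
    simp only [variance]
    field_simp

end Moments

/-! ## Generalized heads and tails -/

/-- The squared norm of the weights. -/
noncomputable def weightSq {E : Type} (l : List (ℝ × E)) : ℝ := (l.map fun p => p.1 ^ 2).sum

/-- The weighted sum of the rows. -/
noncomputable def weightedSum {E : Type} [AddCommGroup E] [Module ℝ E] (l : List (ℝ × E)) : E :=
  (l.map fun p => p.1 • p.2).sum

/-- The rows without their weights. -/
def unweighted {E : Type} (l : List (ℝ × E)) : Multiset E := l.map Prod.snd

/-- The rows read so far are represented by their head `s / √q`. Reading a row `w` of weight `v`
rotates the pair of this head and `w` in a plane: one image is the next head, the other the next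
tail row. Rotations preserve energy, so the energies telescope to that of the initial head and all
rows, minus that of the final head. -/
theorem headTailLoop_val {σ : Schema r κ} (k : ℝ) (l : List (ℝ × σ.Row))
    (q : ℝ) (hq : 0 < q) (s : σ.Row) (out : List σ.Row) :
    (headTailLoop k l q s out).val.1 = (√(q + weightSq l))⁻¹ • (s + weightedSum l) ∧
    ∃ new, (headTailLoop k l q s out).val.2 = out ++ new ∧ new.length = l.length ∧
      ∀ f : σ.Row →ₗ[ℝ] ℝ, sumSq f new =
        k ^ 2 * (sumSq f (unweighted l) + f s ^ 2 / q
          - f (s + weightedSum l) ^ 2 / (q + weightSq l)) := by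
  induction l generalizing q s out with
  | nil =>
    refine ⟨?_, [], by simp [headTailLoop], rfl,
      fun f => by simp [weightedSum, weightSq, unweighted]⟩
    funext i c
    simp [headTailLoop, weightedSum, weightSq, div_eq_inv_mul]
  | cons p l ih =>
    obtain ⟨v, w⟩ := p
    have hq' : 0 < q + v * v := by nlinarith [mul_self_nonneg v]
    obtain ⟨h1, new, h2, h3, h4⟩ := ih (q + v * v) hq' (s + v • w)
      (out ++ [(k / √(q + v * v)) • (√q • w - (v / √q) • s)])
    -- Only the value matters. The step count is copied from the left side, so that after rewriting
    -- the tail row in vector form the equation holds by `rfl`.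
    have e : headTailLoop k ((v, w) :: l) q s out =
        ⟨(headTailLoop k l (q + v * v) (s + v • w)
          (out ++ [(k / √(q + v * v)) • (√q • w - (v / √q) • s)])).val,
          (headTailLoop k ((v, w) :: l) q s out).steps⟩ := by
      have e1 : (fun i c => k * ((√q * w i c - v * s i c / √q) / √(q + v * v)) : σ.Row) =
          (k / √(q + v * v)) • (√q • w - (v / √q) • s) := by
        funext i c
        simp only [Pi.smul_apply, Pi.sub_apply, smul_eq_mul]
        ring
      rw [← e1]
      rfl
    rw [e]
    have hw : q + v * v + weightSq l = q + weightSq ((v, w) :: l) := by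
      simp [weightSq]; ring
    have hs : s + v • w + weightedSum l = s + weightedSum ((v, w) :: l) := by
      simp [weightedSum, add_assoc]
    rw [hw, hs] at h1
    refine ⟨h1, _ :: new, by rw [h2, List.append_assoc]; rfl, by simp [h3], fun f => ?_⟩
    rw [← Multiset.cons_coe, sumSq_cons, h4, hw, hs]
    have hu : sumSq f (unweighted ((v, w) :: l)) = f w ^ 2 + sumSq f (unweighted l) := by
      simp [unweighted, ← Multiset.cons_coe]
    rw [hu]
    simp only [map_smul, map_sub, map_add, smul_eq_mul]
    -- Energy conservation for a single plane rotation.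
    have k1 : (k / √(q + v * v) * (√q * f w - v / √q * f s)) ^ 2 =
        k ^ 2 * (f w ^ 2 + f s ^ 2 / q - (f s + v * f w) ^ 2 / (q + v * v)) := by
      have a1 : √q ^ 2 = q := Real.sq_sqrt hq.le
      have a2 : √(q + v * v) ^ 2 = q + v * v := Real.sq_sqrt hq'.le
      have a3 : √q ≠ 0 := (Real.sqrt_pos.2 hq).ne'
      have : √q * f w - v / √q * f s = (q * f w - v * f s) / √q := by
        field_simp
        rw [a1]
        ring
      rw [this, mul_pow, div_pow, div_pow, a1, a2]
      field_simp
      ring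
    rw [k1]
    ring

/-- The first row has energy `f (v • w) ^ 2 / v ^ 2 = f w ^ 2`, so it joins the other rows in
`sumSq` on an equal footing; its weight must be nonzero for this. The truncated `l.length - 1` also
covers the empty group, which has no tail. -/
theorem headTail_val {σ : Schema r κ} (k : ℝ) (l : List (ℝ × σ.Row)) (hl : ∀ p ∈ l, 0 < p.1)
    (out : List σ.Row) :
    (headTail k l out).val.1 = (√(weightSq l))⁻¹ • weightedSum l ∧
    ∃ new, (headTail k l out).val.2 = out ++ new ∧ new.length = l.length - 1 ∧
      ∀ f : σ.Row →ₗ[ℝ] ℝ, sumSq f new =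
        k ^ 2 * (sumSq f (unweighted l) - f (weightedSum l) ^ 2 / weightSq l) := by
  cases l with
  | nil =>
    refine ⟨?_, [], by simp [headTail], rfl,
      fun f => by simp [weightedSum, weightSq, unweighted]⟩
    simp [headTail, weightedSum]
    rfl
  | cons p l =>
    obtain ⟨v, w⟩ := p
    have hv : 0 < v := hl (v, w) (by simp)
    obtain ⟨h1, new, h2, h3, h4⟩ := headTailLoop_val k l (v * v) (mul_pos hv hv) (v • w) out
    have e : (headTail k ((v, w) :: l) out).val =
      (headTailLoop k l (v * v) (v • w) out).val := rfl
    have hw : v * v + weightSq l = weightSq ((v, w) :: l) := by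
      simp [weightSq]; ring
    have hs : v • w + weightedSum l = weightedSum ((v, w) :: l) := by
      simp [weightedSum]
    rw [hw, hs] at h1
    rw [e]
    refine ⟨h1, new, h2, by simp [h3], fun f => ?_⟩
    have hu : sumSq f (unweighted ((v, w) :: l)) = f w ^ 2 + sumSq f (unweighted l) := by
      simp [unweighted, ← Multiset.cons_coe]
    rw [h4, hw, hs, hu, map_smul, smul_eq_mul, mul_pow, ← sq,
      mul_div_cancel_left₀ _ (pow_ne_zero 2 hv.ne')]
    ring

/-! ## Joins along a forest -/

section Joins

variable [DecidableEq κ] {σ : Schema r κ}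

/-- The key tuple of a row. -/
def keyTuple {i : Fin r} (t : σ.Tuple V i) : KeyTuple κ V := (keyOf t).val

/-- The restriction of a key tuple to the attributes in `X`. -/
def restrict (X : Finset κ) (x : KeyTuple κ V) : KeyTuple κ V := (project X x).val

@[simp] theorem val_keyOf {i : Fin r} (t : σ.Tuple V i) : (keyOf t).val = keyTuple t := rfl

@[simp] theorem val_project (X : Finset κ) (x : KeyTuple κ V) :
    (project X x).val = restrict X x := rfl

/-- The data of a row, with zeros in the columns of the other relations. -/
def embed {i : Fin r} (t : σ.Tuple V i) : σ.Row := Pi.single i t.2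

variable [Fintype κ] [DecidableEq V] (S : σ.Database V)

/-- The key tuples of relation `i`. -/
def keyTuples (i : Fin r) : Finset (KeyTuple κ V) := ((S i).map keyTuple).toFinset

/-- The data of the rows of relation `i` with key tuple `x`. -/
def group (i : Fin r) (x : KeyTuple κ V) : Multiset σ.Row :=
  ((S i).filter (keyTuple · = x)).map embed

/-- The data of the join of the relations in a forest, as far as it matches the key tuple `x` of
the parent `p` of the roots. -/
def joinForest : Fin r → KeyTuple κ V → Forest (Fin r) → Multiset σ.Row
  | _, _, .nil => {0}
  | p, x, .node i cs rest =>
    sumset (∑ x' ∈ keyTuples S i with restrict (σ.key p) x' = restrict (σ.key i) x,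
      sumset (group S i x') (joinForest i x' cs)) (joinForest p x rest)

/-- The data of the join of the relations in a tree, as far as it has the key tuple `x` in the
root. -/
def joinTree (i : Fin r) (cs : Forest (Fin r)) (x : KeyTuple κ V) : Multiset σ.Row :=
  sumset (group S i x) (joinForest S i x cs)

/-- The data of the join of the relations in a tree, as far as it has the key values `y` in the
attributes that are shared with the parent `p`. -/
def joinShared (p i : Fin r) (cs : Forest (Fin r)) (y : KeyTuple κ V) : Multiset σ.Row :=
  ∑ x ∈ keyTuples S i with restrict (σ.key p) x = y, joinTree S i cs x

theorem joinForest_nil (p : Fin r) (x : KeyTuple κ V) : joinForest S p x .nil = {0} := rfl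

theorem joinForest_node (p i : Fin r) (x : KeyTuple κ V) (cs rest : Forest (Fin r)) :
    joinForest S p x (.node i cs rest) =
      sumset (joinShared S p i cs (restrict (σ.key i) x)) (joinForest S p x rest) := rfl

/-- The values in the shared attributes. -/
def sharedTuples (p i : Fin r) : Finset (KeyTuple κ V) :=
  (keyTuples S i).image (restrict (σ.key p))

theorem mem_keyTuples {i : Fin r} {x : KeyTuple κ V} :
    x ∈ keyTuples S i ↔ ∃ t ∈ S i, keyTuple t = x := by
  simp only [keyTuples, List.mem_toFinset, List.mem_map]

theorem group_eq_zero {i : Fin r} {x : KeyTuple κ V} (h : x ∉ keyTuples S i) :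
    group S i x = 0 := by
  have : (S i).filter (keyTuple · = x) = [] := by
    simp only [List.filter_eq_nil_iff, decide_eq_true_eq]
    exact fun t ht hx => h ((mem_keyTuples S).2 ⟨t, ht, hx⟩)
  simp [group, this]

theorem card_group_pos {i : Fin r} {x : KeyTuple κ V} (h : x ∈ keyTuples S i) :
    0 < (group S i x).card := by
  obtain ⟨t, ht, hx⟩ := (mem_keyTuples S).1 h
  rw [Multiset.card_pos_iff_exists_mem]
  refine ⟨embed t, ?_⟩
  simp only [group, Multiset.mem_coe, List.mem_map, List.mem_filter, decide_eq_true_eq]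
  exact ⟨t, ⟨ht, hx⟩, rfl⟩

/-- The groups partition the rows, since a row has just one key tuple. -/
theorem sum_card_group (i : Fin r) :
    ∑ x ∈ keyTuples S i, (group S i x).card = (S i).length := by
  have : ∀ l : List (σ.Tuple V i), ∀ s : Finset (KeyTuple κ V), (∀ t ∈ l, keyTuple t ∈ s) →
      ∑ x ∈ s, (l.filter (keyTuple · = x)).length = l.length := by
    intro l s hl
    induction l with
    | nil => simp
    | cons t l ih =>
      have e : ∀ x, ((t :: l).filter (keyTuple · = x)).length =
          (l.filter (keyTuple · = x)).length + if keyTuple t = x then 1 else 0 := by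
        intro x
        by_cases hx : keyTuple t = x <;> simp [hx]
      simp only [e, Finset.sum_add_distrib, ih fun t ht => hl t (by simp [ht])]
      simp [hl t (by simp)]
  simpa [group] using this (S i) (keyTuples S i) fun t ht => (mem_keyTuples S).2 ⟨t, ht, rfl⟩

theorem card_keyTuples_le (i : Fin r) : (keyTuples S i).card ≤ (S i).length := by
  simpa [keyTuples] using List.toFinset_card_le ((S i).map keyTuple)

theorem joinTree_eq_zero {i : Fin r} (cs : Forest (Fin r)) {x : KeyTuple κ V}
    (h : x ∉ keyTuples S i) : joinTree S i cs x = 0 := by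
  simp [joinTree, group_eq_zero S h]

end Joins

/-! ## The count queries -/

/-- Unwritten keys have the value 0, so a formula valid for all keys requires `f` to vanish outside
`s`. -/
theorem divide_val [Fintype κ] [DecidableEq V] {d e : KeyDict κ V ℝ} {s : Finset (KeyTuple κ V)}
    {f g : KeyTuple κ V → ℝ} (hd : d.Represents s f) (hf : ∀ x, x ∉ s → f x = 0)
    (he : ∀ x, e.get x = g x) :
    (divide d e).val.Represents s fun x => f x / g x := by
  rw [divide, loop_val]
  refine (Dict.represents_foldl_set d.keys hd.nodup (fun x => d.get x / e.get x) 0 s hd.mem_keys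
    fun x hx => ?_).congr rfl fun x => ?_
  · simp [hd.get_eq, hf x hx]
  · simp [hd.get_eq, he]

section Counts

variable [Fintype κ] [DecidableEq κ] [DecidableEq V] {σ : Schema r κ} (S : σ.Database V)

theorem countRows_val (i : Fin r) :
    (countRows S i).val.Represents (keyTuples S i) fun x => ((group S i x).card : ℝ) := by
  rw [countRows, loop_val]
  refine ((Dict.represents_empty (0 : ℝ)).foldl_insert (keyTuple (σ := σ) (i := i))
    (fun _ b => b + 1) (S i)).congr (by simp [keyTuples]) fun x => ?_
  have : ∀ (l : List (σ.Tuple V i)) (c : ℝ), l.foldl (fun b _ => b + 1) c = c + l.length := by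
    intro l
    induction l with
    | nil => simp
    | cons a l ih => intro c; simp [ih]; ring
  simp [this, group]

theorem sumOver_val (X : Finset κ) {d : KeyDict κ V ℝ} {s : Finset (KeyTuple κ V)}
    {g : KeyTuple κ V → ℝ} (h : d.Represents s g) :
    (sumOver X d).val.Represents (s.image (restrict X))
      fun y => ∑ x ∈ s with restrict X x = y, g x := by
  rw [sumOver, loop_val]
  refine ((Dict.represents_empty (0 : ℝ)).foldl_insert (restrict X)
    (fun x b => b + d.get x) d.keys).congr ?_ fun y => ?_
  · rw [← h.toFinset]
    ext
    simp
  · have : ∀ (l : List (KeyTuple κ V)) (c : ℝ),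
        l.foldl (fun b x => b + d.get x) c = c + (l.map d.get).sum := by
      intro l
      induction l with
      | nil => simp
      | cons a l ih => intro c; simp [ih]; ring
    rw [this, zero_add, ← List.sum_toFinset _ (h.nodup.filter _), List.toFinset_filter, h.toFinset]
    simp [h.get_eq]

theorem applyUp_val (X : Finset κ) {up theta : KeyDict κ V ℝ} {s : Finset (KeyTuple κ V)}
    {f g : KeyTuple κ V → ℝ} (ht : theta.Represents s f) (hf : ∀ x, x ∉ s → f x = 0)
    (hu : ∀ x, up.get x = g x) :
    (applyUp X up theta).val.Represents s fun x => f x * g (restrict X x) := by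
  rw [applyUp, loop_val]
  refine (Dict.represents_foldl_set theta.keys ht.nodup
    (fun x => theta.get x * up.get (restrict X x)) 0 s ht.mem_keys
    fun x hx => ?_).congr rfl fun x => ?_
  · simp [ht.get_eq, hf x hx]
  · simp [ht.get_eq, hu]

/-- The first pass has computed the counts for the trees of a forest with parent `p`. -/
def CountsSpec₁ : Fin r → Forest (Fin r) → Forest (Counts₁ r κ V) → Prop
  | _, .nil, .nil => True
  | p, .node i cs rest, .node b cs' rest' =>
    b.idx = i ∧
    (b.rowsPerKey.Represents (keyTuples S i) fun x => ((group S i x).card : ℝ)) ∧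
    (b.theta.Represents (keyTuples S i) fun x => ((joinTree S i cs x).card : ℝ)) ∧
    (b.down.Represents (sharedTuples S p i) fun y => ((joinShared S p i cs y).card : ℝ)) ∧
    CountsSpec₁ i cs cs' ∧ CountsSpec₁ p rest rest'
  | _, _, _ => False

-- Once the key tuple of the parent is fixed, the trees of the forest are chosen independently, so
-- their counts multiply.
variable {S} in
theorem CountsSpec₁.foldl_roots {p : Fin r} {F : Forest (Fin r)} {G : Forest (Counts₁ r κ V)}
    (h : CountsSpec₁ S p F G) (x : KeyTuple κ V) (c : ℝ) :
    G.roots.foldl (fun c b => c * b.down.get (restrict (σ.key b.idx) x)) c =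
      c * (joinForest S p x F).card := by
  induction F generalizing G c p with
  | nil => cases G <;> simp_all [CountsSpec₁, Forest.roots, joinForest_nil]
  | node i cs rest _ ih =>
    cases G with
    | nil => simp [CountsSpec₁] at h
    | node b cs' rest' =>
      obtain ⟨h1, -, -, h4, -, h6⟩ := h
      simp only [Forest.roots, List.foldl_cons, ih h6, h4.get_eq, h1, joinForest_node, card_sumset]
      push_cast
      ring

theorem computeTheta_val {i : Fin r} {cs : Forest (Fin r)} {cs' : Forest (Counts₁ r κ V)}
    (h : CountsSpec₁ S i cs cs') {d : KeyDict κ V ℝ}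
    (hd : d.Represents (keyTuples S i) fun x => ((group S i x).card : ℝ)) :
    (computeTheta σ d cs'.roots).val.Represents (keyTuples S i)
      fun x => ((joinTree S i cs x).card : ℝ) := by
  rw [computeTheta, loop_val]
  simp only [Timed.val_bind, loop_val, Dict.val_lookup, val_mul, val_project, h.foldl_roots]
  refine (Dict.represents_foldl_set d.keys hd.nodup
    (fun x => d.get x * (joinForest S i x cs).card) 0 _ hd.mem_keys
    fun x hx => ?_).congr rfl fun x => ?_
  · simp [hd.get_eq, group_eq_zero S hx]
  · simp [hd.get_eq, joinTree]

theorem pass₁_val (p : Fin r) (F : Forest (Fin r)) : CountsSpec₁ S p F (pass₁ S p F).val := by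
  induction F generalizing p with
  | nil => trivial
  | node i cs rest ih₁ ih₂ =>
    have h1 := countRows_val S i
    have h2 := computeTheta_val S (ih₁ i) h1
    refine ⟨rfl, h1, h2, (sumOver_val (σ.key p) h2).congr rfl fun y => ?_, ih₁ i, ih₂ p⟩
    simp [joinShared]

/-- The size of the join of the relations outside of the tree with root `i`, where `full` is the
size of the complete join per key tuple of the parent `p`. -/
noncomputable def upCount (p i : Fin r) (cs : Forest (Fin r)) (full : KeyTuple κ V → ℝ)
    (y : KeyTuple κ V) : ℝ :=
  (∑ x ∈ keyTuples S p with restrict (σ.key i) x = y, full x) / (joinShared S p i cs y).card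

/-- The size of the complete join per key tuple of `i`. -/
noncomputable def fullCount (p i : Fin r) (cs : Forest (Fin r)) (full : KeyTuple κ V → ℝ)
    (x : KeyTuple κ V) : ℝ :=
  (joinTree S i cs x).card * upCount S p i cs full (restrict (σ.key p) x)

/-- The second pass has computed the counts for the trees of a forest with parent `p`. -/
def CountsSpec₂ : Fin r → (KeyTuple κ V → ℝ) → Forest (Fin r) → Forest (Counts₂ r κ V) → Prop
  | _, _, .nil, .nil => True
  | p, full, .node i cs rest, .node b cs' rest' =>
    b.idx = i ∧
    (∀ x, b.rowsPerKey.get x = (group S i x).card) ∧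
    (∀ y, b.down.get y = (joinShared S p i cs y).card) ∧
    (∀ y, b.up.get y = upCount S p i cs full y) ∧
    (∀ x, b.circ.get x = fullCount S p i cs full x / (group S i x).card) ∧
    CountsSpec₂ i (fullCount S p i cs full) cs cs' ∧ CountsSpec₂ p full rest rest'
  | _, _, _, _ => False

theorem sumOver_divide_val {p i : Fin r} {cs : Forest (Fin r)} {full : KeyTuple κ V → ℝ}
    {d e : KeyDict κ V ℝ} (hd : d.Represents (keyTuples S p) full)
    (he : ∀ y, e.get y = (joinShared S p i cs y).card) :
    (divide (sumOver (σ.key i) d).val e).val.Represents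
      ((keyTuples S p).image (restrict (σ.key i))) (upCount S p i cs full) := by
  refine divide_val (sumOver_val (σ.key i) hd) (fun y hy => ?_) he
  refine Finset.sum_eq_zero fun x hx => ?_
  rw [Finset.mem_filter] at hx
  exact absurd (Finset.mem_image.2 ⟨x, hx⟩) hy

/-- Join rows with a given shared value are pairs of a part inside and a part outside the subtree;
dividing their number by the inside count gives `up`, and `theta * up` is the full count at the
child. Only these recursion formulas are recorded. The energy argument uses no other property of
`up`. -/
theorem pass₂_val {p : Fin r} {full : KeyTuple κ V → ℝ} {d : KeyDict κ V ℝ}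
    {F : Forest (Fin r)} {G : Forest (Counts₁ r κ V)}
    (hd : d.Represents (keyTuples S p) full) (h : CountsSpec₁ S p F G) :
    CountsSpec₂ S p full F (pass₂ σ p d G).val := by
  induction F generalizing p full d G with
  | nil => cases G <;> simp_all [CountsSpec₁, CountsSpec₂, pass₂]
  | node i cs rest ih₁ ih₂ =>
    cases G with
    | nil => simp [CountsSpec₁] at h
    | node b cs' rest' =>
      obtain ⟨h1, h2, h3, h4, h5, h6⟩ := h
      subst h1
      have hup := sumOver_divide_val S hd h4.get_eq
      have hfull := applyUp_val (σ.key p) h3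
        (fun x hx => by simp [joinTree_eq_zero S cs hx]) hup.get_eq
      have hcirc := divide_val hfull
        (fun x hx => by simp [joinTree_eq_zero S cs hx]) h2.get_eq
      exact ⟨rfl, h2.get_eq, h4.get_eq, hup.get_eq, hcirc.get_eq, ih₁ hfull h5, ih₂ hd h6⟩

/-- All counts are correct. -/
theorem computeCounts_val (τ : RootedTree (Fin r)) :
    (computeCounts S τ).val.root.idx = τ.root ∧
    (∀ x, (computeCounts S τ).val.root.rowsPerKey.get x = (group S τ.root x).card) ∧
    (∀ x, (computeCounts S τ).val.root.circ.get x =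
      (joinTree S τ.root τ.children x).card / (group S τ.root x).card) ∧
    CountsSpec₂ S τ.root (fun x => ((joinTree S τ.root τ.children x).card : ℝ)) τ.children
      (computeCounts S τ).val.children := by
  have h1 := countRows_val S τ.root
  have h0 := pass₁_val S τ.root τ.children
  have h2 := computeTheta_val S h0 h1
  have h3 := divide_val h2 (fun x hx => by simp [joinTree_eq_zero S τ.children hx]) h1.get_eq
  exact ⟨rfl, h1.get_eq, h3.get_eq, pass₂_val S h2 h0⟩

end Counts

/-! ## Heads and tails of groups of rows -/

@[simp] theorem padRow_val {σ : Schema r κ} {i : Fin r} (t : σ.Tuple V i) :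
    (padRow t).val = embed t := rfl

theorem foldl_append_singleton {α β : Type} (f : α → β) (l : List α) (b : List β) :
    l.foldl (fun b a => b ++ [f a]) b = b ++ l.map f := by
  induction l generalizing b with
  | nil => simp
  | cons a l ih => simp [ih]

section Groups

variable [Fintype κ] [DecidableEq V] {σ : Schema r κ}

/-- Groups are reduced independently and their tails are concatenated, so lengths and energies add
up over the keys. By `hh` the new scale is the norm of the weights that were merged into the head.
-/
theorem reduceGroups_val {groups : KeyDict κ V (List (ℝ × σ.Row))} {s : Finset (KeyTuple κ V)}
    {g : KeyTuple κ V → List (ℝ × σ.Row)} (hg : groups.Represents s g)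
    (hg0 : ∀ x, x ∉ s → g x = []) (hpos : ∀ x, ∀ p ∈ g x, 0 < p.1)
    (tailCount headCount : KeyDict κ V ℝ) (hh : ∀ x, headCount.get x = weightSq (g x))
    (out : List σ.Row) :
    let st := (reduceGroups groups tailCount headCount out).val
    st.data.Represents s (fun x => (√(weightSq (g x)))⁻¹ • weightedSum (g x)) ∧
    st.scales.Represents s (fun x => √(weightSq (g x))) ∧
    ∃ new, st.out = out ++ new ∧ new.length = ∑ x ∈ s, ((g x).length - 1) ∧
      ∀ f : σ.Row →ₗ[ℝ] ℝ, sumSq f new = ∑ x ∈ s, √(tailCount.get x) ^ 2 *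
        (sumSq f (unweighted (g x)) - f (weightedSum (g x)) ^ 2 / weightSq (g x)) := by
  -- Only `out` is threaded through the tail computation. The other two components are plain folds
  -- of insertions, to which `Dict.represents_foldl_set` applies.
  have key : ∀ (l : List (KeyTuple κ V)) (st : State σ V),
      let st' := l.foldl (fun (st : State σ V) x =>
        (⟨(st.data.insert x (headTail √(tailCount.get x) (g x) st.out).val.1).val,
          (st.scales.insert x √(headCount.get x)).val,
          (headTail √(tailCount.get x) (g x) st.out).val.2⟩ : State σ V)) st
      st'.data = l.foldl (fun d x => (d.insert x
        ((√(weightSq (g x)))⁻¹ • weightedSum (g x))).val) st.data ∧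
      st'.scales = l.foldl (fun d x => (d.insert x √(weightSq (g x))).val) st.scales ∧
      ∃ new, st'.out = st.out ++ new ∧
        new.length = (l.map fun x => (g x).length - 1).sum ∧
        ∀ f : σ.Row →ₗ[ℝ] ℝ, sumSq f new = (l.map fun x => √(tailCount.get x) ^ 2 *
          (sumSq f (unweighted (g x)) - f (weightedSum (g x)) ^ 2 / weightSq (g x))).sum := by
    intro l
    induction l with
    | nil => exact fun st => ⟨rfl, rfl, [], by simp, rfl, fun f => by simp⟩
    | cons x l ih =>
      intro st
      obtain ⟨h1, new, h2, h3, h4⟩ := headTail_val √(tailCount.get x) (g x) (hpos x) st.out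
      obtain ⟨i1, i2, new', i3, i4, i5⟩ := ih
        (⟨(st.data.insert x (headTail √(tailCount.get x) (g x) st.out).val.1).val,
          (st.scales.insert x √(headCount.get x)).val,
          (headTail √(tailCount.get x) (g x) st.out).val.2⟩ : State σ V)
      refine ⟨?_, ?_, new ++ new', ?_, ?_, fun f => ?_⟩
      · rw [List.foldl_cons, List.foldl_cons, i1, h1]
      · rw [List.foldl_cons, List.foldl_cons, i2, hh]
      · rw [List.foldl_cons, i3, h2, List.append_assoc]
      · simp [h3, i4]
      · rw [← Multiset.coe_add, sumSq_add, h4, i5, List.map_cons, List.sum_cons]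
  have e : (reduceGroups groups tailCount headCount out).val =
      groups.keys.foldl (fun (st : State σ V) x =>
        (⟨(st.data.insert x (headTail √(tailCount.get x) (g x) st.out).val.1).val,
          (st.scales.insert x √(headCount.get x)).val,
          (headTail √(tailCount.get x) (g x) st.out).val.2⟩ : State σ V))
        ⟨Dict.empty (fun _ _ => 0), Dict.empty 0, out⟩ := by
    rw [reduceGroups, loop_val]
    simp only [Timed.val_bind, Dict.val_lookup, val_sqrt, Timed.val_pure, hg.get_eq]
  obtain ⟨h1, h2, new, h3, h4, h5⟩ := key groups.keys
    ⟨Dict.empty (fun _ _ => 0), Dict.empty 0, out⟩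
  intro st
  refine ⟨?_, ?_, new, by rw [← h3, ← e], ?_, fun f => ?_⟩
  · simp only [st, e, h1]
    refine Dict.represents_foldl_set _ hg.nodup _ _ s hg.mem_keys fun x hx => ?_
    simp only [hg0 x hx, weightedSum, List.map_nil, List.sum_nil, smul_zero]
    rfl
  · simp only [st, e, h2]
    refine Dict.represents_foldl_set _ hg.nodup _ _ s hg.mem_keys fun x hx => ?_
    simp [hg0 x hx, weightSq]
  · rw [h4, hg.sum_keys]
  · rw [h5, hg.sum_keys]

/-- The entries of `data` and `scales` are the scaled sums and the square roots of the sizes of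
the families `T x`. -/
structure StateSpec (data : KeyDict κ V σ.Row) (scales : KeyDict κ V ℝ)
    (s : Finset (KeyTuple κ V)) (T : KeyTuple κ V → Multiset σ.Row) : Prop where
  data : data.Represents s fun x => (√(T x).card)⁻¹ • (T x).sum
  scales : scales.Represents s fun x => √(T x).card

end Groups

/-! ### Reducing the groups at a single node -/

section Algorithm

variable [Fintype κ] [DecidableEq κ] [DecidableEq V] {σ : Schema r κ} (S : σ.Database V)

theorem groupRows_val (i : Fin r) :
    (groupRows S i).val.Represents (keyTuples S i)
      fun x => ((S i).filter (keyTuple · = x)).map fun t => (1, embed t) := by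
  rw [groupRows, loop_val]
  refine ((Dict.represents_empty ([] : List (ℝ × σ.Row))).foldl_insert
    (keyTuple (σ := σ) (i := i)) (fun t b => b ++ [(1, embed t)]) (S i)).congr
    (by simp [keyTuples]) fun x => ?_
  rw [foldl_append_singleton, List.nil_append]

/-- With unit weights the squared norm is the number of rows, so the tail energy of a group is its
cardinality times its variance, here multiplied by the count `circ`. A group of `c` rows has `c - 1`
tail rows, which leaves one row per key tuple uncounted. -/
theorem headsAndTails_val {i : Fin r} {b : Counts₂ r κ V} (hi : b.idx = i)
    (hb : ∀ x, b.rowsPerKey.get x = (group S i x).card) (hc : ∀ x, 0 ≤ b.circ.get x)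
    (out : List σ.Row) :
    let st := (headsAndTails S b out).val
    StateSpec st.data st.scales (keyTuples S i) (group S i) ∧
    ∃ new, st.out = out ++ new ∧ new.length + (keyTuples S i).card = (S i).length ∧
      ∀ f : σ.Row →ₗ[ℝ] ℝ, sumSq f new =
        ∑ x ∈ keyTuples S i, b.circ.get x * ((group S i x).card * variance f (group S i x)) := by
  subst hi
  have w1 : ∀ l : List (σ.Tuple V b.idx),
      weightSq (l.map fun t => ((1 : ℝ), embed t)) = (l.map embed).length := fun l => by
    simp [weightSq, Function.comp_def]
  have w2 : ∀ l : List (σ.Tuple V b.idx),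
      weightedSum (l.map fun t => ((1 : ℝ), embed t)) = (l.map embed).sum := fun l => by
    simp [weightedSum, Function.comp_def]
  have w3 : ∀ l : List (σ.Tuple V b.idx),
      unweighted (l.map fun t => ((1 : ℝ), embed t)) = (l.map embed) := fun l => by
    simp [unweighted, Function.comp_def]
  obtain ⟨h1, h2, new, h3, h4, h5⟩ := reduceGroups_val (groupRows_val S b.idx)
    (fun x hx => by
      rw [List.map_eq_nil_iff, List.filter_eq_nil_iff]
      intro t ht hx'
      exact hx ((mem_keyTuples S).2 ⟨t, ht, by simpa using hx'⟩))
    (by simp only [List.mem_map]; rintro x p ⟨t, -, rfl⟩; exact one_pos)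
    b.circ b.rowsPerKey (fun x => by rw [w1, hb]; rfl) out
  simp only [w1, w2, w3] at h1 h2 h4 h5
  refine ⟨⟨h1.congr rfl fun x => rfl, h2.congr rfl fun x => rfl⟩, new, h3, ?_, fun f => ?_⟩
  · rw [h4, ← sum_card_group S b.idx, Finset.card_eq_sum_ones, ← Finset.sum_add_distrib]
    refine Finset.sum_congr rfl fun x hx => ?_
    have := card_group_pos S hx
    simp only [group, Multiset.coe_card, List.length_map] at this ⊢
    omega
  · rw [h5]
    refine Finset.sum_congr rfl fun x _ => ?_
    rw [Real.sq_sqrt (hc x), card_mul_variance]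
    rfl

/-- This is the law of total variance. The incoming rows have weights `√(T x).card` and values `sum
/ √card`, so weighted sums are sums of whole families and squared norms are their cardinalities. The
energy of an incoming row is `f(sum)² / card`, without the variance inside `T x`; hence the tail
carries exactly the variance between the families that are merged. -/
theorem projectAway_val {p i : Fin r} {cs : Forest (Fin r)} {b : Counts₂ r κ V}
    (hb : ∀ y, b.down.get y = (joinShared S p i cs y).card) (hu : ∀ y, 0 ≤ b.up.get y)
    (hcs : ∀ x ∈ keyTuples S i, (joinTree S i cs x).card ≠ 0)
    {st : State σ V} (h : StateSpec st.data st.scales (keyTuples S i) (joinTree S i cs)) :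
    let st' := (projectAway p b st).val
    StateSpec st'.data st'.scales (sharedTuples S p i) (joinShared S p i cs) ∧
    ∃ new, st'.out = st.out ++ new ∧
      new.length + (sharedTuples S p i).card = (keyTuples S i).card ∧
      ∀ f : σ.Row →ₗ[ℝ] ℝ, sumSq f new = ∑ y ∈ sharedTuples S p i, b.up.get y *
        ((joinShared S p i cs y).card * variance f (joinShared S p i cs y) -
          ∑ x ∈ keyTuples S i with restrict (σ.key p) x = y,
            (joinTree S i cs x).card * variance f (joinTree S i cs x)) := by
  set T := joinTree S i cs with hT
  set g : KeyTuple κ V → List (ℝ × σ.Row) := fun y =>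
    (st.data.keys.filter (restrict (σ.key p) · = y)).map
      fun x => (st.scales.get x, st.data.get x) with hgdef
  have hg : (loop (fun (d : KeyDict κ V (List (ℝ × σ.Row))) x => do
      let y ← project (σ.key p) x
      let v ← st.scales.lookup x
      let w ← st.data.lookup x
      let g ← d.lookup y
      let g' ← push g (v, w)
      d.insert y g') st.data.keys (Dict.empty ([] : List (ℝ × σ.Row)))).val.Represents
        (sharedTuples S p i) g := by
    rw [loop_val]
    refine ((Dict.represents_empty ([] : List (ℝ × σ.Row))).foldl_insert
      (restrict (σ.key p)) (fun x b => b ++ [(st.scales.get x, st.data.get x)])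
      st.data.keys).congr ?_ fun y => ?_
    · rw [sharedTuples, ← h.data.toFinset]
      ext
      simp
    · rw [foldl_append_singleton, List.nil_append]
  have hsum : ∀ {M : Type} [AddCommMonoid M] (y : KeyTuple κ V) (φ : KeyTuple κ V → M),
      ((st.data.keys.filter (restrict (σ.key p) · = y)).map φ).sum =
        ∑ x ∈ keyTuples S i with restrict (σ.key p) x = y, φ x := by
    intro M _ y φ
    rw [← List.sum_toFinset _ (h.data.nodup.filter _), List.toFinset_filter, h.data.toFinset]
    simp
  have w1 : ∀ y, weightSq (g y) = (joinShared S p i cs y).card := fun y => by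
    simp only [weightSq, hgdef, List.map_map, Function.comp_def, hsum, joinShared, h.scales.get_eq,
      Multiset.card_sum]
    push_cast
    exact Finset.sum_congr rfl fun x _ => Real.sq_sqrt (Nat.cast_nonneg _)
  have w2 : ∀ y, weightedSum (g y) = (joinShared S p i cs y).sum := fun y => by
    simp only [weightedSum, hgdef, List.map_map, Function.comp_def, hsum, joinShared,
      h.scales.get_eq, h.data.get_eq, Multiset.sum_sum]
    refine Finset.sum_congr rfl fun x hx => ?_
    have : (0 : ℝ) < (T x).card := by
      exact_mod_cast Nat.pos_of_ne_zero (hcs x (Finset.mem_filter.1 hx).1)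
    rw [smul_smul, mul_inv_cancel₀ (Real.sqrt_pos.2 this).ne', one_smul]
  -- Here the variances inside the families are missing; their subtraction in the conclusion
  -- originates from this formula.
  have w3 : ∀ (f : σ.Row →ₗ[ℝ] ℝ) y, sumSq f (unweighted (g y)) =
      ∑ x ∈ keyTuples S i with restrict (σ.key p) x = y, f (T x).sum ^ 2 / (T x).card := by
    intro f y
    simp only [unweighted, sumSq, hgdef, List.map_map, Multiset.map_coe, Multiset.sum_coe,
      Function.comp_def, hsum, h.data.get_eq]
    refine Finset.sum_congr rfl fun x hx => ?_
    rw [map_smul, smul_eq_mul, mul_pow, inv_pow, Real.sq_sqrt (Nat.cast_nonneg _)]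
    ring
  obtain ⟨h1, h2, new, h3, h4, h5⟩ := reduceGroups_val hg
    (fun y hy => by
      simp only [hgdef, List.map_eq_nil_iff, List.filter_eq_nil_iff]
      intro x hx hxy
      exact hy (Finset.mem_image.2 ⟨x, (h.data.mem_keys x).1 hx, by simpa using hxy⟩))
    (by
      simp only [hgdef, List.mem_map, List.mem_filter]
      rintro y q ⟨x, ⟨hx, -⟩, rfl⟩
      rw [h.scales.get_eq]
      exact Real.sqrt_pos.2 (by
        exact_mod_cast Nat.pos_of_ne_zero (hcs x ((h.data.mem_keys x).1 hx))))
    b.up b.down (fun y => by rw [w1, hb]) st.out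
  simp only [w1, w2, w3] at h1 h2 h5
  refine ⟨⟨h1, h2⟩, new, h3, ?_, fun f => ?_⟩
  · rw [h4, Finset.card_eq_sum_ones, ← Finset.sum_add_distrib]
    have : ∀ y ∈ sharedTuples S p i, (g y).length - 1 + 1 =
        ((keyTuples S i).filter (restrict (σ.key p) · = y)).card := by
      intro y hy
      have hl : (g y).length = ((keyTuples S i).filter (restrict (σ.key p) · = y)).card := by
        rw [Finset.card_eq_sum_ones, ← hsum]
        simp [hgdef]
      rw [hl]
      obtain ⟨x, hx, hxy⟩ := Finset.mem_image.1 hy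
      exact Nat.succ_pred_eq_of_pos (Finset.card_pos.2 ⟨x, Finset.mem_filter.2 ⟨hx, hxy⟩⟩)
    rw [Finset.sum_congr rfl this]
    exact (Finset.card_eq_sum_card_fiberwise fun x hx =>
      Finset.mem_coe.2 (Finset.mem_image_of_mem _ hx)).symm
  · rw [h5]
    refine Finset.sum_congr rfl fun y _ => ?_
    simp only [Real.sq_sqrt (hu y), card_mul_variance, Finset.sum_sub_distrib, joinShared,
      sumSq_sum]
    ring

end Algorithm

/-! ### Means of families of rows and updates in place -/

section Rows

variable {σ : Schema r κ}

theorem collectNodes_val (i : Fin r) (bs : List (Result σ V)) :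
    (collectNodes i bs).val = i :: bs.flatMap Result.nodes := by
  have h1 : ∀ (l m : List (Fin r)), (loop (fun l k => push l k) m l).val = l ++ m := by
    intro l m
    rw [loop_val]
    have := foldl_append_singleton id m l
    simpa using this
  have h2 : ∀ (bs : List (Result σ V)) (l : List (Fin r)),
      bs.foldl (fun l b => l ++ b.nodes) l = l ++ bs.flatMap Result.nodes := by
    intro bs
    induction bs with
    | nil => simp
    | cons b bs ih => intro l; simp [ih]
  rw [collectNodes, loop_val]
  simp only [h1, h2]
  rfl

theorem sum_sum_apply {ι : Type} (s : Finset ι) (T : ι → Multiset σ.Row) (k : Fin r)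
    (h : ∀ x ∈ s, (T x).sum k = 0) : (∑ x ∈ s, T x).sum k = 0 := by
  rw [Multiset.sum_sum, Finset.sum_apply]
  exact Finset.sum_eq_zero h

/-- The mean of a family of rows. -/
noncomputable def mean (T : Multiset σ.Row) : σ.Row := (T.card : ℝ)⁻¹ • T.sum

theorem mean_sumset {T U : Multiset σ.Row} (hT : T.card ≠ 0) (hU : U.card ≠ 0) :
    mean (sumset T U) = mean T + mean U := by
  have h1 : (T.card : ℝ) ≠ 0 := by exact_mod_cast hT
  have h2 : (U.card : ℝ) ≠ 0 := by exact_mod_cast hU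
  simp only [mean, sum_sumset, card_sumset, ← Nat.cast_smul_eq_nsmul ℝ, smul_add, smul_smul]
  push_cast
  congr 2 <;> field_simp

/-- All written values are read from the fixed row `u`, so neither the order of `l` nor repetitions
in it matter. -/
theorem foldl_update {g : ℝ} (u : σ.Row) (l : List (Fin r)) (w : σ.Row) (k : Fin r) :
    l.foldl (fun w k => Function.update w k fun c => u k c * g) w k =
      if k ∈ l then fun c => u k c * g else w k := by
  induction l generalizing w with
  | nil => simp
  | cons a l ih =>
    rw [List.foldl_cons, ih]
    by_cases h : k ∈ l
    · simp [h]
    · by_cases ha : k = a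
      · subst ha; simp [h]
      · simp [h, ha]

/-- The dictionaries are read and overwritten in the same loop. Since `l` has no duplicates, every
key is visited at most once and its original value is still there when it is read. -/
theorem foldl_state [Fintype κ] [DecidableEq V] (A : KeyTuple κ V → ℝ → σ.Row → σ.Row)
    (B : KeyTuple κ V → ℝ → ℝ)
    (l : List (KeyTuple κ V)) (hl : l.Nodup) (st : State σ V) {s : Finset (KeyTuple κ V)}
    (hs : ∀ x ∈ l, x ∈ s) {f : KeyTuple κ V → σ.Row} {g : KeyTuple κ V → ℝ}
    (hf : st.data.Represents s f) (hg : st.scales.Represents s g) :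
    let st' := l.foldl (fun (st : State σ V) x =>
      (⟨(st.data.insert x (A x (st.scales.get x) (st.data.get x))).val,
        (st.scales.insert x (B x (st.scales.get x))).val, st.out⟩ : State σ V)) st
    st'.data.Represents s (fun x => if x ∈ l then A x (g x) (f x) else f x) ∧
    st'.scales.Represents s (fun x => if x ∈ l then B x (g x) else g x) ∧ st'.out = st.out := by
  induction l generalizing st f g with
  | nil => exact ⟨hf.congr rfl (by simp), hg.congr rfl (by simp), rfl⟩
  | cons a l ih =>
    have ha : s ∪ {a} = s := by simpa using hs a (by simp)
    obtain ⟨hal, hl⟩ := List.nodup_cons.1 hl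
    obtain ⟨h1, h2, h3⟩ := ih hl
      ⟨(st.data.insert a (A a (st.scales.get a) (st.data.get a))).val,
        (st.scales.insert a (B a (st.scales.get a))).val, st.out⟩ (fun x hx => hs x (by simp [hx]))
      ((hf.insert a (A a (st.scales.get a) (st.data.get a))).congr ha fun _ => rfl)
      ((hg.insert a (B a (st.scales.get a))).congr ha fun _ => rfl)
    refine ⟨h1.congr rfl fun x => ?_, h2.congr rfl fun x => ?_, h3⟩
    · by_cases hx : x = a
      · subst hx; simp [hal, hf.get_eq, hg.get_eq]
      · simp [hx]
    · by_cases hx : x = a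
      · subst hx; simp [hal, hg.get_eq]
      · simp [hx]

end Rows

section Algorithm

variable [Fintype κ] [DecidableEq κ] [DecidableEq V] {σ : Schema r κ} (S : σ.Database V)

/-! ## Joining the results of the children -/

/-- The results for the trees of a forest with parent `p`. -/
def ResultSpec : Fin r → Forest (Fin r) → List (Result σ V) → Prop
  | _, .nil, [] => True
  | p, .node i cs rest, b :: bs =>
    b.idx = i ∧ b.nodes.Perm (i :: cs.labels) ∧
    (∀ y, b.scales.get y = √(joinShared S p i cs y).card) ∧
    (∀ y, b.data.get y = (√(joinShared S p i cs y).card)⁻¹ • (joinShared S p i cs y).sum) ∧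
    ResultSpec p rest bs
  | _, _, _ => False

theorem ResultSpec.nodes_perm {p : Fin r} {F : Forest (Fin r)} {bs : List (Result σ V)}
    (h : ResultSpec S p F bs) : (bs.flatMap Result.nodes).Perm F.labels := by
  induction F generalizing p bs with
  | nil => cases bs <;> simp_all [ResultSpec, Forest.labels]
  | node i cs rest _ ih =>
    cases bs with
    | nil => simp [ResultSpec] at h
    | cons b bs =>
      obtain ⟨-, h2, -, -, h5⟩ := h
      simpa [Forest.labels] using h2.append (ih h5)

theorem sum_group_apply {i k : Fin r} (hk : k ≠ i) (x : KeyTuple κ V) :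
    (group S i x).sum k = 0 := by
  have : ∀ l : List (σ.Tuple V i), (l.map embed).sum k = 0 := by
    intro l
    induction l with
    | nil => rfl
    | cons t l ih => simp [ih, embed, hk]
  exact this _

theorem sum_joinForest_apply (p : Fin r) (x : KeyTuple κ V) {F : Forest (Fin r)} {k : Fin r}
    (hk : k ∉ F.labels) : (joinForest S p x F).sum k = 0 := by
  induction F generalizing p x with
  | nil => simp [joinForest_nil]
  | node i cs rest ih₁ ih₂ =>
    simp only [Forest.labels, List.mem_cons, List.mem_append, not_or] at hk
    have h : (joinShared S p i cs (restrict (σ.key i) x)).sum k = 0 :=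
      sum_sum_apply _ _ _ fun x _ => by
        simp [joinTree, sum_sumset, ih₁ i x hk.2.1, sum_group_apply S hk.1]
    rw [joinForest_node, sum_sumset]
    simp [h, ih₂ p x hk.2.2]

theorem sum_joinShared_apply (p i : Fin r) (cs : Forest (Fin r)) (y : KeyTuple κ V) {k : Fin r}
    (hk : k ∉ i :: cs.labels) : (joinShared S p i cs y).sum k = 0 := by
  simp only [List.mem_cons, not_or] at hk
  refine sum_sum_apply _ _ _ fun x _ => ?_
  simp [joinTree, sum_sumset, sum_joinForest_apply S i x hk.2, sum_group_apply S hk.1]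

/-- A child with family `T` of size `n` contributes `sum / √n * (sp / √n) = sp * mean T`. Different
children write to disjoint blocks, which are zero before by `hw`, so overwriting amounts to adding,
and the means add up to the mean of the sumset. -/
theorem ResultSpec.foldl_data {p : Fin r} {F : Forest (Fin r)} {bs : List (Result σ V)}
    (h : ResultSpec S p F bs) (hF : F.labels.Nodup) (x : KeyTuple κ V)
    (hx : (joinForest S p x F).card ≠ 0) (sp : ℝ) (w : σ.Row) (hw : ∀ k ∈ F.labels, w k = 0) :
    bs.foldl (fun w b => b.nodes.foldl (fun w k => Function.update w k fun c =>
        b.data.get (restrict (σ.key b.idx) x) k c *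
          (sp / b.scales.get (restrict (σ.key b.idx) x))) w) w =
      w + sp • mean (joinForest S p x F) := by
  induction F generalizing bs w p with
  | nil =>
    cases bs with
    | nil => simp [joinForest_nil, mean]
    | cons b bs => simp [ResultSpec] at h
  | node i cs rest _ ih =>
    cases bs with
    | nil => simp [ResultSpec] at h
    | cons b bs =>
      obtain ⟨h1, h2, h3, h4, h5⟩ := h
      rw [joinForest_node, card_sumset] at hx
      have hx1 := left_ne_zero_of_mul hx
      have hx2 := right_ne_zero_of_mul hx
      have hlab : (i :: cs.labels ++ rest.labels).Nodup := hF
      rw [List.nodup_append'] at hlab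
      have hstep : b.nodes.foldl (fun w k => Function.update w k fun c =>
          b.data.get (restrict (σ.key b.idx) x) k c *
            (sp / b.scales.get (restrict (σ.key b.idx) x))) w =
          w + sp • mean (joinShared S p i cs (restrict (σ.key i) x)) := by
        funext k
        rw [foldl_update, h1, h3, h4, mean]
        have hn : (0 : ℝ) < (joinShared S p i cs (restrict (σ.key i) x)).card := by
          exact_mod_cast Nat.pos_of_ne_zero hx1
        by_cases hk : k ∈ i :: cs.labels
        · rw [if_pos (h2.mem_iff.2 hk)]
          have hk' : k ∈ (Forest.node i cs rest).labels := by
            simp only [Forest.labels, List.mem_cons, List.mem_append] at hk ⊢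
            tauto
          funext c
          simp only [Pi.add_apply, Pi.smul_apply, smul_eq_mul, hw k hk', Pi.zero_apply, zero_add]
          set n : ℝ := ((joinShared S p i cs (restrict (σ.key i) x)).card : ℝ)
          have : (√n)⁻¹ * (√n)⁻¹ = n⁻¹ := by
            rw [← mul_inv, Real.mul_self_sqrt hn.le]
          rw [← this]
          ring
        · rw [if_neg (fun hk' => hk (h2.mem_iff.1 hk'))]
          simp [sum_joinShared_apply S p i cs _ hk]
      rw [List.foldl_cons, hstep, ih h5 hlab.2.1 hx2, joinForest_node, mean_sumset hx1 hx2,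
        smul_add, add_assoc]
      intro k hk
      have hk1 : k ∉ i :: cs.labels := fun hk' => hlab.2.2 hk' hk
      have hk2 : k ∈ (Forest.node i cs rest).labels := by
        simp only [Forest.labels, List.mem_cons, List.mem_append]
        tauto
      simp [hw k hk2, mean, sum_joinShared_apply S p i cs _ hk1]

theorem ResultSpec.foldl_scales {p : Fin r} {F : Forest (Fin r)} {bs : List (Result σ V)}
    (h : ResultSpec S p F bs) (x : KeyTuple κ V) (c : ℝ) :
    bs.foldl (fun c b => c * b.scales.get (restrict (σ.key b.idx) x)) c =
      c * √(joinForest S p x F).card := by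
  induction F generalizing bs c p with
  | nil => cases bs <;> simp_all [ResultSpec, joinForest_nil]
  | node i cs rest _ ih =>
    cases bs with
    | nil => simp [ResultSpec] at h
    | cons b bs =>
      obtain ⟨h1, -, h3, -, h5⟩ := h
      rw [List.foldl_cons, ih h5, h3, h1, joinForest_node, card_sumset, Nat.cast_mul,
        Real.sqrt_mul (Nat.cast_nonneg _), mul_assoc]

/-- Let the group have `n` rows and the forest below it `m` matches. The sum over their sumset is
`m` times the group sum plus `n` times the forest sum. Divided by `√(n * m)`, the first part is the
old entry times `√m`, and the second is `√n * √m` times the mean of the forest; these are the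
factors that the algorithm uses. -/
theorem joinChildren_val {i : Fin r} {cs : Forest (Fin r)} {bs : List (Result σ V)}
    (h : ResultSpec S i cs bs) (hcs : (i :: cs.labels).Nodup)
    (hpos : ∀ x ∈ keyTuples S i, (joinForest S i x cs).card ≠ 0) {st : State σ V}
    (hst : StateSpec st.data st.scales (keyTuples S i) (group S i)) :
    let st' := (joinChildren i bs st).val
    StateSpec st'.data st'.scales (keyTuples S i) (joinTree S i cs) ∧ st'.out = st.out := by
  obtain ⟨hi, hcs⟩ := List.nodup_cons.1 hcs
  obtain ⟨h1, h2, h3⟩ := foldl_state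
    (fun x s w => bs.foldl (fun w b => b.nodes.foldl (fun w k => Function.update w k fun c =>
        b.data.get (restrict (σ.key b.idx) x) k c *
          (s * (1 * √(joinForest S i x cs).card) / b.scales.get (restrict (σ.key b.idx) x))) w)
      (Function.update w i fun c => w i c * (1 * √(joinForest S i x cs).card)))
    (fun x s => s * (1 * √(joinForest S i x cs).card)) st.data.keys hst.data.nodup st
    (fun x hx => (hst.data.mem_keys x).1 hx) hst.data hst.scales
  have e : (joinChildren i bs st).val = st.data.keys.foldl (fun (st : State σ V) x =>
      (⟨(st.data.insert x (bs.foldl (fun w b => b.nodes.foldl (fun w k =>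
        Function.update w k fun c => b.data.get (restrict (σ.key b.idx) x) k c *
          (st.scales.get x * (1 * √(joinForest S i x cs).card) /
            b.scales.get (restrict (σ.key b.idx) x))) w)
        (Function.update (st.data.get x) i fun c => st.data.get x i c *
          (1 * √(joinForest S i x cs).card)))).val,
        (st.scales.insert x (st.scales.get x * (1 * √(joinForest S i x cs).card))).val,
        st.out⟩ : State σ V)) st := by
    rw [joinChildren, loop_val]
    simp only [Timed.val_bind, loop_val, Dict.val_lookup, val_mul, val_project, val_div,
      val_setBlock, val_tabulate, val_cell, Timed.val_pure, h.foldl_scales]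
  intro st'
  have e' : st' = _ := e
  rw [← e'] at h1 h2 h3
  refine ⟨⟨h1.congr rfl fun x => ?_, h2.congr rfl fun x => ?_⟩, h3⟩
  · by_cases hx : x ∈ keyTuples S i
    · rw [if_pos ((hst.data.mem_keys x).2 hx), h.foldl_data S hcs x (hpos x hx)]
      · have hn : (0 : ℝ) < (group S i x).card := by exact_mod_cast card_group_pos S hx
        have hm : (0 : ℝ) < (joinForest S i x cs).card := by
          exact_mod_cast Nat.pos_of_ne_zero (hpos x hx)
        set n : ℝ := ((group S i x).card : ℝ) with hnd
        set m : ℝ := ((joinForest S i x cs).card : ℝ) with hmd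
        have e1 : (Function.update ((√n)⁻¹ • (group S i x).sum) i fun c =>
            ((√n)⁻¹ • (group S i x).sum) i c * (1 * √m)) =
            (√m * (√n)⁻¹) • (group S i x).sum := by
          funext k
          by_cases hk : k = i
          · subst hk
            funext c
            simp only [Function.update_self, Pi.smul_apply, smul_eq_mul]
            ring
          · simp [Function.update_of_ne hk, sum_group_apply S hk]
        rw [e1, mean, ← hmd, joinTree, card_sumset, sum_sumset, Nat.cast_mul, ← hnd, ← hmd,
          Real.sqrt_mul hn.le, smul_add, ← Nat.cast_smul_eq_nsmul ℝ, ← Nat.cast_smul_eq_nsmul ℝ,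
          ← hnd, ← hmd, smul_smul, smul_smul, smul_smul]
        have hn' := Real.sqrt_pos.2 hn
        have hm' := Real.sqrt_pos.2 hm
        have a1 : √n ^ 2 = n := Real.sq_sqrt hn.le
        have a2 : √m ^ 2 = m := Real.sq_sqrt hm.le
        congr 2
        -- Writing the bare cardinality as the square of its root leaves an identity of fractions in
        -- `√n` and `√m`.
        · rw [mul_inv]
          nth_rw 3 [← a2]
          field_simp
        · rw [mul_inv]
          nth_rw 3 [← a1]
          rw [← a2, Real.sqrt_sq hm'.le]
          field_simp
      · intro k hk
        have hki : k ≠ i := fun h' => hi (h' ▸ hk)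
        simp [Function.update_of_ne hki, sum_group_apply S hki]
    · rw [if_neg (fun h' => hx ((hst.data.mem_keys x).1 h'))]
      simp [group_eq_zero S hx, joinTree_eq_zero S cs hx]
  · by_cases hx : x ∈ keyTuples S i
    · rw [if_pos ((hst.data.mem_keys x).2 hx), one_mul, joinTree, card_sumset, Nat.cast_mul,
        Real.sqrt_mul (Nat.cast_nonneg _)]
    · rw [if_neg (fun h' => hx ((hst.data.mem_keys x).1 h'))]
      simp [group_eq_zero S hx, joinTree_eq_zero S cs hx]

end Algorithm

/-! ## The algorithm -/

section Algorithm

variable [DecidableEq κ] {σ : Schema r κ}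

/-- Every row of a relation matches some row of every other relation. -/
def Matched (S : σ.Database V) : Prop :=
  ∀ i j, ∀ t ∈ S i, ∃ t' ∈ S j, restrict (σ.key i) (keyTuple t') = restrict (σ.key j) (keyTuple t)

/-- The leaves of a forest have no key attributes that their parents do not have. -/
def LeafKeys (σ : Schema r κ) : Fin r → Forest (Fin r) → Prop
  | _, .nil => True
  | p, .node i cs rest => (cs = .nil → σ.key i ⊆ σ.key p) ∧ LeafKeys σ i cs ∧ LeafKeys σ p rest

theorem restrict_keyTuple {X : Finset κ} {i : Fin r} (h : σ.key i ⊆ X) (t : σ.Tuple V i) :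
    restrict X (keyTuple t) = keyTuple t := by
  funext a
  change (if a ∈ X then _ else _) = _
  split_ifs with ha
  · rfl
  · change none = dite _ _ _
    rw [dif_neg fun h' => ha (h h')]

variable [Fintype κ] [DecidableEq V] {S : σ.Database V}

theorem Matched.restrict_mem (hS : Matched S) {p : Fin r} (i : Fin r) {x : KeyTuple κ V}
    (hx : x ∈ keyTuples S p) : restrict (σ.key i) x ∈ sharedTuples S p i := by
  obtain ⟨t, ht, rfl⟩ := (mem_keyTuples S).1 hx
  obtain ⟨t', ht', h⟩ := hS p i t ht
  exact Finset.mem_image.2 ⟨_, (mem_keyTuples S).2 ⟨t', ht', rfl⟩, h⟩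

theorem card_joinShared_ne_zero {p i : Fin r} {cs : Forest (Fin r)}
    (hcs : ∀ x ∈ keyTuples S i, (joinTree S i cs x).card ≠ 0) {y : KeyTuple κ V}
    (hy : y ∈ sharedTuples S p i) : (joinShared S p i cs y).card ≠ 0 := by
  obtain ⟨x, hx, hxy⟩ := Finset.mem_image.1 hy
  rw [joinShared, Multiset.card_sum, ← Nat.pos_iff_ne_zero]
  exact Finset.sum_pos' (fun _ _ => Nat.zero_le _)
    ⟨x, Finset.mem_filter.2 ⟨hx, hxy⟩, Nat.pos_of_ne_zero (hcs x hx)⟩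

/-- Every key tuple finds a partner in each child, and partners in different subtrees are chosen
independently; pairwise matching is therefore enough. -/
theorem Matched.card_joinForest_ne_zero (hS : Matched S) {p : Fin r} (F : Forest (Fin r))
    {x : KeyTuple κ V} (hx : x ∈ keyTuples S p) : (joinForest S p x F).card ≠ 0 := by
  induction F generalizing p x with
  | nil => simp [joinForest_nil]
  | node i cs rest ih₁ ih₂ =>
    rw [joinForest_node, card_sumset]
    refine mul_ne_zero (card_joinShared_ne_zero (fun x' hx' => ?_) (hS.restrict_mem i hx)) (ih₂ hx)
    rw [joinTree, card_sumset]
    exact mul_ne_zero (card_group_pos S hx').ne' (ih₁ hx')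

theorem Matched.card_joinTree_ne_zero (hS : Matched S) {i : Fin r} (cs : Forest (Fin r))
    {x : KeyTuple κ V} (hx : x ∈ keyTuples S i) : (joinTree S i cs x).card ≠ 0 := by
  rw [joinTree, card_sumset]
  exact mul_ne_zero (card_group_pos S hx).ne' (hS.card_joinForest_ne_zero cs hx)

variable (S)

/-- The number of rows that are output for the relations in a forest with parent `p`. -/
def outLength : Fin r → Forest (Fin r) → ℕ
  | _, .nil => 0
  | p, .node i cs rest =>
    (S i).length + outLength i cs - (sharedTuples S p i).card + outLength p rest

theorem card_sharedTuples_le (p i : Fin r) :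
    (sharedTuples S p i).card ≤ (keyTuples S i).card := Finset.card_image_le

theorem restrict_eq_self {X : Finset κ} {i : Fin r} (h : σ.key i ⊆ X) {x : KeyTuple κ V}
    (hx : x ∈ keyTuples S i) : restrict X x = x := by
  obtain ⟨t, -, rfl⟩ := (mem_keyTuples S).1 hx
  exact restrict_keyTuple h t

theorem sharedTuples_leaf {p i : Fin r} (h : σ.key i ⊆ σ.key p) :
    sharedTuples S p i = keyTuples S i := by
  exact (Finset.image_congr fun x hx => restrict_eq_self S h hx).trans Finset.image_id

theorem joinShared_leaf {p i : Fin r} (h : σ.key i ⊆ σ.key p) (y : KeyTuple κ V) :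
    joinShared S p i .nil y = group S i y := by
  have e : ∀ x, joinTree S i .nil x = group S i x := fun x => by
    simp [joinTree, joinForest_nil]
  simp only [joinShared, e]
  rw [Finset.filter_congr fun x hx => by rw [restrict_eq_self S h hx],
    Finset.filter_eq']
  split_ifs with hy
  · simp
  · simp [group_eq_zero S hy]

/-! ### Energy balance between a node and its parent -/

theorem upCount_nonneg {p i : Fin r} {cs : Forest (Fin r)} {full : KeyTuple κ V → ℝ}
    (h : ∀ x, 0 ≤ full x) (y : KeyTuple κ V) : 0 ≤ upCount S p i cs full y :=
  div_nonneg (Finset.sum_nonneg fun x _ => h x) (Nat.cast_nonneg _)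

theorem fullCount_nonneg {p i : Fin r} {cs : Forest (Fin r)} {full : KeyTuple κ V → ℝ}
    (h : ∀ x, 0 ≤ full x) (x : KeyTuple κ V) : 0 ≤ fullCount S p i cs full x :=
  mul_nonneg (Nat.cast_nonneg _) (upCount_nonneg S h _)

variable {S}

/-- By definition `up y * down y` is the sum of `full` over the key tuples of the parent that
restrict to `y`. This moves a sum from the shared values to the parent; nothing is lost, because
every key tuple of the parent restricts to a shared value. -/
theorem sum_upCount (hS : Matched S) (p i : Fin r) (cs : Forest (Fin r))
    (full : KeyTuple κ V → ℝ) (φ : KeyTuple κ V → ℝ) :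
    ∑ y ∈ sharedTuples S p i, upCount S p i cs full y * ((joinShared S p i cs y).card * φ y) =
      ∑ x ∈ keyTuples S p, full x * φ (restrict (σ.key i) x) := by
  rw [← Finset.sum_fiberwise_of_maps_to (t := sharedTuples S p i)
    (g := fun x => restrict (σ.key i) x) fun x hx => hS.restrict_mem i hx]
  refine Finset.sum_congr rfl fun y hy => ?_
  have h : ((joinShared S p i cs y).card : ℝ) ≠ 0 := by
    exact_mod_cast card_joinShared_ne_zero (fun x hx => hS.card_joinTree_ne_zero cs hx) hy
  rw [upCount, ← mul_assoc, div_mul_cancel₀ _ h, Finset.sum_mul]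
  refine Finset.sum_congr rfl fun x hx => ?_
  rw [(Finset.mem_filter.1 hx).2]

/-- The tails of the relation itself supply the variance of the group, the outputs for the children
that of the forest below it. Their sum is the variance of the sumset, and the group size cancels
against the denominator of `circ`. -/
theorem sum_circ_add (hS : Matched S) {i : Fin r} {cs : Forest (Fin r)}
    {full : KeyTuple κ V → ℝ} (f : σ.Row →ₗ[ℝ] ℝ) :
    ∑ x ∈ keyTuples S i, full x / (group S i x).card *
        ((group S i x).card * variance f (group S i x)) +
      ∑ x ∈ keyTuples S i, full x * variance f (joinForest S i x cs) =
      ∑ x ∈ keyTuples S i, full x * variance f (joinTree S i cs x) := by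
  rw [← Finset.sum_add_distrib]
  refine Finset.sum_congr rfl fun x hx => ?_
  have h : ((group S i x).card : ℝ) ≠ 0 := by exact_mod_cast (card_group_pos S hx).ne'
  rw [joinTree, variance_sumset f (card_group_pos S hx).ne' (hS.card_joinForest_ne_zero cs hx),
    ← mul_assoc, div_mul_cancel₀ _ h, mul_add]

/-- The factor `up` depends only on the shared value, so it can be pulled out of each fibre of the
restriction. -/
theorem sum_fullCount {p i : Fin r} {cs : Forest (Fin r)}
    {full : KeyTuple κ V → ℝ} (φ : KeyTuple κ V → ℝ) :
    ∑ x ∈ keyTuples S i, fullCount S p i cs full x * φ x =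
      ∑ y ∈ sharedTuples S p i, upCount S p i cs full y *
        ∑ x ∈ keyTuples S i with restrict (σ.key p) x = y, (joinTree S i cs x).card * φ x := by
  rw [← Finset.sum_fiberwise_of_maps_to (t := sharedTuples S p i)
    (g := fun x => restrict (σ.key p) x) fun x hx => Finset.mem_image_of_mem _ hx]
  refine Finset.sum_congr rfl fun y hy => ?_
  rw [Finset.mul_sum]
  refine Finset.sum_congr rfl fun x hx => ?_
  rw [fullCount, (Finset.mem_filter.1 hx).2]
  ring

/-- The computation at a node after the calls for its children, whose results are `bs`. -/
noncomputable def finishNode (p : Fin r) (b : Counts₂ r κ V) (bs : List (Result σ V))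
    (st : State σ V) (out : List σ.Row) : Timed (State σ V) :=
  match bs with
  | [] => pure st
  | _ :: _ => do
    let st₁ ← joinChildren b.idx bs ⟨st.data, st.scales, out⟩
    projectAway p b st₁

/-- Moving the case distinction into `finishNode` lets leaves and inner nodes share one induction
step. -/
theorem processForest_node (p : Fin r) (b : Counts₂ r κ V) (cs rest : Forest (Counts₂ r κ V))
    (out : List σ.Row) :
    processForest S p (.node b cs rest) out = (do
      tick
      let st ← headsAndTails S b out
      let sub ← processForest S b.idx cs st.out
      let nodes ← collectNodes b.idx sub.1
      let st' ← finishNode p b sub.1 st sub.2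
      let others ← processForest S p rest st'.out
      pure (⟨b.idx, nodes, st'.data, st'.scales⟩ :: others.1, others.2)) := by
  rw [processForest]
  refine Timed.bind_congr _ fun _ => Timed.bind_congr _ fun st => Timed.bind_congr _ fun sub =>
    Timed.bind_congr _ fun nodes => ?_
  obtain ⟨l, out'⟩ := sub
  cases l with
  | nil => rfl
  | cons b' l => exact (Timed.bind_assoc (joinChildren b.idx (b' :: l) _) _ _).symm

/-- The variances within the key tuples of `i` are already in the output. Adding the variance
between them gives the variance per shared value, which `sum_upCount` rewrites in terms of the
parent. At a leaf nothing has to be merged: restricting to the key of the parent is the identity on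
its key tuples. -/
theorem finishNode_val (hS : Matched S) {p i : Fin r} {cs : Forest (Fin r)}
    (hi : (i :: cs.labels).Nodup) (hleaf : cs = .nil → σ.key i ⊆ σ.key p)
    {full : KeyTuple κ V → ℝ} (hfull : ∀ x, 0 ≤ full x) {b : Counts₂ r κ V} (hb : b.idx = i)
    (hdown : ∀ y, b.down.get y = (joinShared S p i cs y).card)
    (hup : ∀ y, b.up.get y = upCount S p i cs full y)
    {bs : List (Result σ V)} (hbs : ResultSpec S i cs bs)
    {st : State σ V} (hst : StateSpec st.data st.scales (keyTuples S i) (group S i))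
    {out : List σ.Row} (hout : bs = [] → out = st.out) :
    let st' := (finishNode p b bs st out).val
    StateSpec st'.data st'.scales (sharedTuples S p i) (joinShared S p i cs) ∧
    ∃ new, st'.out = out ++ new ∧
      new.length + (sharedTuples S p i).card = (keyTuples S i).card ∧
      ∀ f : σ.Row →ₗ[ℝ] ℝ,
        ∑ x ∈ keyTuples S i, fullCount S p i cs full x * variance f (joinTree S i cs x) +
          sumSq f new =
        ∑ x ∈ keyTuples S p, full x * variance f (joinShared S p i cs (restrict (σ.key i) x)) := by
  subst hb
  cases bs with
  | nil =>
    cases cs with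
    | node j cs' rest' => simp [ResultSpec] at hbs
    | nil =>
      have hk := hleaf rfl
      refine ⟨?_, [], ?_, ?_, fun f => ?_⟩
      · rw [sharedTuples_leaf S hk, funext (joinShared_leaf S hk)]
        exact hst
      · rw [hout rfl]
        simp [finishNode]
      · simp [sharedTuples_leaf S hk]
      · rw [sum_fullCount,
          ← sum_upCount hS p b.idx .nil full fun y => variance f (joinShared S p b.idx .nil y)]
        simp only [Multiset.coe_nil, sumSq_zero, add_zero]
        refine Finset.sum_congr rfl fun y hy => ?_
        congr 1
        rw [sharedTuples_leaf S hk] at hy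
        rw [Finset.filter_congr fun x hx => by rw [restrict_eq_self S hk hx],
          Finset.filter_eq', if_pos hy, Finset.sum_singleton, joinShared_leaf S hk]
        simp [joinTree, joinForest_nil]
  | cons b' bs =>
    have h1 := joinChildren_val S hbs hi (fun x hx => hS.card_joinForest_ne_zero cs hx)
      (st := ⟨st.data, st.scales, out⟩) hst
    obtain ⟨h2, new, h3, h4, h5⟩ := projectAway_val S hdown
      (fun y => by rw [hup]; exact upCount_nonneg S hfull y)
      (fun x hx => hS.card_joinTree_ne_zero cs hx) h1.1
    refine ⟨h2, new, ?_, h4, fun f => ?_⟩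
    · rw [h1.2] at h3
      exact h3
    · rw [h5, sum_fullCount, ← Finset.sum_add_distrib,
        ← sum_upCount hS p b.idx cs full fun y => variance f (joinShared S p b.idx cs y)]
      refine Finset.sum_congr rfl fun y _ => ?_
      rw [hup]
      ring

theorem ResultSpec.eq_nil_iff {p : Fin r} {F : Forest (Fin r)} {bs : List (Result σ V)}
    (h : ResultSpec S p F bs) : bs = [] ↔ F = .nil := by
  cases F <;> cases bs <;> simp_all [ResultSpec]

/-- The energy of the forest splits into variance and mean. The output takes care of all the
variance, and the results passed to the parent retain the sums and sizes that determine the mean.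
The weights `full` are arbitrary nonnegative numbers, since the recursive call is made with
`fullCount` in their place. -/
theorem processForest_val (hS : Matched S) {p : Fin r} {full : KeyTuple κ V → ℝ}
    (hfull : ∀ x, 0 ≤ full x) {F : Forest (Fin r)} {G : Forest (Counts₂ r κ V)}
    (hG : CountsSpec₂ S p full F G) (hF : F.labels.Nodup) (hleaf : LeafKeys σ p F)
    (out : List σ.Row) :
    ResultSpec S p F (processForest S p G out).val.1 ∧
    ∃ new, (processForest S p G out).val.2 = out ++ new ∧ new.length = outLength S p F ∧
      ∀ f : σ.Row →ₗ[ℝ] ℝ, sumSq f new =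
        ∑ x ∈ keyTuples S p, full x * variance f (joinForest S p x F) := by
  induction F generalizing p full G out with
  | nil =>
    cases G with
    | node b cs rest => simp [CountsSpec₂] at hG
    | nil =>
      refine ⟨trivial, [], by simp [processForest], rfl, fun f => ?_⟩
      simp [joinForest_nil, variance, sumSq]
  | node i cs rest ih₁ ih₂ =>
    cases G with
    | nil => simp [CountsSpec₂] at hG
    | node b cs' rest' =>
      obtain ⟨hb, hrows, hdown, hup, hcirc, hG₁, hG₂⟩ := hG
      subst hb
      obtain ⟨hl1, hl2, hl3⟩ := hleaf
      have hlab : (b.idx :: cs.labels ++ rest.labels).Nodup := hF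
      rw [List.nodup_append'] at hlab
      have hfull' := fullCount_nonneg S (p := p) (i := b.idx) (cs := cs) hfull
      obtain ⟨h1, new₁, h2, h3, h4⟩ := headsAndTails_val S rfl hrows
        (fun x => by rw [hcirc]; exact div_nonneg (hfull' x) (Nat.cast_nonneg _)) out
      obtain ⟨c1, new₂, c2, c3, c4⟩ := ih₁ hfull' hG₁ (List.nodup_cons.1 hlab.1).2 hl2
        (headsAndTails S b out).val.out
      obtain ⟨f1, new₃, f2, f3, f4⟩ := finishNode_val hS (b := b) (p := p) (out :=
        (processForest S b.idx cs' (headsAndTails S b out).val.out).val.2)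
        -- No results means no children, and then the recursive call returns `out` unchanged.
        hlab.1 hl1 hfull rfl hdown hup c1 h1 (by
          intro h
          have := c1.eq_nil_iff.1 h
          subst this
          cases cs' with
          | nil => rfl
          | node => simp [CountsSpec₂] at hG₁)
      obtain ⟨o1, new₄, o2, o3, o4⟩ := ih₂ hfull hG₂ hlab.2.1 hl3 (finishNode p b
        (processForest S b.idx cs' (headsAndTails S b out).val.out).val.1
        (headsAndTails S b out).val
        (processForest S b.idx cs' (headsAndTails S b out).val.out).val.2).val.out
      rw [processForest_node]
      simp only [Timed.val_bind, Timed.val_pure]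
      refine ⟨⟨rfl, ?_, f1.scales.get_eq, f1.data.get_eq, o1⟩, new₁ ++ new₂ ++ new₃ ++ new₄, ?_,
        ?_, fun f => ?_⟩
      · rw [collectNodes_val]
        exact (c1.nodes_perm S).cons _
      · rw [o2, f2, c2, h2]
        simp
      · simp only [List.length_append, c3, o3, outLength]
        -- This makes the truncated subtraction in `outLength` exact.
        have := card_sharedTuples_le S p b.idx
        omega
      · have hf4 := f4 f
        simp only [← Multiset.coe_add, sumSq_add, c4, o4, h4, hcirc]
        rw [sum_circ_add hS, hf4, ← Finset.sum_add_distrib]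
        refine Finset.sum_congr rfl fun x hx => ?_
        rw [joinForest_node, variance_sumset f
          (card_joinShared_ne_zero (fun x hx => hS.card_joinTree_ne_zero cs hx)
            (hS.restrict_mem b.idx hx)) (hS.card_joinForest_ne_zero rest hx), mul_add]

/-- The data of the join of all relations. -/
def joinRows (S : σ.Database V) (τ : RootedTree (Fin r)) : Multiset σ.Row :=
  ∑ x ∈ keyTuples S τ.root, joinTree S τ.root τ.children x

/-- At the root `full x` is the size of `joinTree` at `x`. The tails therefore sum to cardinality
times variance, and the rows output last contribute the missing `f(sum)² / card`. The clause for a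
single join row records the output exactly, sign included, since energies determine a row only up to
sign. -/
theorem figaro_val (hS : Matched S) {τ : RootedTree (Fin r)} (hτ : τ.labels.Nodup)
    (hleaf : LeafKeys σ τ.root τ.children) :
    (∃ new last, (figaro S τ).val = new ++ last ∧
      last.length = (keyTuples S τ.root).card ∧
      ((joinRows S τ).card = 1 → last = [(joinRows S τ).sum])) ∧
    (figaro S τ).val.length = (S τ.root).length + outLength S τ.root τ.children ∧
    ∀ f : σ.Row →ₗ[ℝ] ℝ, sumSq f (figaro S τ).val = sumSq f (joinRows S τ) := by
  obtain ⟨hb, hrows, hcirc, hG⟩ := computeCounts_val S τ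
  set t := (computeCounts S τ).val
  obtain ⟨h1, new₁, h2, h3, h4⟩ := headsAndTails_val S hb hrows
    (fun x => by rw [hcirc]; positivity) []
  have hnd : (τ.root :: τ.children.labels).Nodup := hτ
  obtain ⟨c1, new₂, c2, c3, c4⟩ := processForest_val hS (fun x => by positivity) hG
    (List.nodup_cons.1 hnd).2 hleaf (headsAndTails S t.root []).val.out
  rw [← hb] at c1 c2
  have j := joinChildren_val S (st := ⟨(headsAndTails S t.root []).val.data,
    (headsAndTails S t.root []).val.scales, (processForest S t.root.idx t.children
      (headsAndTails S t.root []).val.out).val.2⟩) c1 (hb ▸ hnd)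
    (fun x hx => hS.card_joinForest_ne_zero _ hx) (hb ▸ h1)
  have e : (figaro S τ).val = (loop (fun out x => do
      let w ← (joinChildren t.root.idx (processForest S t.root.idx t.children
        (headsAndTails S t.root []).val.out).val.1 ⟨(headsAndTails S t.root []).val.data,
        (headsAndTails S t.root []).val.scales, (processForest S t.root.idx t.children
        (headsAndTails S t.root []).val.out).val.2⟩).val.data.lookup x
      push out w) (joinChildren t.root.idx (processForest S t.root.idx t.children
        (headsAndTails S t.root []).val.out).val.1 ⟨(headsAndTails S t.root []).val.data,
        (headsAndTails S t.root []).val.scales, (processForest S t.root.idx t.children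
        (headsAndTails S t.root []).val.out).val.2⟩).val.data.keys
        (joinChildren t.root.idx (processForest S t.root.idx t.children
        (headsAndTails S t.root []).val.out).val.1 ⟨(headsAndTails S t.root []).val.data,
        (headsAndTails S t.root []).val.scales, (processForest S t.root.idx t.children
        (headsAndTails S t.root []).val.out).val.2⟩).val.out).val := rfl
  rw [loop_val] at e
  obtain ⟨j1, j2⟩ := j
  generalize (joinChildren t.root.idx (processForest S t.root.idx t.children
        (headsAndTails S t.root []).val.out).val.1 ⟨(headsAndTails S t.root []).val.data,
        (headsAndTails S t.root []).val.scales, (processForest S t.root.idx t.children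
        (headsAndTails S t.root []).val.out).val.2⟩).val = st' at e j1 j2
  have e2 : (figaro S τ).val = new₁ ++ new₂ ++ st'.data.keys.map st'.data.get := by
    rw [e]
    simp only [Timed.val_bind, Dict.val_lookup, val_push]
    rw [foldl_append_singleton, j2, c2, h2]
    simp
  rw [hb] at j1
  refine ⟨⟨_, _, e2, by simp [j1.data.length_keys], fun hc => ?_⟩, ?_, fun f => ?_⟩
  -- Every key tuple of the root has at least one join row, so a single join row leaves room for
  -- only one key tuple.
  · have hcard : (keyTuples S τ.root).card = 1 := by
      rw [joinRows, Multiset.card_sum] at hc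
      have h : (keyTuples S τ.root).card ≤
          ∑ x ∈ keyTuples S τ.root, (joinTree S τ.root τ.children x).card := by
        rw [Finset.card_eq_sum_ones]
        exact Finset.sum_le_sum fun x hx => Nat.pos_of_ne_zero (hS.card_joinTree_ne_zero _ hx)
      have h0 : (keyTuples S τ.root).card ≠ 0 := by
        intro h0
        rw [Finset.card_eq_zero.1 h0] at hc
        simp at hc
      omega
    obtain ⟨x, hx⟩ := Finset.card_eq_one.1 hcard
    have hkeys : st'.data.keys = [x] := by
      have h1 := j1.data.length_keys
      rw [hcard, List.length_eq_one_iff] at h1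
      obtain ⟨a, ha⟩ := h1
      have := j1.data.mem_keys a
      rw [ha, hx] at this
      rw [ha, show a = x by simpa using this]
    rw [joinRows, hx, Finset.sum_singleton] at hc ⊢
    simp [hkeys, j1.data.get_eq, hc]
  · rw [e2]
    simp only [List.length_append, List.length_map, j1.data.length_keys, c3]
    omega
  · rw [e2]
    simp only [← Multiset.coe_add, sumSq_add, h4, c4, hcirc]
    rw [sum_circ_add hS, joinRows, sumSq_sum]
    have : sumSq f ↑(List.map st'.data.get st'.data.keys) =
        ∑ x ∈ keyTuples S τ.root, f (joinTree S τ.root τ.children x).sum ^ 2 /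
          (joinTree S τ.root τ.children x).card := by
      simp only [sumSq, Multiset.map_coe, Multiset.sum_coe, List.map_map]
      rw [j1.data.sum_keys]
      refine Finset.sum_congr rfl fun x _ => ?_
      simp only [Function.comp, j1.data.get_eq, map_smul, smul_eq_mul, mul_pow, inv_pow,
        Real.sq_sqrt (Nat.cast_nonneg _)]
      ring
    rw [this, ← Finset.sum_add_distrib]
    refine Finset.sum_congr rfl fun x _ => ?_
    rw [card_mul_variance]
    ring

/-! ## The number of rows -/

theorem outLength_le (p : Fin r) (F : Forest (Fin r)) :
    outLength S p F ≤ (F.labels.map fun i => (S i).length).sum := by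
  induction F generalizing p with
  | nil => simp [outLength]
  | node i cs rest ih₁ ih₂ =>
    have h1 := ih₁ i
    have h2 := ih₂ p
    simp only [outLength, Forest.labels, List.map_cons, List.sum_cons, List.map_append,
      List.sum_append]
    omega

/-- This sums `a + b ≤ a * b + 1`, for positive integers `a` and `b`, over the key tuples, where `a`
is the size of the group and `b` the number of matches below it. -/
theorem length_add_outLength_le (hS : Matched S) {i : Fin r} {cs : Forest (Fin r)}
    (h : outLength S i cs + (keyTuples S i).card ≤
      ∑ x ∈ keyTuples S i, (joinForest S i x cs).card) :
    (S i).length + outLength S i cs ≤ ∑ x ∈ keyTuples S i, (joinTree S i cs x).card := by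
  have h1 : ∀ x ∈ keyTuples S i, (group S i x).card + (joinForest S i x cs).card ≤
      (joinTree S i cs x).card + 1 := fun x hx => by
    have a := card_group_pos S hx
    have b := Nat.pos_of_ne_zero (hS.card_joinForest_ne_zero cs hx)
    rw [joinTree, card_sumset]
    nlinarith
  have h2 := Finset.sum_le_sum h1
  rw [Finset.sum_add_distrib, Finset.sum_add_distrib, sum_card_group, ← Finset.card_eq_sum_ones]
    at h2
  omega

/-- The summand for the key tuples of `p` makes the induction work: it reserves one join row per key
tuple for the row of `data` that is still to be output. For each tree, the rows beyond one per
shared value are paid for by the key tuples of the parent. -/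
theorem outLength_add_le (hS : Matched S) (p : Fin r) (F : Forest (Fin r)) :
    outLength S p F + (keyTuples S p).card ≤
      ∑ x ∈ keyTuples S p, (joinForest S p x F).card := by
  induction F generalizing p with
  | nil => simp [outLength, joinForest_nil]
  | node i cs rest ih₁ ih₂ =>
    have h1 := length_add_outLength_le hS (ih₁ i)
    have h2 := ih₂ p
    have hpos : ∀ y ∈ sharedTuples S p i, 0 < (joinShared S p i cs y).card := fun y hy =>
      Nat.pos_of_ne_zero
        (card_joinShared_ne_zero (fun x hx => hS.card_joinTree_ne_zero cs hx) hy)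
    have h3 : ∑ x ∈ keyTuples S i, (joinTree S i cs x).card =
        ∑ y ∈ sharedTuples S p i, (joinShared S p i cs y).card := by
      rw [← Finset.sum_fiberwise_of_maps_to (t := sharedTuples S p i)
        (g := fun x => restrict (σ.key p) x) fun x hx => Finset.mem_image_of_mem _ hx]
      simp [joinShared]
    -- Every shared value is the restriction of at least one key tuple of the parent; this uses
    -- matching from the child to the parent.
    have h4 : ∑ y ∈ sharedTuples S p i, ((joinShared S p i cs y).card - 1) ≤
        ∑ x ∈ keyTuples S p, ((joinShared S p i cs (restrict (σ.key i) x)).card - 1) := by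
      rw [← Finset.sum_fiberwise_of_maps_to (s := keyTuples S p) (t := sharedTuples S p i)
        (g := fun x => restrict (σ.key i) x) fun x hx => hS.restrict_mem i hx]
      refine Finset.sum_le_sum fun y hy => ?_
      obtain ⟨x', hx', rfl⟩ := Finset.mem_image.1 hy
      obtain ⟨t', ht', rfl⟩ := (mem_keyTuples S).1 hx'
      obtain ⟨t, ht, hk⟩ := hS i p t' ht'
      refine le_trans ?_ (Finset.single_le_sum
        (f := fun x => (joinShared S p i cs (restrict (σ.key i) x)).card - 1)
        (fun _ _ => Nat.zero_le _)
        (Finset.mem_filter.2 ⟨(mem_keyTuples S).2 ⟨t, ht, rfl⟩, hk⟩))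
      exact le_of_eq (by rw [hk])
    have h5 : ∑ y ∈ sharedTuples S p i, ((joinShared S p i cs y).card - 1) +
        (sharedTuples S p i).card = ∑ y ∈ sharedTuples S p i, (joinShared S p i cs y).card := by
      rw [Finset.card_eq_sum_ones, ← Finset.sum_add_distrib]
      exact Finset.sum_congr rfl fun y hy => Nat.succ_pred_eq_of_pos (hpos y hy)
    -- Termwise this is `(a - 1) + b ≤ a * b` for positive integers.
    have h6 : ∑ x ∈ keyTuples S p, ((joinShared S p i cs (restrict (σ.key i) x)).card - 1) +
        ∑ x ∈ keyTuples S p, (joinForest S p x rest).card ≤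
        ∑ x ∈ keyTuples S p, (joinForest S p x (.node i cs rest)).card := by
      rw [← Finset.sum_add_distrib]
      refine Finset.sum_le_sum fun x hx => ?_
      have a := hpos _ (hS.restrict_mem i hx)
      have b := Nat.pos_of_ne_zero (hS.card_joinForest_ne_zero rest hx)
      rw [joinForest_node, card_sumset]
      obtain ⟨a', ha'⟩ := Nat.exists_eq_add_of_le' a
      rw [ha'] at *
      simp only [Nat.add_sub_cancel]
      nlinarith
    have h7 := card_sharedTuples_le S p i
    have h8 := card_keyTuples_le S i
    simp only [outLength]
    omega

end Algorithm

/-! ## Join trees -/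

namespace Forest

variable {α : Type}

/-- Every node below the root is the child end of exactly one listed edge; with distinct labels its
parent is therefore unique. -/
theorem map_snd_edges (p : α) (F : Forest α) : (F.edges p).map Prod.snd = F.labels := by
  induction F generalizing p with
  | nil => rfl
  | node a cs rest ih₁ ih₂ => simp [edges, labels, ih₁, ih₂]

theorem fst_mem_of_mem_edges {p : α} {F : Forest α} {e : α × α} (h : e ∈ F.edges p) :
    e.1 = p ∨ e.1 ∈ F.labels := by
  induction F generalizing p with
  | nil => simp [edges] at h
  | node a cs rest ih₁ ih₂ =>
    simp only [edges, List.mem_cons, List.mem_append] at h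
    simp only [labels, List.mem_cons, List.mem_append]
    rcases h with rfl | h | h
    · exact Or.inl rfl
    · have := ih₁ h
      tauto
    · have := ih₂ h
      tauto

theorem snd_mem_of_mem_edges {p : α} {F : Forest α} {e : α × α} (h : e ∈ F.edges p) :
    e.2 ∈ F.labels := by
  rw [← map_snd_edges p F]
  exact List.mem_map_of_mem h

theorem reachable_of_edges (G : SimpleGraph α) {p : α} {F : Forest α}
    (h : ∀ e ∈ F.edges p, G.Reachable e.1 e.2) {k : α} (hk : k ∈ F.labels) :
    G.Reachable p k := by
  induction F generalizing p with
  | nil => simp [labels] at hk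
  | node a cs rest ih₁ ih₂ =>
    simp only [edges, List.mem_cons, List.mem_append] at h
    simp only [labels, List.mem_cons, List.mem_append] at hk
    have ha : G.Reachable p a := h (p, a) (Or.inl rfl)
    rcases hk with rfl | hk | hk
    · exact ha
    · exact ha.trans (ih₁ (fun e he => h e (Or.inr (Or.inl he))) hk)
    · exact ih₂ (fun e he => h e (Or.inr (Or.inr he))) hk

end Forest

section JoinTree

variable [DecidableEq κ] {σ : Schema r κ} {τ : RootedTree (Fin r)}

theorem IsJoinTree.reachable (h : IsJoinTree σ τ) (i j : Fin r) : τ.graph.Reachable i j := by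
  have hroot : ∀ k, τ.graph.Reachable τ.root k := by
    intro k
    have hk : k = τ.root ∨ k ∈ τ.children.labels := by
      simpa [RootedTree.labels] using h.mem_labels k
    rcases hk with rfl | hk
    · exact SimpleGraph.Reachable.rfl
    · refine Forest.reachable_of_edges _ (fun e he => ?_) hk
      -- `SimpleGraph.fromRel` discards loops, so equal endpoints need a separate case.
      by_cases hne : e.1 = e.2
      · rw [hne]
      · exact SimpleGraph.Adj.reachable
          ((SimpleGraph.fromRel_adj _ _ _).2 ⟨hne, Or.inl he⟩)
  exact (hroot i).symm.trans (hroot j)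

/-- A key attribute of a leaf occurs in some other relation as well. The path to that relation has
to leave the leaf through its parent, whose key contains the attribute by the path condition. The
hypotheses `hE` and `hF` locate the edges of the subforest within the whole tree, so that the
induction can see that a leaf has no further neighbours. -/
theorem IsJoinTree.leafKeys_aux (h : IsJoinTree σ τ) (p : Fin r) (F : Forest (Fin r))
    (hE : ∀ e ∈ F.edges p, e ∈ τ.children.edges τ.root)
    (hF : ∀ e ∈ τ.children.edges τ.root, e.1 ∈ F.labels → e ∈ F.edges p)
    (hnd : (p :: F.labels).Nodup) : LeafKeys σ p F := by
  induction F generalizing p with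
  | nil => trivial
  | node i cs rest ih₁ ih₂ =>
    simp only [Forest.labels, Forest.edges, List.nodup_cons, List.mem_cons, List.mem_append,
      not_or, List.nodup_append'] at hE hF hnd
    obtain ⟨⟨hpi, hpc, hpr⟩, ⟨hic, hir⟩, hcs, hrest, hdis⟩ := hnd
    refine ⟨?_, ih₁ i (fun e he => hE e (Or.inr (Or.inl he))) (fun e he hk => ?_) ?_,
      ih₂ p (fun e he => hE e (Or.inr (Or.inr he))) (fun e he hk => ?_) ?_⟩
    · rintro rfl a ha
      obtain ⟨j, hj, haj⟩ : ∃ j, j ≠ i ∧ a ∈ σ.key j := by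
        obtain ⟨j, j', hjj, h1, h2⟩ := σ.shared a
        by_cases hji : j = i
        · exact ⟨j', fun h' => hjj (hji.trans h'.symm), h2⟩
        · exact ⟨j, hji, h1⟩
      obtain ⟨w, hw⟩ := (h.reachable i j).exists_isPath
      have hpath := h.path i j w hw
      cases w with
      | nil => exact absurd rfl hj
      | @cons _ v _ hadj w =>
        -- The first step of the path leads to a child, which a leaf does not have, or to a parent,
        -- which is unique.
        obtain ⟨-, hv | hv⟩ := (SimpleGraph.fromRel_adj _ _ _).1 hadj
        · have hv' := hF (i, v) hv (Or.inl rfl)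
          simp only [Forest.edges, Prod.mk.injEq, List.not_mem_nil, false_or] at hv'
          rcases hv' with ⟨h', -⟩ | h'
          · exact absurd h'.symm hpi
          · rcases Forest.fst_mem_of_mem_edges h' with h' | h'
            · exact absurd h'.symm hpi
            · exact absurd h' hir
        · have hp := hE (p, i) (Or.inl rfl)
          have hnd : ((τ.children.edges τ.root).map Prod.snd).Nodup := by
            rw [Forest.map_snd_edges]
            exact (List.nodup_cons.1 h.nodup).2
          have := List.inj_on_of_nodup_map hnd hv hp rfl
          have hvp : v = p := congrArg Prod.fst this
          subst hvp
          exact hpath v (by simp) (Finset.mem_inter.2 ⟨ha, haj⟩)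
    · rcases hF e he (Or.inr (Or.inl hk)) with rfl | h' | h'
      · exact absurd hk hpc
      · exact h'
      · rcases Forest.fst_mem_of_mem_edges h' with h' | h'
        · exact absurd (h' ▸ hk) hpc
        · exact absurd h' (hdis hk)
    · exact List.nodup_cons.2 ⟨hic, hcs⟩
    · rcases hF e he (Or.inr (Or.inr hk)) with rfl | h' | h'
      · exact absurd hk hpr
      · rcases Forest.fst_mem_of_mem_edges h' with h' | h'
        · exact absurd (h' ▸ hk) hir
        · exact absurd hk (hdis h')
      · exact h'
    · exact List.nodup_cons.2 ⟨hpr, hrest⟩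

theorem IsJoinTree.leafKeys (h : IsJoinTree σ τ) : LeafKeys σ τ.root τ.children :=
  h.leafKeys_aux _ _ (fun _ he => he) (fun _ he _ => he) h.nodup

theorem restrict_keyTuple_eq_iff {i j : Fin r} (t : σ.Tuple V i) (t' : σ.Tuple V j) :
    restrict (σ.key i) (keyTuple t') = restrict (σ.key j) (keyTuple t) ↔
      ∀ a (hi : a ∈ σ.key i) (hj : a ∈ σ.key j), t'.1 ⟨a, hj⟩ = t.1 ⟨a, hi⟩ := by
  have h1 : ∀ a, restrict (σ.key i) (keyTuple t') a =
    if a ∈ σ.key i then (if h : a ∈ σ.key j then some (t'.1 ⟨a, h⟩) else none) else none :=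
    fun _ => rfl
  have h2 : ∀ a, restrict (σ.key j) (keyTuple t) a =
    if a ∈ σ.key j then (if h : a ∈ σ.key i then some (t.1 ⟨a, h⟩) else none) else none :=
    fun _ => rfl
  constructor
  · intro h a hi hj
    have := congrFun h a
    rw [h1, h2] at this
    simpa [hi, hj] using this
  · intro h
    funext a
    rw [h1, h2]
    by_cases hi : a ∈ σ.key i <;> by_cases hj : a ∈ σ.key j <;> simp [hi, hj]
    exact h a hi hj

theorem FullyReduced.matched {S : σ.Database V} (h : FullyReduced S) : Matched S := by
  intro i j t ht
  obtain ⟨u, hu, rfl⟩ := h i t ht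
  exact ⟨_, hu j, (restrict_keyTuple_eq_iff _ _).2 fun a _ _ => rfl⟩

/-- Rows of all relations that match along the edges of a join tree match everywhere. -/
theorem IsJoinTree.consistent (h : IsJoinTree σ τ) (f : ∀ i, σ.Tuple V i)
    (hf : ∀ e ∈ τ.children.edges τ.root,
      restrict (σ.key e.1) (keyTuple (f e.2)) = restrict (σ.key e.2) (keyTuple (f e.1)))
    (i j : Fin r) (a : κ) (hi : a ∈ σ.key i) (hj : a ∈ σ.key j) :
    (f i).1 ⟨a, hi⟩ = (f j).1 ⟨a, hj⟩ := by
  obtain ⟨w, hw⟩ := (h.reachable i j).exists_isPath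
  have hpath : ∀ k ∈ w.support, a ∈ σ.key k := fun k hk =>
    h.path i j w hw k hk (Finset.mem_inter.2 ⟨hi, hj⟩)
  -- Being a path was needed only to place `a` in every key along the way. The induction runs over
  -- arbitrary walks with that property.
  clear hw
  induction w with
  | nil => rfl
  | @cons u v _ hadj w ih =>
    have hv : a ∈ σ.key v := hpath v (by simp)
    rw [← ih hv hj fun k hk => hpath k (by simp [hk])]
    obtain ⟨-, he | he⟩ := (SimpleGraph.fromRel_adj _ _ _).1 hadj
    · exact ((restrict_keyTuple_eq_iff _ _).1 (hf _ he) a hi hv).symm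
    · exact (restrict_keyTuple_eq_iff _ _).1 (hf _ he) a hv hi

end JoinTree

/-! ## The natural join along a join tree -/

section Selections

variable {σ : Schema r κ}

/-- The data of the chosen rows of the given relations. -/
def rowOf (l : List (Fin r)) (f : ∀ i, σ.Tuple V i) : σ.Row := (l.map fun k => embed (f k)).sum

theorem rowOf_congr {l : List (Fin r)} {f g : ∀ i, σ.Tuple V i} (h : ∀ k ∈ l, f k = g k) :
    rowOf l f = rowOf l g := by
  unfold rowOf
  rw [List.map_congr_left fun k hk => by rw [h k hk]]

theorem rowOf_eq {l : List (Fin r)} (hl : l.Nodup) (hmem : ∀ i, i ∈ l) (f : ∀ i, σ.Tuple V i) :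
    rowOf l f = fun i => (f i).2 := by
  rw [rowOf, ← List.sum_toFinset _ hl, show l.toFinset = Finset.univ by ext; simp [hmem]]
  exact Finset.univ_sum_single fun i => (f i).2

variable [Fintype κ] [DecidableEq κ] [DecidableEq V] (S : σ.Database V)

/-- All choices of rows of the relations in a forest with parent `p` that match along the edges;
for the other relations the rows are those of `f`. -/
def selections : Fin r → (∀ i, σ.Tuple V i) → Forest (Fin r) → List (∀ i, σ.Tuple V i)
  | _, f, .nil => [f]
  | p, f, .node i cs rest =>
    ((S i).filter fun t =>
        restrict (σ.key p) (keyTuple t) = restrict (σ.key i) (keyTuple (f p))).flatMap fun t =>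
      (selections i (Function.update f i t) cs).flatMap fun g => selections p g rest

/-- Since the labels are distinct, choices in the children and in the siblings affect different
relations, and neither changes the row of `p` or of `i` on which the matching conditions depend. -/
theorem mem_selections {p : Fin r} {F : Forest (Fin r)} (hF : (p :: F.labels).Nodup)
    (f g : ∀ i, σ.Tuple V i) :
    g ∈ selections S p f F ↔ (∀ k, k ∉ F.labels → g k = f k) ∧ (∀ k ∈ F.labels, g k ∈ S k) ∧
      ∀ e ∈ F.edges p,
        restrict (σ.key e.1) (keyTuple (g e.2)) = restrict (σ.key e.2) (keyTuple (g e.1)) := by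
  induction F generalizing p f g with
  | nil =>
    simp only [selections, List.mem_singleton, Forest.labels, Forest.edges]
    constructor
    · rintro rfl; simp
    · intro h; funext k; exact h.1 k (by simp)
  | node i cs rest ih₁ ih₂ =>
    simp only [Forest.labels, Forest.edges, List.nodup_cons, List.mem_cons, List.mem_append,
      not_or, List.nodup_append'] at hF ⊢
    obtain ⟨⟨hpi, hpc, hpr⟩, ⟨hic, hir⟩, hcs, hrest, hdis⟩ := hF
    simp only [selections, List.mem_flatMap, List.mem_filter, decide_eq_true_eq,
      ih₁ (List.nodup_cons.2 ⟨hic, hcs⟩), ih₂ (List.nodup_cons.2 ⟨hpr, hrest⟩)]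
    constructor
    · rintro ⟨t, ⟨ht, htp⟩, f₁, ⟨h1, h2, h3⟩, h4, h5, h6⟩
      have hgi : g i = t := by rw [h4 i hir, h1 i hic, Function.update_self]
      have hgp : g p = f p := by rw [h4 p hpr, h1 p hpc, Function.update_of_ne hpi]
      have hgc : ∀ k ∈ cs.labels, g k = f₁ k := fun k hk => h4 k (hdis hk)
      have hgi' : g i = f₁ i := h4 i hir
      refine ⟨fun k hk => ?_, fun k hk => ?_, fun e he => ?_⟩
      · rw [h4 k hk.2.2, h1 k hk.2.1, Function.update_of_ne hk.1]
      · rcases hk with rfl | hk | hk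
        · rwa [hgi]
        · rw [hgc k hk]; exact h2 k hk
        · exact h5 k hk
      · rcases he with rfl | he | he
        · simp only [hgi, hgp]; exact htp
        · rw [hgc _ (Forest.snd_mem_of_mem_edges he)]
          have : g e.1 = f₁ e.1 := by
            rcases Forest.fst_mem_of_mem_edges he with h | h
            · rw [h, hgi']
            · exact hgc _ h
          rw [this]
          exact h3 e he
        · exact h6 e he
    · rintro ⟨h1, h2, h3⟩
      have hgp : g p = f p := h1 p ⟨hpi, hpc, hpr⟩
      have hd : ∀ k ∈ cs.labels, k ∉ rest.labels := fun k hk => hdis hk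
      -- The intermediate choice after the subtree of `i`: the siblings still have their rows from
      -- `f`.
      refine ⟨g i, ⟨h2 i (Or.inl rfl), ?_⟩, fun k => if k ∈ rest.labels then f k else g k,
        ⟨fun k hk => ?_, fun k hk => ?_, fun e he => ?_⟩, fun k hk => ?_, fun k hk => ?_,
        fun e he => ?_⟩
      · rw [← hgp]
        exact h3 (p, i) (Or.inl rfl)
      · by_cases hki : k = i
        · subst hki; simp [hir]
        · rw [Function.update_of_ne hki]
          by_cases hkr : k ∈ rest.labels
          · simp [hkr]
          · simp only [hkr, if_false]
            exact h1 k ⟨hki, hk, hkr⟩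
      · simp only [hd k hk, if_false]
        exact h2 k (Or.inr (Or.inl hk))
      · have e1 : e.1 ∉ rest.labels := by
          rcases Forest.fst_mem_of_mem_edges he with h | h
          · rwa [h]
          · exact hdis h
        simp only [e1, hd _ (Forest.snd_mem_of_mem_edges he), if_false]
        exact h3 e (Or.inr (Or.inl he))
      · simp [hk]
      · exact h2 k (Or.inr (Or.inr hk))
      · exact h3 e (Or.inr (Or.inr he))

theorem nodup_selections (hS : ∀ i, (S i).Nodup) {p : Fin r} {F : Forest (Fin r)}
    (hF : (p :: F.labels).Nodup) (f : ∀ i, σ.Tuple V i) : (selections S p f F).Nodup := by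
  induction F generalizing p f with
  | nil => simp [selections]
  | node i cs rest ih₁ ih₂ =>
    have hF' := hF
    simp only [Forest.labels, List.nodup_cons, List.mem_cons, List.mem_append,
      not_or, List.nodup_append'] at hF
    obtain ⟨⟨hpi, hpc, hpr⟩, ⟨hic, hir⟩, hcs, hrest, hdis⟩ := hF
    have n1 := List.nodup_cons.2 ⟨hic, hcs⟩
    have n2 := List.nodup_cons.2 ⟨hpr, hrest⟩
    rw [selections, List.nodup_flatMap]
    refine ⟨fun t _ => ?_, ?_⟩
    · rw [List.nodup_flatMap]
      refine ⟨fun g _ => ih₂ n2 g, ?_⟩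
      refine (ih₁ n1 _).pairwise_of_forall_ne fun g hg g' hg' hne => ?_
      intro h h1 h2
      rw [mem_selections S n1] at hg hg'
      rw [mem_selections S n2] at h1 h2
      refine hne (funext fun k => ?_)
      by_cases hk : k ∈ rest.labels
      · have hkc : k ∉ cs.labels := fun h' => hdis h' hk
        rw [hg.1 k hkc, hg'.1 k hkc]
      · rw [← h1.1 k hk, ← h2.1 k hk]
    · refine ((hS i).filter _).pairwise_of_forall_ne fun t _ t' _ hne => ?_
      intro h h1 h2
      simp only [List.mem_flatMap, mem_selections S n1, mem_selections S n2] at h1 h2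
      obtain ⟨g, hg, hg2⟩ := h1
      obtain ⟨g', hg', hg2'⟩ := h2
      refine hne ?_
      have e1 := hg.1 i hic
      have e2 := hg'.1 i hic
      rw [Function.update_self] at e1 e2
      rw [← e1, ← e2, ← hg2.1 i hir, ← hg2'.1 i hir]

/-- Every row belongs to exactly one group, so summing over key tuples amounts to going through the
rows one by one. -/
theorem sum_sumset_group (i : Fin r) (s : Finset (KeyTuple κ V)) (J : KeyTuple κ V → Multiset σ.Row)
    (l : List (σ.Tuple V i)) :
    ∑ x ∈ s, sumset (((l.filter (keyTuple · = x)).map embed : List σ.Row) : Multiset σ.Row) (J x) =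
      ((l.filter (keyTuple · ∈ s) : List _) : Multiset (σ.Tuple V i)).bind
        fun t => (J (keyTuple t)).map (embed t + ·) := by
  induction l with
  | nil => simp
  | cons t l ih =>
    have e : ∀ x, sumset ((((t :: l).filter (keyTuple · = x)).map embed : List σ.Row) :
        Multiset σ.Row) (J x) = (if keyTuple t = x then (J x).map (embed t + ·) else 0) +
          sumset (((l.filter (keyTuple · = x)).map embed : List σ.Row) : Multiset σ.Row) (J x) := by
      intro x
      by_cases hx : keyTuple t = x
      · simp [hx, ← Multiset.cons_coe]
      · simp [hx]
    simp only [e, Finset.sum_add_distrib, ih, Finset.sum_ite_eq]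
    by_cases ht : keyTuple t ∈ s
    · simp [ht, ← Multiset.cons_coe]
    · simp [ht]

theorem joinShared_eq_bind (p i : Fin r) (cs : Forest (Fin r)) (y : KeyTuple κ V) :
    joinShared S p i cs y =
      (((S i).filter fun t => restrict (σ.key p) (keyTuple t) = y : List _) :
        Multiset (σ.Tuple V i)).bind
          fun t => (joinForest S i (keyTuple t) cs).map (embed t + ·) := by
  refine (sum_sumset_group i _ (fun x => joinForest S i x cs) (S i)).trans ?_
  congr 2
  refine List.filter_congr fun t ht => ?_
  have : keyTuple t ∈ keyTuples S i := (mem_keyTuples S).2 ⟨t, ht, rfl⟩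
  simp [this]

/-- Both sides are the same nested bind over rows, and the data of a selection is the sum of the
parts from the row of `i`, its subtree and its siblings. The later choices leave the earlier parts
unchanged. -/
theorem map_rowOf_selections {p : Fin r} {F : Forest (Fin r)} (hF : (p :: F.labels).Nodup)
    (f : ∀ i, σ.Tuple V i) :
    ((selections S p f F).map (rowOf F.labels) : Multiset σ.Row) =
      joinForest S p (keyTuple (f p)) F := by
  induction F generalizing p f with
  | nil => simp [selections, joinForest_nil, rowOf, Forest.labels]
  | node i cs rest ih₁ ih₂ =>
    simp only [Forest.labels, List.nodup_cons, List.mem_cons, List.mem_append,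
      not_or, List.nodup_append'] at hF
    obtain ⟨⟨hpi, hpc, hpr⟩, ⟨hic, hir⟩, hcs, hrest, hdis⟩ := hF
    have n1 := List.nodup_cons.2 ⟨hic, hcs⟩
    have n2 := List.nodup_cons.2 ⟨hpr, hrest⟩
    rw [joinForest_node, joinShared_eq_bind, selections, ← Multiset.map_coe, ← Multiset.coe_bind,
      Multiset.map_bind]
    unfold sumset
    rw [Multiset.bind_assoc]
    refine Multiset.bind_congr fun t _ => ?_
    rw [← Multiset.coe_bind, Multiset.map_bind, Multiset.bind_map]
    have h1 := ih₁ n1 (Function.update f i t)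
    rw [Function.update_self] at h1
    rw [← h1, ← Multiset.map_coe, Multiset.bind_map]
    refine Multiset.bind_congr fun g hg => ?_
    rw [Multiset.mem_coe, mem_selections S n1] at hg
    have hgp : g p = f p := by rw [hg.1 p hpc, Function.update_of_ne hpi]
    have hgi : g i = t := by rw [hg.1 i hic, Function.update_self]
    rw [← hgp, ← ih₂ n2 g, ← Multiset.map_coe, Multiset.map_map]
    refine Multiset.map_congr rfl fun h hh => ?_
    rw [Multiset.mem_coe, mem_selections S n2] at hh
    rw [Function.comp_apply, rowOf_congr fun k hk => (hh.1 k (hdis hk)).symm]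
    simp [rowOf, Forest.labels, hh.1 i hir, hgi, add_assoc]

/-- The rows of the natural join are the rows of the join along a join tree. -/
theorem map_natJoin {S : σ.Database V} (hnd : ∀ i, (S i).Nodup) (hS : FullyReduced S)
    {τ : RootedTree (Fin r)} (hτ : IsJoinTree σ τ) {m : ℕ} (e : Fin m ≃ natJoin S) :
    (Finset.univ.val.map fun a => (e a).1.2 : Multiset σ.Row) = joinRows S τ := by
  have hjoin : joinRows S τ = ((S τ.root : List _) : Multiset (σ.Tuple V τ.root)).bind
      fun t => (joinForest S τ.root (keyTuple t) τ.children).map (embed t + ·) := by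
    refine (sum_sumset_group τ.root _ (fun x => joinForest S τ.root x τ.children)
      (S τ.root)).trans ?_
    congr 2
    refine List.filter_eq_self.2 fun t ht => ?_
    simpa using (mem_keyTuples S).2 ⟨t, ht, rfl⟩
  -- Selections are families over all relations and need some initial rows. A join tuple supplies
  -- them; without one, full reduction makes the root relation empty.
  obtain hempty | ⟨u₀, hu₀⟩ := (natJoin S).eq_empty_or_nonempty
  · have hm : IsEmpty (Fin m) := e.isEmpty_congr.2 (Set.isEmpty_coe_sort.2 hempty)
    have hroot : S τ.root = [] := by
      rw [List.eq_nil_iff_forall_not_mem]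
      intro t ht
      obtain ⟨u, hu, -⟩ := hS _ t ht
      rw [hempty] at hu
      exact hu
    rw [hjoin, hroot]
    simp
  · have hn : (τ.root :: τ.children.labels).Nodup := hτ.nodup
    have hroot := (List.nodup_cons.1 hn).1
    let f₀ : ∀ i, σ.Tuple V i := Schema.JoinTuple.proj u₀
    let L := (S τ.root).flatMap fun t =>
      selections S τ.root (Function.update f₀ τ.root t) τ.children
    have hlab : ∀ k, k = τ.root ∨ k ∈ τ.children.labels := fun k => by
      simpa [RootedTree.labels] using hτ.mem_labels k
    have hL : ∀ f, f ∈ L ↔ (∀ k, f k ∈ S k) ∧ ∀ e ∈ τ.children.edges τ.root,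
        restrict (σ.key e.1) (keyTuple (f e.2)) = restrict (σ.key e.2) (keyTuple (f e.1)) := by
      intro f
      simp only [L, List.mem_flatMap, mem_selections S hn]
      constructor
      · rintro ⟨t, ht, h1, h2, h3⟩
        refine ⟨fun k => ?_, h3⟩
        rcases hlab k with rfl | hk
        · rw [h1 _ hroot, Function.update_self]
          exact ht
        · exact h2 k hk
      · rintro ⟨h1, h2⟩
        refine ⟨f τ.root, h1 _, fun k hk => ?_, fun k _ => h1 k, h2⟩
        rcases hlab k with rfl | hk'
        · rw [Function.update_self]
        · exact absurd hk' hk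
    have hLnd : L.Nodup := by
      rw [List.nodup_flatMap]
      refine ⟨fun t _ => nodup_selections S hnd hn _,
        (hnd _).pairwise_of_forall_ne fun t _ t' _ hne => ?_⟩
      intro h h1 h2
      rw [mem_selections S hn] at h1 h2
      have e1 := h1.1 _ hroot
      have e2 := h2.1 _ hroot
      rw [Function.update_self] at e1 e2
      exact hne (e1.symm.trans e2)
    have hLrow : (L.map (fun f => (fun i => (f i).2 : σ.Row)) : Multiset σ.Row) =
        joinRows S τ := by
      rw [hjoin, ← Multiset.map_coe]
      simp only [L]
      rw [← Multiset.coe_bind, Multiset.map_bind]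
      refine Multiset.bind_congr fun t _ => ?_
      have h1 := map_rowOf_selections S hn (Function.update f₀ τ.root t)
      rw [Function.update_self] at h1
      rw [← h1, ← Multiset.map_coe, Multiset.map_map]
      refine Multiset.map_congr rfl fun f hf => ?_
      rw [Multiset.mem_coe, mem_selections S hn] at hf
      rw [← rowOf_eq hn hτ.mem_labels]
      have e1 := hf.1 _ hroot
      rw [Function.update_self] at e1
      simp [rowOf, e1]
    rw [← hLrow]
    -- Both lists are free of repetitions and have the same members. A join tuple is determined by
    -- its projections because every key attribute belongs to some relation.
    have hperm : (List.ofFn fun a => Schema.JoinTuple.proj (e a).1).Perm L := by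
      refine (List.perm_ext_iff_of_nodup (List.nodup_ofFn.2 fun a b hab => ?_) hLnd).2 fun f => ?_
      · refine e.injective (Subtype.ext (Prod.ext (funext fun c => ?_) (funext fun i => ?_)))
        · obtain ⟨i, _, _, hi, _⟩ := σ.shared c
          exact congrFun (congrArg Prod.fst (congrFun hab i)) ⟨c, hi⟩
        · exact congrArg Prod.snd (congrFun hab i)
      · rw [hL, List.mem_ofFn]
        constructor
        · rintro ⟨a, rfl⟩
          exact ⟨fun k => (e a).2 k, fun _ _ => (restrict_keyTuple_eq_iff _ _).2 fun _ _ _ => rfl⟩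
        · rintro ⟨h1, h2⟩
          choose ι ι' hne hι hι' using σ.shared
          -- Each attribute takes its value from a chosen relation containing it; by `hτ.consistent`
          -- the choice does not matter.
          let u : σ.JoinTuple V := (fun c => (f (ι c)).1 ⟨c, hι c⟩, fun i => (f i).2)
          have hu : Schema.JoinTuple.proj u = f := by
            funext i
            refine Prod.ext (funext fun c => ?_) rfl
            exact hτ.consistent f h2 _ _ c.1 (hι c.1) c.2
          have hmem : u ∈ natJoin S := fun i => by
            rw [hu]
            exact h1 i
          refine ⟨e.symm ⟨u, hmem⟩, ?_⟩
          simpa using hu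
    rw [← Multiset.coe_eq_coe] at hperm
    rw [← Multiset.map_coe, ← hperm, Multiset.map_coe, List.map_ofFn]
    rw [Fin.univ_val_map]
    rfl

end Selections

/-! ## Orthogonal matrices and Givens rotations -/

section Orthogonal

open Matrix

theorem mem_orthogonalGroup_of_dotProduct {m : ℕ} {Q : Matrix (Fin m) (Fin m) ℝ}
    (h : ∀ u v, (Q *ᵥ u) ⬝ᵥ (Q *ᵥ v) = u ⬝ᵥ v) : Q ∈ Matrix.orthogonalGroup (Fin m) ℝ := by
  rw [Matrix.mem_orthogonalGroup_iff']
  ext a b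
  have := h (Pi.single a 1) (Pi.single b 1)
  rw [Matrix.mulVec_single_one, Matrix.mulVec_single_one] at this
  rw [Matrix.mul_apply, Matrix.one_apply]
  simpa [dotProduct, Matrix.col, Pi.single_apply, eq_comm] using this

/-- Matrices with the same Gram matrix differ by an orthogonal factor. -/
theorem exists_orthogonal_mul_eq {m : ℕ} {ι : Type} [Fintype ι] (A B : Matrix (Fin m) ι ℝ)
    (h : ∀ z : ι → ℝ, ∑ a, (A *ᵥ z) a ^ 2 = ∑ a, (B *ᵥ z) a ^ 2) :
    ∃ Q ∈ Matrix.orthogonalGroup (Fin m) ℝ, A = Q * B := by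
  classical
  let LA : (ι → ℝ) →ₗ[ℝ] EuclideanSpace ℝ (Fin m) :=
    (WithLp.linearEquiv 2 ℝ (Fin m → ℝ)).symm.toLinearMap ∘ₗ A.mulVecLin
  let LB : (ι → ℝ) →ₗ[ℝ] EuclideanSpace ℝ (Fin m) :=
    (WithLp.linearEquiv 2 ℝ (Fin m → ℝ)).symm.toLinearMap ∘ₗ B.mulVecLin
  have hLA : ∀ z a, LA z a = (A *ᵥ z) a := fun _ _ => rfl
  have hLB : ∀ z a, LB z a = (B *ᵥ z) a := fun _ _ => rfl
  have hnorm : ∀ z, ‖LA z‖ = ‖LB z‖ := fun z => by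
    simp only [EuclideanSpace.norm_eq, Real.norm_eq_abs, sq_abs, hLA, hLB, h]
  -- The map `LB z ↦ LA z` is an isometry on the range of `LB`. It is built from a linear section
  -- `g` and then extended to the whole space.
  obtain ⟨g, hg⟩ := LB.rangeRestrict.exists_rightInverse_of_surjective LB.range_rangeRestrict
  have hg' : ∀ y, LB (g y) = y := fun y => congrArg Subtype.val (LinearMap.congr_fun hg y)
  let L : LB.range →ₗᵢ[ℝ] EuclideanSpace ℝ (Fin m) :=
    ⟨LA ∘ₗ g, fun y => by
      rw [LinearMap.comp_apply, hnorm, hg']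
      rfl⟩
  have hL : ∀ z, L.extend (LB z) = LA z := fun z => by
    have h1 := L.extend_apply ⟨LB z, LinearMap.mem_range_self LB z⟩
    rw [h1]
    change LA (g _) = LA z
    -- The choice of preimage is irrelevant: by `hnorm` the kernel of `LB` is also that of `LA`.
    rw [← sub_eq_zero, ← map_sub, ← norm_eq_zero, hnorm, map_sub, hg', sub_self, norm_zero]
  let Q : Matrix (Fin m) (Fin m) ℝ :=
    Matrix.toEuclideanLin.symm L.extend.toLinearMap
  have hQ : ∀ y : EuclideanSpace ℝ (Fin m), WithLp.toLp 2 (Q *ᵥ y.ofLp) = L.extend y := fun y => by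
    have : Matrix.toEuclideanLin Q = L.extend.toLinearMap := LinearEquiv.apply_symm_apply _ _
    rw [← Matrix.toLpLin_apply, this]
    rfl
  refine ⟨Q, mem_orthogonalGroup_of_dotProduct fun u v => ?_, ?_⟩
  · have h1 := L.extend.inner_map_map (WithLp.toLp 2 v) (WithLp.toLp 2 u)
    rw [← hQ, ← hQ, EuclideanSpace.inner_eq_star_dotProduct,
      EuclideanSpace.inner_eq_star_dotProduct] at h1
    simpa using h1
  · refine Matrix.ext_of_mulVec_single fun i => ?_
    have h1 := hL (Pi.single i 1)
    rw [← hQ] at h1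
    have h2 := congrArg WithLp.ofLp h1
    rw [← Matrix.mulVec_mulVec]
    exact h2.symm

/-! ### Givens rotations and their products -/

variable {m : ℕ}

theorem givens_mulVec {i j : Fin m} (hij : i ≠ j) (θ : ℝ) (u : Fin m → ℝ) (a : Fin m) :
    (givens i j θ *ᵥ u) a =
      if a = i then Real.cos θ * u i - Real.sin θ * u j
      else if a = j then Real.sin θ * u i + Real.cos θ * u j else u a := by
  rw [Matrix.mulVec, dotProduct]
  by_cases hi : a = i
  · subst hi
    rw [if_pos rfl, Fintype.sum_eq_add a j hij]
    · simp [givens, hij, hij.symm, sub_eq_add_neg]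
    · rintro b ⟨hb1, hb2⟩
      simp [givens, hij, hb1, hb2, Ne.symm hb1]
  · by_cases hj : a = j
    · subst hj
      rw [if_neg hi, if_pos rfl, Fintype.sum_eq_add i a hij]
      · simp [givens, hij, hi]
      · rintro b ⟨hb1, hb2⟩
        simp [givens, hi, hb1, hb2, Ne.symm hb2]
    · rw [if_neg hi, if_neg hj, Fintype.sum_eq_single a]
      · simp [givens, hi, hj]
      · intro b hb
        simp [givens, hi, hj, Ne.symm hb]

theorem givens_mem_orthogonalGroup {i j : Fin m} (hij : i ≠ j) (θ : ℝ) :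
    givens i j θ ∈ Matrix.orthogonalGroup (Fin m) ℝ := by
  refine mem_orthogonalGroup_of_dotProduct fun u v => ?_
  rw [← sub_eq_zero, dotProduct, dotProduct, ← Finset.sum_sub_distrib,
    Fintype.sum_eq_add i j hij]
  · simp only [givens_mulVec hij, if_true, hij.symm, if_false]
    linear_combination (u i * v i + u j * v j) * Real.sin_sq_add_cos_sq θ
  · rintro a ⟨hi, hj⟩
    simp [givens_mulVec hij, hi, hj]

/-- Products of Givens rotations. -/
def IsGivensProduct (P : Matrix (Fin m) (Fin m) ℝ) : Prop :=
  ∃ G : List (Matrix (Fin m) (Fin m) ℝ),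
    (∀ g ∈ G, ∃ (i j : Fin m) (θ : ℝ), i ≠ j ∧ g = givens i j θ) ∧ G.prod = P

theorem isGivensProduct_one : IsGivensProduct (1 : Matrix (Fin m) (Fin m) ℝ) :=
  ⟨[], by simp, rfl⟩

theorem isGivensProduct_givens {i j : Fin m} (hij : i ≠ j) (θ : ℝ) :
    IsGivensProduct (givens i j θ) :=
  ⟨[givens i j θ], by simpa using ⟨i, j, hij, θ, rfl⟩, by simp⟩

theorem IsGivensProduct.mul {P P' : Matrix (Fin m) (Fin m) ℝ} (h : IsGivensProduct P)
    (h' : IsGivensProduct P') : IsGivensProduct (P * P') := by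
  obtain ⟨G, hG, rfl⟩ := h
  obtain ⟨G', hG', rfl⟩ := h'
  refine ⟨G ++ G', fun g hg => ?_, List.prod_append⟩
  rcases List.mem_append.1 hg with hg | hg
  · exact hG g hg
  · exact hG' g hg

theorem IsGivensProduct.mem_orthogonalGroup {P : Matrix (Fin m) (Fin m) ℝ}
    (h : IsGivensProduct P) : P ∈ Matrix.orthogonalGroup (Fin m) ℝ := by
  obtain ⟨G, hG, rfl⟩ := h
  refine Submonoid.list_prod_mem _ fun g hg => ?_
  obtain ⟨i, j, θ, hij, rfl⟩ := hG g hg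
  exact givens_mem_orthogonalGroup hij θ

/-- Rotate by minus the argument of `x + iy`. The sign condition later makes the diagonal entries
`1` and not `-1`. -/
theorem exists_rotation (x y : ℝ) :
    ∃ θ : ℝ, Real.sin θ * x + Real.cos θ * y = 0 ∧ 0 ≤ Real.cos θ * x - Real.sin θ * y := by
  have hx : x = ‖(⟨x, y⟩ : ℂ)‖ * Real.cos (Complex.arg ⟨x, y⟩) :=
    (Complex.norm_mul_cos_arg ⟨x, y⟩).symm
  have hy : y = ‖(⟨x, y⟩ : ℂ)‖ * Real.sin (Complex.arg ⟨x, y⟩) :=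
    (Complex.norm_mul_sin_arg ⟨x, y⟩).symm
  set ρ := ‖(⟨x, y⟩ : ℂ)‖
  set φ := Complex.arg ⟨x, y⟩
  refine ⟨-φ, ?_, ?_⟩
  · rw [hx, hy, Real.sin_neg, Real.cos_neg]
    ring
  · rw [hx, hy, Real.sin_neg, Real.cos_neg]
    have : Real.cos φ * (ρ * Real.cos φ) - -Real.sin φ * (ρ * Real.sin φ) = ρ := by
      linear_combination ρ * Real.sin_sq_add_cos_sq φ
    rw [this]
    exact norm_nonneg _

/-- Givens rotations annihilate the entries of a vector at the indices in `s`. -/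
theorem exists_givens_annihilate (u : Fin m → ℝ) (k : Fin m) (s : Finset (Fin m)) (hk : k ∉ s) :
    ∃ P, IsGivensProduct P ∧ (∀ i ∈ s, (P *ᵥ u) i = 0) ∧
      (∀ i, i ∉ s → i ≠ k → (P *ᵥ u) i = u i) ∧ (s.Nonempty → 0 ≤ (P *ᵥ u) k) ∧
      ∀ v : Fin m → ℝ, v k = 0 → (∀ i ∈ s, v i = 0) → P *ᵥ v = v := by
  induction s using Finset.induction_on with
  | empty => exact ⟨1, isGivensProduct_one, by simp, by simp, by simp, by simp⟩
  | insert i s his ih =>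
    rw [Finset.mem_insert, not_or] at hk
    obtain ⟨P, h1, h2, h3, -, h5⟩ := ih hk.2
    obtain ⟨θ, hθ, hθ'⟩ := exists_rotation ((P *ᵥ u) k) ((P *ᵥ u) i)
    refine ⟨givens k i θ * P, (isGivensProduct_givens hk.1 θ).mul h1, fun j hj => ?_,
      fun j hj hjk => ?_, fun _ => ?_, fun v hv hv' => ?_⟩
    · rw [← Matrix.mulVec_mulVec, givens_mulVec hk.1]
      rcases Finset.mem_insert.1 hj with rfl | hj
      · rw [if_neg (Ne.symm hk.1), if_pos rfl, hθ]
      · rw [if_neg (ne_of_mem_of_not_mem hj hk.2),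
          if_neg (ne_of_mem_of_not_mem hj his), h2 j hj]
    · rw [Finset.mem_insert, not_or] at hj
      rw [← Matrix.mulVec_mulVec, givens_mulVec hk.1, if_neg hjk, if_neg hj.1, h3 j hj.2 hjk]
    · rw [← Matrix.mulVec_mulVec, givens_mulVec hk.1, if_pos rfl]
      exact hθ'
    · rw [← Matrix.mulVec_mulVec, h5 v hv fun j hj => hv' j (Finset.mem_insert_of_mem hj)]
      funext j
      rw [givens_mulVec hk.1, hv, hv' i (Finset.mem_insert_self _ _)]
      split_ifs with h h'
      · rw [h, hv]; ring
      · rw [h', hv' i (Finset.mem_insert_self _ _)]; ring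
      · rfl

theorem sum_mul_of_mem_orthogonalGroup {U : Matrix (Fin m) (Fin m) ℝ}
    (hU : U ∈ Matrix.orthogonalGroup (Fin m) ℝ) (j k : Fin m) :
    ∑ a, U a j * U a k = (1 : Matrix (Fin m) (Fin m) ℝ) j k := by
  rw [← (Matrix.mem_orthogonalGroup_iff' (Fin m) ℝ).1 hU]
  simp [Matrix.mul_apply]

/-- Column `k` is orthogonal to column `j`, which is a standard basis vector. -/
theorem apply_eq_zero_of_column {U : Matrix (Fin m) (Fin m) ℝ}
    (hU : U ∈ Matrix.orthogonalGroup (Fin m) ℝ) {j k : Fin m} (hjk : j ≠ k)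
    (h : ∀ a, U a j = (1 : Matrix (Fin m) (Fin m) ℝ) a j) : U j k = 0 := by
  have := sum_mul_of_mem_orthogonalGroup hU j k
  simpa [h, Matrix.one_apply, hjk] using this

/-- Givens rotations reduce an orthogonal matrix to the identity matrix up to the last column. -/
theorem exists_givens_columns {Q : Matrix (Fin m) (Fin m) ℝ}
    (hQ : Q ∈ Matrix.orthogonalGroup (Fin m) ℝ) (n : ℕ) (hn : n + 1 ≤ m) :
    ∃ P : Matrix (Fin m) (Fin m) ℝ, IsGivensProduct P ∧ ∀ j : Fin m, (j : ℕ) < n →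
      ∀ a, (P * Q) a j = (1 : Matrix (Fin m) (Fin m) ℝ) a j := by
  induction n with
  | zero => exact ⟨1, isGivensProduct_one, by simp⟩
  | succ n ih =>
    obtain ⟨P, hP, hcol⟩ := ih (by omega)
    set U := P * Q with hUdef
    have hU : U ∈ Matrix.orthogonalGroup (Fin m) ℝ := mul_mem hP.mem_orthogonalGroup hQ
    let k : Fin m := ⟨n, by omega⟩
    obtain ⟨P', h1, h2, h3, h4, h5⟩ := exists_givens_annihilate (U.col k) k (Finset.Ioi k)
      (by simp)
    have hU' : P' * U ∈ Matrix.orthogonalGroup (Fin m) ℝ := mul_mem h1.mem_orthogonalGroup hU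
    have hcolk : ∀ j a, (P' * U) a j = (P' *ᵥ U.col j) a := fun j a => rfl
    have hne : ∀ a, a ≠ k → (P' * U) a k = 0 := fun a ha => by
      rw [hcolk]
      -- Above the diagonal, orthogonality to the finished columns forces zeros; below it, the
      -- rotations produce them.
      rcases lt_or_gt_of_ne ha with ha' | ha'
      · rw [h3 a (by simpa using ha'.le) ha]
        exact apply_eq_zero_of_column hU ha (hcol a ha')
      · exact h2 a (by simpa using ha')
    refine ⟨P' * P, h1.mul hP, fun j hj a => ?_⟩
    rw [Matrix.mul_assoc, ← hUdef]
    rcases Nat.lt_succ_iff_lt_or_eq.1 hj with hj | hj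
    · have hjk : j ≠ k := fun h => by simp [h, k] at hj
      rw [hcolk, h5]
      · exact hcol j hj a
      · exact (hcol j hj k).trans (Matrix.one_apply_ne hjk.symm)
      · intro i hi
        have hij : i ≠ j := by
          rintro rfl
          have h' : k < i := by simpa using hi
          have : n < (i : ℕ) := h'
          omega
        exact (hcol j hj i).trans (Matrix.one_apply_ne hij)
    · have hjk : j = k := Fin.ext hj
      rw [hjk]
      by_cases ha : a = k
      · rw [ha]
        have hsq := sum_mul_of_mem_orthogonalGroup hU' k k
        rw [Fintype.sum_eq_single k fun b hb => by rw [hne b hb, mul_zero],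
          Matrix.one_apply_eq] at hsq
        -- Fixing the sign requires an index below `k`, which is why the last column is excluded.
        have hpos : 0 ≤ (P' * U) k k := h4 ⟨⟨n + 1, by omega⟩, by simp [k, Fin.lt_def]⟩
        rw [Matrix.one_apply_eq]
        nlinarith
      · rw [hne a ha, Matrix.one_apply_ne ha]

/-- Givens rotations reduce an orthogonal matrix to a permutation matrix. -/
theorem exists_givens_permutation (hm : m ≠ 1) {Q : Matrix (Fin m) (Fin m) ℝ}
    (hQ : Q ∈ Matrix.orthogonalGroup (Fin m) ℝ) :
    ∃ (P : Matrix (Fin m) (Fin m) ℝ) (π : Equiv.Perm (Fin m)), IsGivensProduct P ∧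
      P * Q = (1 : Matrix (Fin m) (Fin m) ℝ).submatrix π id := by
  rcases Nat.eq_zero_or_pos m with rfl | hpos
  · exact ⟨1, Equiv.refl _, isGivensProduct_one, Subsingleton.elim _ _⟩
  obtain ⟨P, hP, hcol⟩ := exists_givens_columns hQ (m - 1) (by omega)
  set U := P * Q with hUdef
  have hU : U ∈ Matrix.orthogonalGroup (Fin m) ℝ := mul_mem hP.mem_orthogonalGroup hQ
  let l : Fin m := ⟨m - 1, by omega⟩
  let z : Fin m := ⟨0, hpos⟩
  have hzl : z ≠ l := by
    intro h
    have : (0 : ℕ) = m - 1 := congrArg Fin.val h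
    omega
  have hlt : ∀ j : Fin m, j ≠ l → (j : ℕ) < m - 1 := fun j hj => by
    have h1 : (j : ℕ) ≠ m - 1 := fun h => hj (Fin.ext h)
    have := j.2
    omega
  have hlast : ∀ j, j ≠ l → U j l = 0 := fun j hj =>
    apply_eq_zero_of_column hU hj (hcol j (hlt j hj))
  have hsq := sum_mul_of_mem_orthogonalGroup hU l l
  rw [Fintype.sum_eq_single l fun b hb => by rw [hlast b hb, mul_zero], Matrix.one_apply_eq] at hsq
  have hentry : ∀ a b, U a b = if b = l then (if a = l then U l l else 0) else
      (1 : Matrix (Fin m) (Fin m) ℝ) a b := fun a b => by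
    split_ifs with hb ha
    · rw [ha, hb]
    · rw [hb, hlast a ha]
    · exact hcol b (hlt b hb) a
  rcases mul_self_eq_one_iff.1 hsq with h1 | h1
  · refine ⟨P, Equiv.refl _, hP, ?_⟩
    ext a b
    rw [← hUdef, hentry, h1, Matrix.submatrix_apply, id, Equiv.refl_apply]
    split_ifs with hb ha
    · rw [ha, hb, Matrix.one_apply_eq]
    · rw [hb, Matrix.one_apply_ne ha]
    · rfl
  -- The last diagonal entry is `-1`. A quarter turn exchanges rows `z` and `l` and negates the one
  -- that carries this entry, which leaves a transposition.
  · refine ⟨givens z l (Real.pi / 2) * P, Equiv.swap z l,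
      (isGivensProduct_givens hzl _).mul hP, ?_⟩
    ext a b
    rw [Matrix.mul_assoc, ← hUdef]
    have : (givens z l (Real.pi / 2) * U) a b = (givens z l (Real.pi / 2) *ᵥ U.col b) a := rfl
    rw [this, givens_mulVec hzl, Real.cos_pi_div_two, Real.sin_pi_div_two, Matrix.submatrix_apply,
      id]
    simp only [Matrix.col_apply, zero_mul, one_mul, zero_sub, add_zero]
    split_ifs with ha ha'
    · rw [ha, Equiv.swap_apply_left, hentry, if_pos rfl, h1]
      by_cases hb : b = l
      · rw [if_pos hb, hb, Matrix.one_apply_eq, neg_neg]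
      · rw [if_neg hb, Matrix.one_apply_ne (Ne.symm hb), neg_zero]
    · rw [ha', Equiv.swap_apply_right, hentry, if_neg hzl]
      by_cases hb : b = l
      · rw [if_pos hb, hb, Matrix.one_apply_ne hzl]
      · rw [if_neg hb]
    · rw [Equiv.swap_apply_of_ne_of_ne ha ha', hentry, if_neg ha']
      by_cases hb : b = l
      · rw [if_pos hb, hb, Matrix.one_apply_ne ha']
      · rw [if_neg hb]

theorem exists_givens_eq_submatrix {ι : Type} (hm : m ≠ 1) {Q : Matrix (Fin m) (Fin m) ℝ}
    (hQ : Q ∈ Matrix.orthogonalGroup (Fin m) ℝ) (B : Matrix (Fin m) ι ℝ) :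
    ∃ (G : List (Matrix (Fin m) (Fin m) ℝ)) (π : Equiv.Perm (Fin m)),
      (∀ g ∈ G, ∃ (i j : Fin m) (θ : ℝ), i ≠ j ∧ g = givens i j θ) ∧
      G.prod * (Q * B) = B.submatrix π id := by
  obtain ⟨P, π, ⟨G, hG, rfl⟩, h⟩ := exists_givens_permutation hm hQ
  refine ⟨G, π, hG, ?_⟩
  rw [← Matrix.mul_assoc, h]
  ext a b
  simp [Matrix.mul_apply, Matrix.one_apply]

end Orthogonal

/-! ## The running time -/

theorem loop_steps_le_sum {α β : Type} (c : α → ℕ) (f : β → α → Timed β) (l : List α) (b : β)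
    (h : ∀ a ∈ l, ∀ b, (f b a).steps ≤ c a) :
    (loop f l b).steps ≤ 1 + (l.map fun a => 1 + c a).sum :=
  loop_steps_le (fun _ => True) c f l b trivial fun a ha b _ => ⟨trivial, h a ha b⟩

theorem Forest.length_roots_le {α : Type} (F : Forest α) : F.roots.length ≤ F.labels.length := by
  induction F with
  | nil => simp [roots]
  | node a cs rest _ ih =>
    simp only [roots, labels, List.length_cons, List.length_append]
    omega

theorem length_roots_le_of_nodup {F : Forest (Fin r)} (h : F.labels.Nodup) :
    F.roots.length ≤ r :=
  F.length_roots_le.trans (by simpa using h.length_le_card)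

section HeadTail

variable {σ : Schema r κ}

/-- A row costs `14 * numCols σ + 4 * r + 8` steps, apart from the recursive call. Because `r` is
positive, additive constants are absorbed; the constants in this part are not sharp. -/
theorem headTailLoop_steps (hr : 0 < r) (k : ℝ) (l : List (ℝ × σ.Row)) (q : ℝ) (s : σ.Row)
    (out : List σ.Row) :
    (headTailLoop k l q s out).steps ≤
      6 * (numCols σ + r) + 22 * (numCols σ + r) * l.length := by
  induction l generalizing q s out with
  | nil =>
    simp only [headTailLoop, Timed.steps_bind, steps_tick, steps_sqrt, Timed.steps_pure]
    rw [steps_grid _ 2 fun i c => by simp]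
    simp only [List.length_nil]
    omega
  | cons p l ih =>
    obtain ⟨v, w⟩ := p
    simp only [headTailLoop, Timed.steps_bind, steps_tick, steps_sqrt, steps_mul, steps_add,
      steps_push]
    rw [steps_grid _ 8 fun i c => by simp, steps_grid _ 4 fun i c => by simp]
    refine (Nat.add_le_add_left (Nat.add_le_add_left (Nat.add_le_add_left (Nat.add_le_add_left
      (Nat.add_le_add_left (Nat.add_le_add_left (Nat.add_le_add_left (Nat.add_le_add_left
        (ih _ _ _) _) _) _) _) _) _) _) _).trans ?_
    rw [List.length_cons, Nat.mul_succ]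
    omega

theorem headTail_steps (hr : 0 < r) (k : ℝ) (l : List (ℝ × σ.Row)) (out : List σ.Row) :
    (headTail k l out).steps ≤ 1 + 22 * (numCols σ + r) * l.length := by
  cases l with
  | nil => simp [headTail]
  | cons p l =>
    obtain ⟨v, w⟩ := p
    simp only [headTail, Timed.steps_bind, steps_tick, steps_mul]
    rw [steps_grid _ 2 fun i c => by simp]
    refine (Nat.add_le_add_left (Nat.add_le_add_left (Nat.add_le_add_left
      (headTailLoop_steps hr _ _ _ _ _) _) _) _).trans ?_
    rw [List.length_cons, Nat.mul_succ]
    omega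

theorem width_le_numCols (σ : Schema r κ) (i : Fin r) : σ.width i ≤ numCols σ :=
  Finset.single_le_sum (f := σ.width) (fun _ _ => Nat.zero_le _) (Finset.mem_univ i)

theorem padRow_steps (hr : 0 < r) {i : Fin r} (t : σ.Tuple V i) :
    (padRow t).steps ≤ 6 * (numCols σ + r) := by
  have h := width_le_numCols σ i
  simp only [padRow, Timed.steps_bind, steps_setBlock]
  rw [steps_grid _ 0 fun i c => by simp]
  simp only [steps_tabulate, Finset.sum_const, Finset.card_univ, Fintype.card_fin, smul_eq_mul]
  omega

theorem collectNodes_steps (i : Fin r) (bs : List (Result σ V)) :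
    (collectNodes i bs).steps ≤ 1 + 2 * bs.length + 2 * (bs.flatMap Result.nodes).length := by
  refine (loop_steps_le_sum (fun b : Result σ V => 1 + b.nodes.length * (1 + 1)) _ bs _
    fun b _ l => loop_steps_le_const 1 _ _ _ fun k _ m => le_rfl).trans ?_
  induction bs with
  | nil => simp
  | cons b bs ih =>
    simp only [List.map_cons, List.sum_cons, List.length_cons, List.flatMap_cons,
      List.length_append] at ih ⊢
    omega

end HeadTail

/-- Distinct relations have disjoint blocks, so copying the blocks from all children costs a
multiple of `numCols σ + r` in total, not per child. -/
theorem sum_width_le (σ : Schema r κ) {l : List (Fin r)} (hl : l.Nodup) :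
    (l.map fun k => 3 + 3 * σ.width k).sum ≤ 3 * r + 3 * numCols σ := by
  rw [← List.sum_toFinset _ hl]
  refine (Finset.sum_le_univ_sum_of_nonneg fun _ => Nat.zero_le _).trans ?_
  rw [Finset.sum_add_distrib, ← Finset.mul_sum]
  simp [numCols, mul_comm]

theorem sum_length_filter {α K : Type} [DecidableEq K] (key : α → K) (l : List α) :
    ∑ k ∈ (l.map key).toFinset, (l.filter (key · = k)).length = l.length := by
  have h := Multiset.sum_count_eq_card (s := (l.map key).toFinset) (m := (l.map key : Multiset K))
    (by simp)
  rw [Multiset.coe_card, List.length_map] at h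
  rw [← h]
  refine Finset.sum_congr rfl fun k _ => ?_
  rw [Multiset.coe_count, List.count, List.countP_map, List.countP_eq_length_filter]
  congr 2

theorem divide_steps [Fintype κ] [DecidableEq V] (d e : KeyDict κ V ℝ) :
    (divide d e).steps ≤ 1 + 5 * d.keys.length := by
  refine (loop_steps_le_const 4 _ _ _ fun t _ d => by simp).trans ?_
  omega

theorem reduceGroups_steps [Fintype κ] [DecidableEq V] {σ : Schema r κ} (hr : 0 < r)
    (groups : KeyDict κ V (List (ℝ × σ.Row)))
    (tailCount headCount : KeyDict κ V ℝ) (out : List σ.Row) :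
    (reduceGroups groups tailCount headCount out).steps ≤ 1 + 9 * groups.keys.length +
      22 * (numCols σ + r) * (groups.keys.map fun x => (groups.get x).length).sum := by
  refine (loop_steps_le_sum
    (fun x => 8 + 22 * (numCols σ + r) * (groups.get x).length) _ _ _ fun x _ st => ?_).trans ?_
  · simp only [Timed.steps_bind, Dict.steps_lookup, steps_sqrt, Dict.steps_insert, Dict.val_lookup,
      val_sqrt, Timed.steps_pure]
    have := headTail_steps (σ := σ) hr √(tailCount.get x) (groups.get x) st.out
    omega
  · induction groups.keys with
    | nil => simp
    | cons x l ih =>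
      simp only [List.map_cons, List.sum_cons, List.length_cons, mul_add] at ih ⊢
      omega

/-! ### Running time of the count queries -/

section Counts

variable [Fintype κ] [DecidableEq κ] [DecidableEq V] {σ : Schema r κ} (S : σ.Database V)

theorem countRows_steps (i : Fin r) : (countRows S i).steps ≤ 1 + 5 * (S i).length := by
  refine (loop_steps_le_const 4 _ _ _ fun t _ d => by simp).trans ?_
  omega

theorem computeTheta_steps (d : KeyDict κ V ℝ) (bs : List (Counts₁ r κ V)) :
    (computeTheta σ d bs).steps ≤ 1 + d.keys.length * (4 + 4 * bs.length) := by
  refine (loop_steps_le_const (3 + 4 * bs.length) _ _ _ fun x _ d' => ?_).trans ?_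
  · simp only [Timed.steps_bind, Dict.steps_lookup, Dict.steps_insert]
    have := loop_steps_le_const 3 (fun c (b : Counts₁ r κ V) => do
      let y ← project (σ.key b.idx) x
      let f ← b.down.lookup y
      mul c f) bs (d.get x) fun b _ c => by simp
    simp only [Dict.val_lookup]
    omega
  · rw [← add_assoc]

theorem sumOver_steps (X : Finset κ) (d : KeyDict κ V ℝ) :
    (sumOver X d).steps ≤ 1 + 6 * d.keys.length := by
  refine (loop_steps_le_const 5 _ _ _ fun t _ d => by simp).trans ?_
  omega

theorem applyUp_steps (X : Finset κ) (d e : KeyDict κ V ℝ) :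
    (applyUp X d e).steps ≤ 1 + 6 * e.keys.length := by
  refine (loop_steps_le_const 5 _ _ _ fun t _ d => by simp).trans ?_
  omega

variable {S} in
theorem CountsSpec₁.length_roots {p : Fin r} {F : Forest (Fin r)} {G : Forest (Counts₁ r κ V)}
    (h : CountsSpec₁ S p F G) : G.roots.length = F.roots.length := by
  induction F generalizing G p with
  | nil => cases G <;> simp_all [CountsSpec₁, Forest.roots]
  | node i cs rest _ ih =>
    cases G with
    | nil => simp [CountsSpec₁] at h
    | node b cs' rest' => simp [Forest.roots, ih h.2.2.2.2.2]

theorem pass₁_steps (hS : ∀ i, 0 < (S i).length) (p : Fin r) {F : Forest (Fin r)}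
    (hF : F.labels.Nodup) :
    (pass₁ S p F).steps ≤
      1 + (F.labels.map fun i => 24 * ((S i).length * (numCols σ + r))).sum := by
  induction F generalizing p with
  | nil => simp [pass₁]
  | node i cs rest ih₁ ih₂ =>
    have hlab : (i :: cs.labels ++ rest.labels).Nodup := hF
    rw [List.nodup_append'] at hlab
    have hcs := (List.nodup_cons.1 hlab.1).2
    have h1 := ih₁ i hcs
    have h2 := ih₂ p hlab.2.1
    have hspec := pass₁_val S i cs
    have v1 := countRows_val S i
    have v2 := computeTheta_val S hspec v1
    have t1 := countRows_steps S i
    have t2 := computeTheta_steps (σ := σ) (countRows S i).val (pass₁ S i cs).val.roots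
    have t3 := sumOver_steps (σ.key p)
      (computeTheta σ (countRows S i).val (pass₁ S i cs).val.roots).val
    rw [v1.length_keys, hspec.length_roots] at t2
    rw [v2.length_keys] at t3
    have hk := card_keyTuples_le S i
    have hr := length_roots_le_of_nodup hcs
    have hn := hS i
    have hr0 : 0 < r := i.pos
    have m1 : (keyTuples S i).card * (4 + 4 * cs.roots.length) ≤
        (S i).length * (8 * (numCols σ + r)) := Nat.mul_le_mul hk (by omega)
    have m2 : (S i).length ≤ (S i).length * (numCols σ + r) := Nat.le_mul_of_pos_right _ (by omega)
    have m3 : (S i).length * (8 * (numCols σ + r)) = 8 * ((S i).length * (numCols σ + r)) := by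
      ring
    simp only [pass₁, Timed.steps_bind, steps_tick, Timed.steps_pure, Forest.labels, List.map_cons,
      List.sum_cons, List.map_append, List.sum_append]
    omega

/-- The cost at a node involves the key tuples of its parent, so it cannot be charged to the rows of
the node. A charge of `28 * M` per node still gives a total of order `M * r`. -/
theorem pass₂_steps {M : ℕ} (hM : 0 < M) (hSM : ∀ i, (S i).length ≤ M) {p : Fin r}
    {full : KeyTuple κ V → ℝ} {d : KeyDict κ V ℝ} {F : Forest (Fin r)}
    {G : Forest (Counts₁ r κ V)}
    (hd : d.Represents (keyTuples S p) full) (h : CountsSpec₁ S p F G) :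
    (pass₂ σ p d G).steps ≤ 1 + F.labels.length * (28 * M) := by
  induction F generalizing p full d G with
  | nil => cases G <;> simp_all [CountsSpec₁, pass₂]
  | node i cs rest ih₁ ih₂ =>
    cases G with
    | nil => simp [CountsSpec₁] at h
    | node b cs' rest' =>
      obtain ⟨h1, h2, h3, h4, h5, h6⟩ := h
      subst h1
      have hsums := sumOver_val (σ.key b.idx) hd
      have hup := sumOver_divide_val S hd h4.get_eq
      have hfull := applyUp_val (σ.key p) h3
        (fun x hx => by simp [joinTree_eq_zero S cs hx]) hup.get_eq
      have i1 := ih₁ hfull h5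
      have i2 := ih₂ hd h6
      have t1 := sumOver_steps (σ.key b.idx) d
      have t2 := divide_steps (sumOver (σ.key b.idx) d).val b.down
      have t3 := applyUp_steps (σ.key p) (divide (sumOver (σ.key b.idx) d).val b.down).val b.theta
      have t4 := divide_steps (applyUp (σ.key p)
        (divide (sumOver (σ.key b.idx) d).val b.down).val b.theta).val b.rowsPerKey
      rw [hd.length_keys] at t1
      rw [hsums.length_keys] at t2
      rw [h3.length_keys] at t3
      rw [hfull.length_keys] at t4
      have k1 := (card_keyTuples_le S p).trans (hSM p)
      have k2 := (card_keyTuples_le S b.idx).trans (hSM b.idx)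
      have k3 : ((keyTuples S p).image (restrict (σ.key b.idx))).card ≤ M :=
        Finset.card_image_le.trans k1
      simp only [pass₂, Timed.steps_bind, steps_tick, Timed.steps_pure, Forest.labels,
        List.length_cons, List.length_append, add_mul, one_mul]
      omega

end Counts

/-! ### Running time of the recursion -/

section Algorithm

variable [Fintype κ] [DecidableEq κ] [DecidableEq V] {σ : Schema r κ} (S : σ.Database V)

theorem headsAndTails_steps (hr : 0 < r) (b : Counts₂ r κ V) (hS : 0 < (S b.idx).length)
    (out : List σ.Row) :
    (headsAndTails S b out).steps ≤ 44 * ((S b.idx).length * (numCols σ + r)) := by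
  have hg := groupRows_val S b.idx
  have t1 : (groupRows S b.idx).steps ≤
      1 + (S b.idx).length * (1 + (4 + 6 * (numCols σ + r))) :=
    loop_steps_le_const _ _ _ _ fun t _ d => by
      simp only [Timed.steps_bind, Dict.steps_lookup, steps_keyOf, Dict.steps_insert, steps_push]
      have := padRow_steps (σ := σ) hr t
      omega
  have t2 := reduceGroups_steps hr (groupRows S b.idx).val b.circ b.rowsPerKey out
  have hsum : ((groupRows S b.idx).val.keys.map fun x =>
      ((groupRows S b.idx).val.get x).length).sum = (S b.idx).length := by
    rw [hg.sum_keys, ← sum_length_filter (keyTuple (σ := σ) (i := b.idx)) (S b.idx)]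
    simp [hg.get_eq, keyTuples]
  rw [hsum, hg.length_keys] at t2
  have hk := card_keyTuples_le S b.idx
  have m1 : (S b.idx).length * (1 + (4 + 6 * (numCols σ + r))) ≤
      (S b.idx).length * (11 * (numCols σ + r)) := Nat.mul_le_mul le_rfl (by omega)
  have m2 : (S b.idx).length ≤ (S b.idx).length * (numCols σ + r) :=
    Nat.le_mul_of_pos_right _ (by omega)
  have m3 : (S b.idx).length * (11 * (numCols σ + r)) =
    11 * ((S b.idx).length * (numCols σ + r)) := by ring
  have m4 : 22 * (numCols σ + r) * (S b.idx).length =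
    22 * ((S b.idx).length * (numCols σ + r)) := by ring
  simp only [headsAndTails, Timed.steps_bind]
  omega

theorem projectAway_steps (hr : 0 < r) (p : Fin r) (b : Counts₂ r κ V) (st : State σ V) :
    (projectAway p b st).steps ≤ 2 + 38 * (st.data.keys.length * (numCols σ + r)) := by
  set groups : Timed (KeyDict κ V (List (ℝ × σ.Row))) := loop (fun d x => do
    let y ← project (σ.key p) x
    let v ← st.scales.lookup x
    let w ← st.data.lookup x
    let g ← d.lookup y
    let g' ← push g (v, w)
    d.insert y g') st.data.keys (Dict.empty ([] : List (ℝ × σ.Row))) with hgroups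
  have e : projectAway p b st = groups >>= fun groups => reduceGroups groups b.up b.down st.out :=
    rfl
  have hg : groups.val.Represents (∅ ∪ (st.data.keys.map (restrict (σ.key p))).toFinset) fun y =>
      (st.data.keys.filter (restrict (σ.key p) · = y)).foldl
        (fun b x => b ++ [(st.scales.get x, st.data.get x)]) [] := by
    rw [hgroups, loop_val]
    exact (Dict.represents_empty ([] : List (ℝ × σ.Row))).foldl_insert
      (restrict (σ.key p)) (fun x b => b ++ [(st.scales.get x, st.data.get x)]) st.data.keys
  have t1 : groups.steps ≤ 1 + st.data.keys.length * (1 + 6) :=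
    loop_steps_le_const _ _ _ _ fun t _ d => by simp
  have t2 := reduceGroups_steps hr groups.val b.up b.down st.out
  have hsum : (groups.val.keys.map fun x => (groups.val.get x).length).sum =
      st.data.keys.length := by
    rw [hg.sum_keys, ← sum_length_filter (restrict (σ.key p)) st.data.keys]
    simp only [hg.get_eq, foldl_append_singleton]
    simp
  have hlen : groups.val.keys.length ≤ st.data.keys.length := by
    rw [hg.length_keys, Finset.empty_union]
    simpa using List.toFinset_card_le (st.data.keys.map (restrict (σ.key p)))
  rw [hsum] at t2
  have m2 : st.data.keys.length ≤ st.data.keys.length * (numCols σ + r) :=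
    Nat.le_mul_of_pos_right _ (by omega)
  have m4 : 22 * (numCols σ + r) * st.data.keys.length =
    22 * (st.data.keys.length * (numCols σ + r)) := by ring
  rw [e, Timed.steps_bind]
  omega

/-- The product of all scales but one is a single quotient, and the subtrees of the children are
disjoint, so the work per key tuple stays linear in `numCols σ + r`. -/
theorem joinChildren_steps (hr : 0 < r) (i : Fin r) (bs : List (Result σ V))
    (hbs : (bs.flatMap Result.nodes).Nodup) (hlen : bs.length ≤ r) (st : State σ V) :
    (joinChildren i bs st).steps ≤ 1 + 23 * (st.data.keys.length * (numCols σ + r)) := by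
  have hw := width_le_numCols σ i
  refine (loop_steps_le_const (22 * (numCols σ + r)) _ _ _ fun x _ st' => ?_).trans ?_
  · have t1 : ∀ c, (loop (fun p (b : Result σ V) => do
        let y ← project (σ.key b.idx) x
        let f ← b.scales.lookup y
        mul p f) bs c).steps ≤ 1 + bs.length * (1 + 3) := fun c =>
      loop_steps_le_const _ _ _ _ fun b _ c => by simp
    have t2 : ∀ (sp : ℝ) (w : σ.Row), (loop (fun w (b : Result σ V) => do
        let y ← project (σ.key b.idx) x
        let f ← b.scales.lookup y
        let g ← div sp f
        let u ← b.data.lookup y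
        loop (fun w k => do
          let blk ← tabulate fun c => do
            let a ← cell u k c
            mul a g
          setBlock w k blk) b.nodes w) bs w).steps ≤
        1 + (bs.map fun b => 1 + (5 + (b.nodes.map fun k => 3 + 3 * σ.width k).sum)).sum := by
      intro sp w
      refine loop_steps_le_sum _ _ _ _ fun b _ w => ?_
      simp only [Timed.steps_bind, steps_project, Dict.steps_lookup, steps_div]
      have t3 : ∀ (u : σ.Row) (g : ℝ), (loop (fun w k => do
          let blk ← tabulate fun c => do
            let a ← cell u k c
            mul a g
          setBlock w k blk) b.nodes w).steps ≤
          1 + (b.nodes.map fun k => 1 + (2 + 3 * σ.width k)).sum := fun u g =>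
        loop_steps_le_sum _ _ _ _ fun k _ w => by
          simp only [Timed.steps_bind, steps_tabulate, steps_cell, steps_mul, Finset.sum_const,
            Finset.card_univ, Fintype.card_fin, smul_eq_mul, steps_setBlock]
          omega
      have t4 := t3 (b.data.get (project (σ.key b.idx) x).val)
        (sp / b.scales.get (project (σ.key b.idx) x).val)
      simp only [← add_assoc, show 1 + 2 = 3 from rfl] at t4
      simp only [Dict.val_lookup, val_div]
      omega
    have hsum : (bs.map fun b => 1 + (5 + (b.nodes.map fun k => 3 + 3 * σ.width k).sum)).sum =
        6 * bs.length + ((bs.flatMap Result.nodes).map fun k => 3 + 3 * σ.width k).sum := by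
      clear t1 t2 hbs hlen
      induction bs with
      | nil => simp
      | cons b bs ih =>
        simp only [List.map_cons, List.sum_cons, List.length_cons, List.flatMap_cons,
          List.map_append, List.sum_append, ih]
        ring
    have hsum' := sum_width_le σ hbs
    simp only [Timed.steps_bind, Dict.steps_lookup, steps_mul, steps_setBlock, Dict.steps_insert,
      Timed.steps_pure, steps_tabulate, steps_cell, Finset.sum_const, Finset.card_univ,
      Fintype.card_fin, smul_eq_mul]
    refine (Nat.add_le_add_left (Nat.add_le_add_left (Nat.add_le_add (t1 _)
      (Nat.add_le_add_left (Nat.add_le_add_left (Nat.add_le_add_left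
        (Nat.add_le_add_right (t2 _ _) _) _) _) _)) _) _).trans ?_
    rw [hsum]
    omega
  · have m : st.data.keys.length * (1 + 22 * (numCols σ + r)) ≤
        st.data.keys.length * (23 * (numCols σ + r)) := Nat.mul_le_mul le_rfl (by omega)
    have m3 : st.data.keys.length * (23 * (numCols σ + r)) =
      23 * (st.data.keys.length * (numCols σ + r)) := by ring
    omega

theorem ResultSpec.length_eq {p : Fin r} {F : Forest (Fin r)} {bs : List (Result σ V)}
    (h : ResultSpec S p F bs) : bs.length = F.roots.length := by
  induction F generalizing bs p with
  | nil => cases bs <;> simp_all [ResultSpec, Forest.roots]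
  | node i cs rest _ ih =>
    cases bs with
    | nil => simp [ResultSpec] at h
    | cons b bs => simp [Forest.roots, ih h.2.2.2.2]

theorem ResultSpec.joinChildren_steps {i : Fin r} {cs : Forest (Fin r)}
    {bs : List (Result σ V)} (h : ResultSpec S i cs bs) (hcs : cs.labels.Nodup)
    {st : State σ V} (hst : st.data.keys.length ≤ (S i).length) :
    (joinChildren i bs st).steps ≤ 1 + 23 * ((S i).length * (numCols σ + r)) :=
  (Figaro.joinChildren_steps i.pos i bs ((h.nodes_perm S).nodup_iff.2 hcs)
    (by rw [h.length_eq S]; exact length_roots_le_of_nodup hcs) st).trans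
    (Nat.add_le_add_left (Nat.mul_le_mul_left _ (Nat.mul_le_mul_right _ hst)) _)

variable {S}

theorem finishNode_steps (hS : Matched S) (p : Fin r) (b : Counts₂ r κ V)
    {cs : Forest (Fin r)} {bs : List (Result σ V)} (h : ResultSpec S b.idx cs bs)
    (hcs : (b.idx :: cs.labels).Nodup) {st : State σ V}
    (hst : StateSpec st.data st.scales (keyTuples S b.idx) (group S b.idx)) (out : List σ.Row) :
    (finishNode p b bs st out).steps ≤ 3 + 61 * ((S b.idx).length * (numCols σ + r)) := by
  cases bs with
  | nil => simp [finishNode]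
  | cons b' bs =>
    have hk := card_keyTuples_le S b.idx
    have t1 := h.joinChildren_steps S (List.nodup_cons.1 hcs).2 (st := ⟨st.data, st.scales, out⟩)
      (by rw [hst.data.length_keys]; exact hk)
    have v1 := joinChildren_val S h hcs (fun x hx => hS.card_joinForest_ne_zero cs hx)
      (st := ⟨st.data, st.scales, out⟩) hst
    have t2 := projectAway_steps b.idx.pos p b
      (joinChildren b.idx (b' :: bs) ⟨st.data, st.scales, out⟩).val
    rw [v1.1.data.length_keys] at t2
    have m := Nat.mul_le_mul_right (numCols σ + r) hk
    simp only [finishNode, Timed.steps_bind]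
    omega

/-- Of the 117, heads and tails use 44 and `finishNode` 61. The remaining 12 cover the collection of
labels, at most `1 + 4 * r` steps, and the additive constants; this works because the relation has
at least one row. -/
theorem processForest_steps (hS : Matched S) (hpos : ∀ i, 0 < (S i).length) {p : Fin r}
    {full : KeyTuple κ V → ℝ} (hfull : ∀ x, 0 ≤ full x) {F : Forest (Fin r)}
    {G : Forest (Counts₂ r κ V)} (hG : CountsSpec₂ S p full F G) (hF : F.labels.Nodup)
    (hleaf : LeafKeys σ p F) (out : List σ.Row) :
    (processForest S p G out).steps ≤
      1 + (F.labels.map fun i => 117 * ((S i).length * (numCols σ + r))).sum := by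
  induction F generalizing p full G out with
  | nil =>
    cases G with
    | node b cs rest => simp [CountsSpec₂] at hG
    | nil => simp [processForest]
  | node i cs rest ih₁ ih₂ =>
    cases G with
    | nil => simp [CountsSpec₂] at hG
    | node b cs' rest' =>
      obtain ⟨hb, hrows, hdown, hup, hcirc, hG₁, hG₂⟩ := hG
      subst hb
      obtain ⟨hl1, hl2, hl3⟩ := hleaf
      have hlab : (b.idx :: cs.labels ++ rest.labels).Nodup := hF
      rw [List.nodup_append'] at hlab
      have hcs := (List.nodup_cons.1 hlab.1).2
      have hfull' := fullCount_nonneg S (p := p) (i := b.idx) (cs := cs) hfull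
      have h1 := (headsAndTails_val S rfl hrows
        (fun x => by rw [hcirc]; exact div_nonneg (hfull' x) (Nat.cast_nonneg _)) out).1
      have c1 := (processForest_val hS hfull' hG₁ hcs hl2 (headsAndTails S b out).val.out).1
      have t1 := headsAndTails_steps S b.idx.pos b (hpos _) out
      have t2 := ih₁ hfull' hG₁ hcs hl2 (headsAndTails S b out).val.out
      have t3 := collectNodes_steps b.idx
        (processForest S b.idx cs' (headsAndTails S b out).val.out).val.1
      have t4 := finishNode_steps hS p b c1 hlab.1 h1
        (processForest S b.idx cs' (headsAndTails S b out).val.out).val.2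
      have t5 := ih₂ hfull hG₂ hlab.2.1 hl3 (finishNode p b
        (processForest S b.idx cs' (headsAndTails S b out).val.out).val.1
        (headsAndTails S b out).val
        (processForest S b.idx cs' (headsAndTails S b out).val.out).val.2).val.out
      rw [c1.length_eq S, (c1.nodes_perm S).length_eq] at t3
      have n1 := length_roots_le_of_nodup hcs
      have n2 : cs.labels.length ≤ r := by simpa using hcs.length_le_card
      have hr : 0 < r := b.idx.pos
      have m1 : numCols σ + r ≤ (S b.idx).length * (numCols σ + r) :=
        Nat.le_mul_of_pos_left _ (hpos _)
      rw [processForest_node]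
      simp only [Timed.steps_bind, steps_tick, Timed.steps_pure, Forest.labels, List.map_cons,
        List.sum_cons, List.map_append, List.sum_append]
      omega

theorem sum_labels {τ : RootedTree (Fin r)} (hnd : τ.labels.Nodup) (hmem : ∀ i, i ∈ τ.labels)
    (f : Fin r → ℕ) : f τ.root + (τ.children.labels.map f).sum = ∑ i, f i := by
  rw [← show τ.labels.toFinset = Finset.univ by ext; simp [hmem], List.sum_toFinset _ hnd]
  rfl

theorem figaro_steps (hS : Matched S) (hpos : ∀ i, 0 < (S i).length) {τ : RootedTree (Fin r)}
    (hnd : τ.labels.Nodup) (hmem : ∀ i, i ∈ τ.labels) (hleaf : LeafKeys σ τ.root τ.children) :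
    (figaro S τ).steps ≤ 300 * (numRows S * (numCols σ + r)) := by
  obtain ⟨hb, hrows, hcirc, hG⟩ := computeCounts_val S τ
  have hn : (τ.root :: τ.children.labels).Nodup := hnd
  have hcs := (List.nodup_cons.1 hn).2
  have hr : 0 < r := τ.root.pos
  have hle : ∀ i, (S i).length ≤ numRows S := fun i =>
    Finset.single_le_sum (f := fun i => (S i).length) (fun _ _ => Nat.zero_le _)
      (Finset.mem_univ i)
  have hM : 0 < numRows S := (hpos τ.root).trans_le (hle _)
  have hlen : τ.children.labels.length ≤ r := by simpa using hcs.length_le_card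
  have hsum : ∀ c : ℕ, c * ((S τ.root).length * (numCols σ + r)) +
      (τ.children.labels.map fun i => c * ((S i).length * (numCols σ + r))).sum =
        c * (numRows S * (numCols σ + r)) := fun c => by
    rw [sum_labels hnd hmem fun i => c * ((S i).length * (numCols σ + r)), ← Finset.mul_sum,
      ← Finset.sum_mul, numRows]
  have m0 : numRows S ≤ numRows S * (numCols σ + r) := Nat.le_mul_of_pos_right _ (by omega)
  have mroot : (S τ.root).length * (numCols σ + r) ≤ numRows S * (numCols σ + r) :=
    Nat.mul_le_mul_right _ (hle _)
  have hkeys := (card_keyTuples_le S τ.root).trans (hle τ.root)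
  have hcounts : (computeCounts S τ).steps ≤ 100 * (numRows S * (numCols σ + r)) := by
    have h1 := countRows_val S τ.root
    have h0 := pass₁_val S τ.root τ.children
    have h2 := computeTheta_val S h0 h1
    have t1 := pass₁_steps S hpos τ.root hcs
    have t2 := countRows_steps S τ.root
    have t3 := computeTheta_steps (σ := σ) (countRows S τ.root).val
      (pass₁ S τ.root τ.children).val.roots
    have t4 := divide_steps (computeTheta σ (countRows S τ.root).val
      (pass₁ S τ.root τ.children).val.roots).val (countRows S τ.root).val
    have t5 := pass₂_steps S hM hle h2 h0
    rw [h1.length_keys, h0.length_roots] at t3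
    rw [h2.length_keys] at t4
    have hroots := length_roots_le_of_nodup hcs
    have m1 : (keyTuples S τ.root).card * (4 + 4 * τ.children.roots.length) ≤
        numRows S * (8 * (numCols σ + r)) := Nat.mul_le_mul hkeys (by omega)
    have m2 : τ.children.labels.length * (28 * numRows S) ≤
        (numCols σ + r) * (28 * numRows S) := Nat.mul_le_mul_right _ (by omega)
    have e1 : numRows S * (8 * (numCols σ + r)) = 8 * (numRows S * (numCols σ + r)) := by ring
    have e2 : (numCols σ + r) * (28 * numRows S) = 28 * (numRows S * (numCols σ + r)) := by ring
    have e3 := hsum 24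
    have := hle τ.root
    simp only [computeCounts, Timed.steps_bind, steps_tick, Timed.steps_pure]
    omega
  set t := (computeCounts S τ).val with ht
  have h1 := (headsAndTails_val S hb hrows (fun x => by rw [hcirc]; positivity) []).1
  have c1 := (processForest_val hS (fun x => by positivity) hG hcs hleaf
    (headsAndTails S t.root []).val.out).1
  have t1 := headsAndTails_steps S t.root.idx.pos t.root (hpos _) []
  have t2 := processForest_steps hS hpos (fun x => by positivity) hG hcs hleaf
    (headsAndTails S t.root []).val.out
  rw [← hb] at c1 t2
  have t3 := c1.joinChildren_steps S hcs (st := ⟨(headsAndTails S t.root []).val.data,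
    (headsAndTails S t.root []).val.scales, (processForest S t.root.idx t.children
      (headsAndTails S t.root []).val.out).val.2⟩)
    (by rw [h1.data.length_keys, hb]; exact card_keyTuples_le S _)
  have j := (joinChildren_val S (st := ⟨(headsAndTails S t.root []).val.data,
    (headsAndTails S t.root []).val.scales, (processForest S t.root.idx t.children
      (headsAndTails S t.root []).val.out).val.2⟩) c1 (hb ▸ hn)
    (fun x hx => hS.card_joinForest_ne_zero _ hx) (hb ▸ h1)).1
  have t4 : ∀ (st : State σ V), (loop (fun out x => do
      let w ← st.data.lookup x
      push out w) st.data.keys st.out).steps ≤ 1 + st.data.keys.length * (1 + 2) := fun st =>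
    loop_steps_le_const _ _ _ _ fun x _ out => by simp
  have t5 := t4 (joinChildren t.root.idx (processForest S t.root.idx t.children
    (headsAndTails S t.root []).val.out).val.1 ⟨(headsAndTails S t.root []).val.data,
      (headsAndTails S t.root []).val.scales, (processForest S t.root.idx t.children
      (headsAndTails S t.root []).val.out).val.2⟩).val
  rw [j.data.length_keys] at t5
  have e3 := hsum 117
  simp only [figaro, Timed.steps_bind, steps_tick, ← ht]
  rw [hb] at *
  omega

end Algorithm

/-! ## The output matrix -/

section Output

variable {σ : Schema r κ}

/-- The linear functional on rows with the coefficients `z`. -/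
def rowFunctional (z : σ.Col → ℝ) : σ.Row →ₗ[ℝ] ℝ where
  toFun w := ∑ c : σ.Col, w c.1 c.2 * z c
  map_add' v w := by simp [add_mul, Finset.sum_add_distrib]
  map_smul' a w := by simp [Finset.mul_sum, mul_assoc]

theorem rowFunctional_apply (z : σ.Col → ℝ) (w : σ.Row) :
    rowFunctional z w = ∑ c : σ.Col, w c.1 c.2 * z c := rfl

theorem sum_sq_stackZero {R : List σ.Row} {m : ℕ} (h : R.length ≤ m) (z : σ.Col → ℝ) :
    ∑ a, (stackZero R m).mulVec z a ^ 2 = sumSq (rowFunctional z) R := by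
  obtain ⟨n, rfl⟩ := Nat.exists_eq_add_of_le h
  rw [Fin.sum_univ_add, add_eq_left.2]
  · simp only [sumSq, Multiset.map_coe, Multiset.sum_coe]
    rw [← Fin.sum_univ_fun_getElem R fun w => rowFunctional z w ^ 2]
    refine Finset.sum_congr rfl fun a _ => ?_
    simp [Matrix.mulVec, dotProduct, stackZero, rowFunctional_apply]
  · refine Finset.sum_eq_zero fun a _ => ?_
    simp [Matrix.mulVec, dotProduct, stackZero]

theorem sum_sq_joinMatrix {S : σ.Database V} {m : ℕ} (e : Fin m ≃ natJoin S) (z : σ.Col → ℝ) :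
    ∑ a, (joinMatrix e).mulVec z a ^ 2 =
      sumSq (rowFunctional z) (Finset.univ.val.map fun a => (e a).1.2) := by
  rw [sumSq, Multiset.map_map, Finset.sum]
  congr 1

/-- One input tuple extends to a join tuple, which projects into every relation. -/
theorem length_pos_of_numRows_pos {S : σ.Database V} (hS : FullyReduced S) (h : 0 < numRows S)
    (i : Fin r) :
    0 < (S i).length := by
  obtain ⟨j, -, hj⟩ := Finset.exists_ne_zero_of_sum_ne_zero h.ne'
  obtain ⟨t, ht⟩ := List.exists_mem_of_length_pos (Nat.pos_of_ne_zero hj)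
  obtain ⟨u, hu, -⟩ := hS j t ht
  exact List.length_pos_of_mem (hu i)

end Output

end Figaro

/-! ### Assembly of the statements -/

theorem mainTheorem1 :
    ∃ C : ℕ, ∀ (r : ℕ) (κ V : Type) [Fintype κ] [DecidableEq κ] [DecidableEq V]
      (σ : Figaro.Schema r κ) (S : σ.Database V) (τ : Figaro.RootedTree (Fin r)),
      (∀ i, (S i).Nodup) →
      Figaro.FullyReduced S →
      Figaro.IsJoinTree σ τ →
      let R₀ := (Figaro.figaro S τ).val
      let time := (Figaro.figaro S τ).steps
      let M := Figaro.numRows S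
      let N := Figaro.numCols σ
      -- the running time
      (0 < M →
        time ≤ C * (M * (N + r)) ∧
        (0 < N → time ≤ C * r * (M * N)) ∧
        ((∀ i, 0 < σ.width i) → time ≤ C * (M * N))) ∧
      -- the number of rows
      R₀.length ≤ M ∧
      -- the decomposition, for the rows of the join output in any order `e`
      ∀ (m : ℕ) (e : Fin m ≃ Figaro.natJoin S),
        R₀.length ≤ m ∧
        (∃ Q ∈ Matrix.orthogonalGroup (Fin m) ℝ,
          Figaro.joinMatrix e = Q * Figaro.stackZero R₀ m) ∧
        ∃ (G : List (Matrix (Fin m) (Fin m) ℝ)) (π : Equiv.Perm (Fin m)),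
          (∀ g ∈ G, ∃ (i j : Fin m) (θ : ℝ), i ≠ j ∧ g = Figaro.givens i j θ) ∧
          G.prod * Figaro.joinMatrix e = (Figaro.stackZero R₀ m).submatrix π id := by
  -- The constant is twice the 300 of `figaro_steps`: `N + r ≤ 2 * (r * N)` if `N` is positive, and
  -- `N + r ≤ 2 * N` if all widths are.
  refine ⟨600, fun r κ V _ _ _ σ S τ hnd hred hτ => ?_⟩
  intro R₀ time M N
  have hS := hred.matched
  have hr : 0 < r := τ.root.pos
  obtain ⟨⟨new, last, hR, -, hone⟩, hlen, hsq⟩ := Figaro.figaro_val hS hτ.nodup hτ.leafKeys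
  refine ⟨fun hM => ?_, ?_, fun m e => ?_⟩
  · have htime : time ≤ 300 * (M * (N + r)) := Figaro.figaro_steps hS
      (Figaro.length_pos_of_numRows_pos hred hM) hτ.nodup hτ.mem_labels hτ.leafKeys
    refine ⟨htime.trans (Nat.mul_le_mul_right _ (by norm_num)), fun hN => htime.trans ?_,
      fun hw => htime.trans ?_⟩
    · have h1 : N + r ≤ 2 * (r * N) := by nlinarith
      calc 300 * (M * (N + r)) ≤ 300 * (M * (2 * (r * N))) := by gcongr
        _ = 600 * r * (M * N) := by ring
    · have h1 : r ≤ N := by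
        calc r = ∑ _i : Fin r, 1 := by simp
          _ ≤ N := Finset.sum_le_sum fun i _ => hw i
      calc 300 * (M * (N + r)) ≤ 300 * (M * (N + N)) := by gcongr
        _ = 600 * (M * N) := by ring
  · calc R₀.length = (S τ.root).length + Figaro.outLength S τ.root τ.children := hlen
      _ ≤ (S τ.root).length + (τ.children.labels.map fun i => (S i).length).sum :=
        Nat.add_le_add_left (Figaro.outLength_le _ _) _
      _ = M := Figaro.sum_labels hτ.nodup hτ.mem_labels fun i => (S i).length
  · have hrows := Figaro.map_natJoin hnd hred hτ e
    have hcard : (Figaro.joinRows S τ).card = m := by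
      rw [← hrows]
      simp
    have hm : R₀.length ≤ m := by
      rw [← hcard, Figaro.joinRows, Multiset.card_sum]
      exact hlen.trans_le
        (Figaro.length_add_outLength_le hS (Figaro.outLength_add_le hS _ _))
    have hQ : ∃ Q ∈ Matrix.orthogonalGroup (Fin m) ℝ,
        Figaro.joinMatrix e = Q * Figaro.stackZero R₀ m :=
      Figaro.exists_orthogonal_mul_eq _ _ fun z => by
        rw [Figaro.sum_sq_joinMatrix, Figaro.sum_sq_stackZero hm, hrows, hsq]
    refine ⟨hm, hQ, ?_⟩
    -- With one coordinate there are no rotations, so the single output row has to equal the join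
    -- row itself.
    by_cases h1 : m = 1
    · subst h1
      have hlast := hone hcard
      have hR' : R₀ = [(Figaro.joinRows S τ).sum] := by
        have h2 : R₀ = new ++ last := hR
        have h3 : new = [] := by
          rw [h2, hlast, List.length_append, List.length_singleton] at hm
          exact List.eq_nil_of_length_eq_zero (by omega)
        rw [h2, h3, hlast, List.nil_append]
      refine ⟨[], Equiv.refl _, by simp, ?_⟩
      ext a c
      have ha : a = 0 := Subsingleton.elim _ _
      subst ha
      rw [hR', ← hrows]
      simp [Figaro.joinMatrix, Figaro.stackZero]
    · obtain ⟨Q, hQ, hA⟩ := hQ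
      rw [hA]
      exact Figaro.exists_givens_eq_submatrix h1 hQ _
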